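/- Consider combinatorial maps (graphs with a cyclic permutation of the half-edges around each vertex), possibly disconnected, drawn on the sphere. Vertices are labelled, and vertices of valency zero are allowed. A disconnected map consists of planar connected components, together with the data of which faces of which components are glued together into the regions of the complement of the graph in the sphere. A region is a monogon if it is a single face with exactly one incident edge side; if it also touches another connected component of the graph (for example a vertex of valency zero), it is not a monogon. Two maps are identified if they are related by an isomorphism that fixes each vertex and preserves half-edges, edges, cyclic permutations and regions. Let $r_1,r_2,r_3,r_4\in\frac12\mathbb{N}$ (with $0\in\mathbb N$), and let $\mathcal{M}_{0,4}(r_1,r_2,r_3,r_4)$ be the set of planar maps without monogons with four vertices, of valencies $2r_1,2r_2,2r_3,2r_4$. Let $Z_{0,4}(k)=0$ for $0\le k\leq 3$ and $Z_{0,4}(4)=1$. Then: 1. if all $r_i$ are integers, then $$|\mathcal{M}_{0,4}(r_1,\dots,r_4)| = \sum_{i=1}^4 r_i^2+2-Z_{0,4}\left(\#\{i\mid r_i=0\}\right) = \sum_{i=1}^4 r_i^2+2-\prod_{i=1}^4\delta_{r_i,0}\ ;$$ 2. if exactly two of the $r_i$ belong to $\mathbb{N}+\frac12$, then $$|\mathcal{M}_{0,4}(r_1,\dots,r_4)|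 = \sum_{i=1}^4 \lfloor r_i^2\rfloor+1\ ;$$ 3. if all four $r_i$ belong to $\mathbb{N}+\frac12$, then $$|\mathcal{M}_{0,4}(r_1,\dots,r_4)| = \sum_{i=1}^4 \lfloor r_i^2\rfloor+3\ .$$ -/

import Mathlib

/-- The half-edges of a graph on the labelled vertices `0, …, n - 1` with prescribed valencies:
`d i` half-edges are attached to the vertex `i`, so that `x.1` is the vertex of the half-edge
`x`. Their numbering is immaterial, since maps are counted up to renumbering (`MapIso`). -/
abbrev HalfEdge {n : ℕ} (d : Fin n → ℕ) : Type := Σ i : Fin n, Fin (d i)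

/-- The corners at the vertices. In the surface, a vertex of positive valency is surrounded by as
many corners as it has half-edges: `Sum.inl x` is the corner at the vertex `x.1` that immediately
precedes the half-edge `x` in the cyclic order. A vertex `i` of valency zero has one corner
`Sum.inr i`. -/
abbrev Corner {n : ℕ} (d : Fin n → ℕ) : Type := HalfEdge d ⊕ {i : Fin n // d i = 0}

/-- The vertex at which a corner lies. -/
def Corner.vertex {n : ℕ} {d : Fin n → ℕ} : Corner d → Fin n
  | .inl x => x.1
  | .inr i => i.1

/-- A combinatorial map, not necessarily connected, on labelled vertices with valencies `d i`,
together with a way of gluing faces of its connected components.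

* `rot` is the cyclic permutation of the half-edges around each vertex.
* `opp` exchanges the two half-edges of each edge.
* `region` says which corners lie in the same region, i.e. in the same connected component of
  the complement of the graph in the surface. Two corners of the same face of a connected
  component of the graph lie in the same region: from the corner preceding `x`, walking along the
  edge of `x` leads to the corner following `opp x`, which precedes `rot (opp x)`.
  A region is thus obtained by gluing one or more faces of the connected components, where a
  component that consists of a single vertex of valency zero has one face. -/
structure CombMap {n : ℕ} (d : Fin n → ℕ) where
  rot : Equiv.Perm (HalfEdge d)
  rot_cyclic : ∀ x y : HalfEdge d, rot.SameCycle x y ↔ x.1 = y.1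
  opp : Equiv.Perm (HalfEdge d)
  opp_opp : ∀ x, opp (opp x) = x
  opp_ne : ∀ x, opp x ≠ x
  region : Setoid (Corner d)
  region_face : ∀ x : HalfEdge d, region (.inl x) (.inl (rot (opp x)))

namespace CombMap

variable {n : ℕ} {d : Fin n → ℕ} (m : CombMap d)

/-- The underlying graph, up to loops and multiple edges. -/
def graph : SimpleGraph (Fin n) :=
  SimpleGraph.fromRel fun i j => ∃ x : HalfEdge d, x.1 = i ∧ (m.opp x).1 = j

/-- The connected components of the graph. -/
abbrev Component : Type := m.graph.ConnectedComponent

/-- The component to which a vertex belongs. -/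
abbrev comp (i : Fin n) : m.Component := m.graph.connectedComponentMk i

/-- Edges: orbits of `opp`. -/
abbrev Edge : Type := Quotient (Equiv.Perm.SameCycle.setoid m.opp)

/-- The step from one corner of a face to the next one. The face of a vertex of valency zero has
only one corner. -/
def faceStep : Equiv.Perm (Corner d) := Equiv.sumCongr (m.opp.trans m.rot) (Equiv.refl _)

/-- Faces of the connected components of the graph: cycles of corners. -/
abbrev Face : Type := Quotient (Equiv.Perm.SameCycle.setoid m.faceStep)

/-- The face of its component to which a corner belongs. -/
abbrev face (c : Corner d) : m.Face := Quotient.mk _ c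

/-- Regions of the surface minus the graph. -/
abbrev Region : Type := Quotient m.region

/-- The component `K` has genus zero: `#vertices - #edges + #faces = 2`. -/
def ComponentPlanar (K : m.Component) : Prop :=
  ({i : Fin n | m.comp i = K}.ncard : ℤ)
    - {e : m.Edge | ∃ x : HalfEdge d, Quotient.mk _ x = e ∧ m.comp x.1 = K}.ncard
    + {f : m.Face | ∃ c : Corner d, m.face c = f ∧ m.comp c.vertex = K}.ncard = 2

/-- The pattern according to which the surface is glued. Its nodes are the connected components of
the graph, their faces, and the regions. Each face is joined to the component that it belongs to
and to the region that it is a part of. (Having faces as nodes ensures that two faces of one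
component that are glued into the same region give rise to a cycle.) -/
def gluingGraph : SimpleGraph (m.Component ⊕ m.Face ⊕ m.Region) :=
  SimpleGraph.fromRel fun a b => ∃ c : Corner d,
    (a = .inl (m.comp c.vertex) ∧ b = .inr (.inl (m.face c))) ∨
    (a = .inr (.inl (m.face c)) ∧ b = .inr (.inr (Quotient.mk _ c)))

/-- The map is planar, i.e. the surface is the sphere: the surface is glued from spheres with
holes, one for each component (with a hole for each face) and one for each region (with a hole for
each of the faces that it is made of), and the gluing pattern is connected and has no cycle. (At
least one vertex is assumed, as the empty map has no component.) -/
def IsPlanar : Prop :=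
  (∀ K : m.Component, m.ComponentPlanar K) ∧ m.gluingGraph.IsTree

/-- There are no monogons: a face with only one incident edge side is never a whole region, i.e.
its region contains another corner (of another component, possibly of a vertex of valency
zero). -/
def NoMonogon : Prop :=
  ∀ x : HalfEdge d, m.rot (m.opp x) = x → ∃ c : Corner d, c ≠ .inl x ∧ m.region (.inl x) c

end CombMap

/-- The action on corners of a renumbering of the half-edges. -/
def cornerMap {n : ℕ} {d : Fin n → ℕ} (e : Equiv.Perm (HalfEdge d)) : Corner d → Corner d :=
  Sum.map e id

/-- Two maps are the same if they are related by a renumbering of the half-edges at each vertex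
that preserves the cyclic permutations, the edges, and the regions. Vertices are labelled, so they
are not permuted. -/
def MapIso {n : ℕ} {d : Fin n → ℕ} (m m' : CombMap d) : Prop :=
  ∃ e : Equiv.Perm (HalfEdge d), (∀ x, (e x).1 = x.1) ∧
    (∀ x, e (m.rot x) = m'.rot (e x)) ∧ (∀ x, e (m.opp x) = m'.opp (e x)) ∧
    ∀ c c', m.region c c' ↔ m'.region (cornerMap e c) (cornerMap e c')

theorem cornerMap_symm {n : ℕ} {d : Fin n → ℕ} (e : Equiv.Perm (HalfEdge d)) (c : Corner d) :
    cornerMap e (cornerMap e.symm c) = c := by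
  rcases c with x | i <;> simp [cornerMap]

theorem cornerMap_trans {n : ℕ} {d : Fin n → ℕ} (e e' : Equiv.Perm (HalfEdge d)) (c : Corner d) :
    cornerMap (e.trans e') c = cornerMap e' (cornerMap e c) := by
  rcases c with x | i <;> simp [cornerMap]

theorem mapIso_refl {n : ℕ} {d : Fin n → ℕ} (m : CombMap d) : MapIso m m :=
  ⟨Equiv.refl _, by simp, by simp, by simp, by simp [cornerMap]⟩

theorem MapIso.symm {n : ℕ} {d : Fin n → ℕ} {m m' : CombMap d} (h : MapIso m m') :
    MapIso m' m := by
  obtain ⟨e, h1, h2, h3, h4⟩ := h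
  refine ⟨e.symm, fun x => ?_, fun x => ?_, fun x => ?_, fun c c' => ?_⟩
  · rw [← h1, e.apply_symm_apply]
  · rw [Equiv.symm_apply_eq, h2, e.apply_symm_apply]
  · rw [Equiv.symm_apply_eq, h3, e.apply_symm_apply]
  · rw [h4, cornerMap_symm, cornerMap_symm]

theorem MapIso.trans {n : ℕ} {d : Fin n → ℕ} {m m' m'' : CombMap d} (h : MapIso m m')
    (h' : MapIso m' m'') : MapIso m m'' := by
  obtain ⟨e, h1, h2, h3, h4⟩ := h
  obtain ⟨e', h1', h2', h3', h4'⟩ := h'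
  refine ⟨e.trans e', fun x => ?_, fun x => ?_, fun x => ?_, fun c c' => ?_⟩
  · simp [h1, h1']
  · simp [h2, h2']
  · simp [h3, h3']
  · rw [h4, h4', cornerMap_trans, cornerMap_trans]

/-- Isomorphism, as an equivalence relation on the planar maps without monogons whose vertices
have valencies `d i`. -/
def planarMapSetoid {n : ℕ} (d : Fin n → ℕ) :
    Setoid {m : CombMap d // m.IsPlanar ∧ m.NoMonogon} where
  r m m' := MapIso m.1 m'.1
  iseqv := ⟨fun m => mapIso_refl m.1, fun h => h.symm, fun h h' => h.trans h'⟩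

/-- The set of planar maps without monogons with `n` labelled vertices (`1 ≤ n`) of valencies
`d 0, …, d (n - 1)`, up to isomorphism. -/
def PlanarMaps {n : ℕ} (d : Fin n → ℕ) : Type := Quotient (planarMapSetoid d)

/-- The correction term for four vertices, as a function of the number `k ≤ 4` of vertices of
valency zero. -/
def Z04 (k : ℕ) : ℤ := if k = 4 then 1 else 0

/-! A map is encoded on its set `D` of corners by a rotation `σ` whose cycles are the vertices, an
involution `τ` whose 2-cycles are the edges, and a partition `R` into regions. The fixed points of
`τ` are marks: corners that carry no half-edge. A vertex of valency zero is a single mark. Planarity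
becomes connectedness together with one linear relation `Euler` between numbers of classes
(`isPlanar_iff`), and the absence of monogons becomes: no class of `R` is a single corner
(`noMonogon_iff`).

Maps with a fixed `σ` are counted by a recursion of Tutte type (`plain_step`). Let `x` be a
half-edge at a distinguished vertex and `y` its partner. Multiplying both `σ` and `τ` by the
transposition of `x` and `y` preserves the face permutation and turns `x`, `y` into marks. If `y` is
at another vertex, the edge is contracted, which leaves one vertex with two marks (`euler_merge`).
If `y` is at the same vertex, the sphere is cut along a loop. Then Euler's formula survives exactly
when the two sides are separated (`euler_cut`); this form of the Jordan curve theorem follows from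
the genus inequality `euler_le`. The result is a pair of maps, each with one mark, so their numbers
multiply (`cnt_cut`).

A mark can be erased, unless it lies in a region with only one other corner, which would become a
monogon. In that case a loop encloses the mark, and cutting it off leaves a vertex with two
half-edges fewer and again a mark at that place. Hence, if `f` is the count without marks, the count
with one mark and `e` half-edges is `g e = f e + f (e - 2) + ⋯`; in the presence of other vertices,
the count with two marks that separate `a` from `b` half-edges is `g (a + b) + g (a + b - 2) + ⋯ + g
|a - b|` (`one_step`, `two_step`).

With these rules, maps with numbered half-edges can be counted for one, two, three and four vertices
in turn. There are none with one vertex. With two vertices, both valencies must equal some `d`, and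
there are `max d 1`. With three there are `∏ max (d i) 1`, provided that the total valency is even.
With four, this product is multiplied by a quarter of the sum of the squares plus `2` or `1/2`,
depending on whether all valencies have the same parity (`plain_triple`). The squares come from the
cubic polynomials of `cum_oneSum_max`. These are odd, so the truncated ranges of summation combine
into one polynomial. If all valencies vanish, there is no half-edge to start from, and the number is
`1` instead of `2`; this is the correction term.

Finally, a map with at least three vertices has no nontrivial automorphism that fixes the vertices
(`rigid`). So the `∏ max (d i) 1` symmetries of the standard rotation act freely, and division by
their number gives the number of isomorphism classes (`card_planarMaps_mul`). For `d i = 2 * r i`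
the quarter of the sum of squares is the sum of the `r i ^ 2`, and each floor of a half-integer
squared takes away `1/4`. -/

namespace SphMap

open Equiv

/-! ### Partitions, orbits and numbers of classes -/

/-- The partition of a set into the orbits of a permutation. -/
abbrev orb {D : Type} (f : Perm D) : Setoid D := Perm.SameCycle.setoid f

/-- The number of classes of a partition. -/
noncomputable def nc {D : Type} (r : Setoid D) : ℕ := Nat.card (Quotient r)

/-- The orbits form the finest partition in which each element is equivalent to its image, so an
inclusion of orbits only has to be tested on one step. -/
theorem orb_le {D : Type} {f : Perm D} {s : Setoid D} : orb f ≤ s ↔ ∀ c, s c (f c) := by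
  refine ⟨fun h c => h ⟨1, by simp⟩, fun h => ?_⟩
  have key : ∀ (i : ℤ) c, s c ((f ^ i) c) := by
    intro i
    induction i using Int.induction_on with
    | zero => intro c; exact s.refl _
    | succ n ih =>
      intro c
      have := s.trans (h c) (ih (f c))
      rwa [← Perm.mul_apply, ← zpow_add_one] at this
    | pred n ih =>
      intro c
      have h1 := h (f⁻¹ c)
      rw [show f (f⁻¹ c) = c from f.apply_symm_apply c] at h1
      have := s.trans (s.symm h1) (ih (f⁻¹ c))
      rwa [← Perm.mul_apply, ← zpow_sub_one] at this
  rintro a b ⟨i, rfl⟩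
  exact key i a

theorem orb_apply {D : Type} (f : Perm D) (c : D) : orb f c (f c) := ⟨1, by simp⟩

/-- The partition obtained by joining the classes of two elements. -/
def glue {D : Type} (r : Setoid D) (x y : D) : Setoid D where
  r a b := r a b ∨ (r a x ∧ r y b) ∨ (r a y ∧ r x b)
  iseqv := by
    refine ⟨fun a => Or.inl (r.refl a), ?_, ?_⟩
    · rintro a b (h | ⟨h, h'⟩ | ⟨h, h'⟩)
      · exact Or.inl (r.symm h)
      · exact Or.inr (Or.inr ⟨r.symm h', r.symm h⟩)
      · exact Or.inr (Or.inl ⟨r.symm h', r.symm h⟩)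
    · rintro a b c (h | ⟨h, h'⟩ | ⟨h, h'⟩) (k | ⟨k, k'⟩ | ⟨k, k'⟩)
      · exact Or.inl (r.trans h k)
      · exact Or.inr (Or.inl ⟨r.trans h k, k'⟩)
      · exact Or.inr (Or.inr ⟨r.trans h k, k'⟩)
      · exact Or.inr (Or.inl ⟨h, r.trans h' k⟩)
      · exact Or.inr (Or.inl ⟨h, k'⟩)
      · exact Or.inl (r.trans h k')
      · exact Or.inr (Or.inr ⟨h, r.trans h' k⟩)
      · exact Or.inl (r.trans h k')
      · exact Or.inr (Or.inr ⟨h, k'⟩)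

theorem glue_iff {D : Type} {r : Setoid D} {x y a b : D} :
    glue r x y a b ↔ r a b ∨ (r a x ∧ r y b) ∨ (r a y ∧ r x b) := Iff.rfl

theorem le_glue {D : Type} (r : Setoid D) (x y : D) : r ≤ glue r x y := fun _ _ h => Or.inl h

theorem glue_rel {D : Type} (r : Setoid D) (x y : D) : glue r x y x y :=
  Or.inr (Or.inl ⟨r.refl _, r.refl _⟩)

theorem glue_le {D : Type} {r s : Setoid D} {x y : D} : glue r x y ≤ s ↔ r ≤ s ∧ s x y := by
  refine ⟨fun h => ⟨(le_glue r x y).trans h, h (glue_rel r x y)⟩, ?_⟩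
  rintro ⟨h, hxy⟩ a b (k | ⟨k, k'⟩ | ⟨k, k'⟩)
  · exact h k
  · exact s.trans (h k) (s.trans hxy (h k'))
  · exact s.trans (h k) (s.trans (s.symm hxy) (h k'))

theorem glue_sup {D : Type} (r s : Setoid D) (x y : D) : glue r x y ⊔ s = glue (r ⊔ s) x y := by
  apply le_antisymm
  · refine sup_le (glue_le.2 ⟨le_sup_left.trans (le_glue _ _ _), glue_rel _ _ _⟩)
      (le_sup_right.trans (le_glue _ _ _))
  · refine glue_le.2 ⟨sup_le_sup_right (le_glue _ _ _) _, ?_⟩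
    exact (le_sup_left : glue r x y ≤ _) (glue_rel r x y)

theorem sup_glue {D : Type} (r s : Setoid D) (x y : D) : r ⊔ glue s x y = glue (r ⊔ s) x y := by
  rw [sup_comm, glue_sup, sup_comm]

theorem glue_eq_self {D : Type} {r : Setoid D} {x y : D} (h : r x y) : glue r x y = r :=
  le_antisymm (glue_le.2 ⟨le_rfl, h⟩) (le_glue _ _ _)

/-- The classes other than that of `y` represent the classes of the glued partition bijectively. -/
theorem nc_glue {D : Type} [Finite D] {r : Setoid D} {x y : D} (h : ¬ r x y) :
    nc r = nc (glue r x y) + 1 := by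
  classical
  let y' : Quotient r := Quotient.mk r y
  have e1 : nc r = Nat.card {q : Quotient r // q ≠ y'} + 1 := by
    rw [← Finite.card_option]
    exact Nat.card_congr (Equiv.optionSubtypeNe y').symm
  rw [e1, nc]
  congr 1
  let F : Quotient r → Quotient (glue r x y) := Quotient.map id (fun a b hab => Or.inl hab)
  refine Nat.card_congr (Equiv.ofBijective (fun q : {q : Quotient r // q ≠ y'} => F q.1) ⟨?_, ?_⟩)
  · rintro ⟨a, ha⟩ ⟨b, hb⟩ hab
    induction a using Quotient.inductionOn with | _ a
    induction b using Quotient.inductionOn with | _ b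
    have ha' : ¬ r a y := fun h => ha (Quotient.sound h)
    have hb' : ¬ r b y := fun h => hb (Quotient.sound h)
    apply Subtype.ext
    apply Quotient.sound
    have : glue r x y a b := Quotient.exact hab
    rcases this with k | ⟨k, k'⟩ | ⟨k, k'⟩
    · exact k
    · exact absurd (r.symm k') hb'
    · exact absurd k ha'
  · intro q
    induction q using Quotient.inductionOn with | _ a
    by_cases ha : r a y
    · refine ⟨⟨Quotient.mk r x, fun h' => h (Quotient.exact h')⟩, ?_⟩
      exact Quotient.sound (Or.inr (Or.inl ⟨r.refl x, r.symm ha⟩))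
    · exact ⟨⟨Quotient.mk r a, fun h' => ha (Quotient.exact h')⟩, rfl⟩

theorem nc_glue_le {D : Type} [Finite D] (r : Setoid D) (x y : D) : nc r ≤ nc (glue r x y) + 1 := by
  by_cases h : r x y
  · rw [glue_eq_self h]; omega
  · exact (nc_glue h).le

theorem nc_eq_one {D : Type} [Nonempty D] {r : Setoid D} (h : r = ⊤) : nc r = 1 := by
  subst h
  have : Nonempty (Quotient (⊤ : Setoid D)) := ⟨Quotient.mk _ (Classical.arbitrary D)⟩
  refine Nat.card_eq_one_iff_unique.2 ⟨⟨fun a b => ?_⟩, this⟩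
  induction a using Quotient.inductionOn
  induction b using Quotient.inductionOn
  exact Quotient.sound trivial

theorem nc_bot {D : Type} : nc (⊥ : Setoid D) = Nat.card D := by
  refine Nat.card_congr (Equiv.ofBijective (Quotient.mk (⊥ : Setoid D)) ⟨fun a b h => ?_, ?_⟩).symm
  · exact Quotient.exact h
  · exact Quotient.mk_surjective

theorem orb_one {D : Type} : orb (1 : Perm D) = ⊥ := by
  apply le_bot_iff.1
  exact orb_le.2 fun c => rfl

theorem pow_path {D : Type} {f g : Perm D} {x y : D} {m : ℕ} (h1 : g x = f y)
    (h : ∀ i, 0 < i → i < m → g ((f ^ i) y) = f ((f ^ i) y)) :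
    ∀ i, 0 < i → i ≤ m → (g ^ i) x = (f ^ i) y := by
  intro i
  induction i with
  | zero => intro h; omega
  | succ i ih =>
    intro _ hi
    rcases Nat.eq_zero_or_pos i with rfl | hp
    · simpa using h1
    · rw [pow_succ', pow_succ', Perm.mul_apply, Perm.mul_apply, ih hp (by omega), h i hp (by omega)]

theorem sameCycle_exists_pow {D : Type} [Finite D] {f : Perm D} {x y : D} (h : f.SameCycle x y) :
    ∃ i, 0 < i ∧ (f ^ i) x = y := by
  obtain ⟨i, hi, _, h⟩ := h.exists_pow_eq''
  exact ⟨i, hi, h⟩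

/-! ### Merging and cutting cycles by a transposition -/

section Swap
variable {D : Type} [DecidableEq D]

theorem mul_swap_left (σ : Perm D) (x y : D) : (σ * swap x y) x = σ y := by simp

theorem mul_swap_right (σ : Perm D) (x y : D) : (σ * swap x y) y = σ x := by simp

theorem mul_swap_other (σ : Perm D) {x y c : D} (hx : c ≠ x) (hy : c ≠ y) :
    (σ * swap x y) c = σ c := by simp [swap_apply_of_ne_of_ne hx hy]

theorem orb_mul_swap_of_sameCycle {σ : Perm D} {x y : D}
    (h : (σ * swap x y).SameCycle x y) : orb (σ * swap x y) = glue (orb σ) x y := by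
  apply le_antisymm
  · refine orb_le.2 fun c => ?_
    by_cases hx : c = x
    · subst hx
      rw [mul_swap_left]
      exact Or.inr (Or.inl ⟨(orb σ).refl _, orb_apply σ y⟩)
    by_cases hy : c = y
    · subst hy
      rw [mul_swap_right]
      exact Or.inr (Or.inr ⟨(orb σ).refl _, orb_apply σ x⟩)
    rw [mul_swap_other σ hx hy]
    exact Or.inl (orb_apply σ c)
  · refine glue_le.2 ⟨orb_le.2 fun c => ?_, h⟩
    have hyx := orb_apply (σ * swap x y) y
    have hxy := orb_apply (σ * swap x y) x
    rw [mul_swap_left] at hxy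
    rw [mul_swap_right] at hyx
    by_cases hx : c = x
    · subst hx
      exact h.trans hyx
    by_cases hy : c = y
    · subst hy
      exact h.symm.trans hxy
    have := orb_apply (σ * swap x y) c
    rwa [mul_swap_other σ hx hy] at this

/-- Powers along the joined cycle. -/
theorem merge_pow {σ : Perm D} {x y : D} (h : ¬ σ.SameCycle x y) {m : ℕ}
    (hmin : ∀ i, 0 < i → i < m → (σ ^ i) y ≠ y) :
    ∀ i, 0 < i → i ≤ m → ((σ * swap x y) ^ i) x = (σ ^ i) y := by
  refine pow_path (mul_swap_left _ _ _) fun i hi him => mul_swap_other _ ?_ (hmin i hi him)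
  rintro hx
  exact h ⟨-(i : ℤ), by rw [← hx]; simp⟩

/-- From `x` the new permutation jumps into the old cycle of `y` and follows it until it reaches
`y`. -/
theorem merge_sameCycle [Finite D] {σ : Perm D} {x y : D} (h : ¬ σ.SameCycle x y) :
    (σ * swap x y).SameCycle x y := by
  have hex : ∃ i, 0 < i ∧ (σ ^ i) y = y := sameCycle_exists_pow (Perm.SameCycle.refl σ y)
  classical
  obtain ⟨h0, h1⟩ := Nat.find_spec hex
  refine ⟨(Nat.find hex : ℕ), ?_⟩
  rw [zpow_natCast, merge_pow h (m := Nat.find hex) ?_ _ h0 le_rfl, h1]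
  intro i hi him hy
  exact Nat.find_min hex him ⟨hi, hy⟩

theorem orb_merge [Finite D] {σ : Perm D} {x y : D} (h : ¬ σ.SameCycle x y) :
    orb (σ * swap x y) = glue (orb σ) x y :=
  orb_mul_swap_of_sameCycle (merge_sameCycle h)

/-- Powers along the separated cycle. -/
theorem cut_pow {σ : Perm D} {x y : D} {m : ℕ}
    (hx : (σ ^ m) y = x) (hmin : ∀ i, 0 < i → i < m → (σ ^ i) y ≠ x) :
    (∀ i, 0 < i → i < m → (σ ^ i) y ≠ y) ∧
    ∀ i, 0 < i → i ≤ m → ((σ * swap x y) ^ i) x = (σ ^ i) y := by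
  have hy : ∀ i, 0 < i → i < m → (σ ^ i) y ≠ y := by
    intro i hi him hiy
    -- A return to `y` after `i` steps would shorten the way from `y` to `x` to `m - i` steps.
    refine hmin (m - i) (by omega) (by omega) ?_
    have : (σ ^ (m - i + i)) y = x := by rw [Nat.sub_add_cancel him.le, hx]
    rwa [pow_add, Perm.mul_apply, hiy] at this
  exact ⟨hy, pow_path (mul_swap_left _ _ _) fun i hi him =>
    mul_swap_other _ (hmin i hi him) (hy i hi him)⟩

theorem cut_sameCycle_iff [Finite D] {σ : Perm D} {x y : D} {m : ℕ} (hm : 0 < m)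
    (hx : (σ ^ m) y = x) (hmin : ∀ i, 0 < i → i < m → (σ ^ i) y ≠ x) (c : D) :
    (σ * swap x y).SameCycle x c ↔ ∃ i, 0 < i ∧ i ≤ m ∧ (σ ^ i) y = c := by
  obtain ⟨hy, hp⟩ := cut_pow hx hmin
  constructor
  · intro h
    obtain ⟨n, hn, hnc⟩ := sameCycle_exists_pow h
    have hmx : ((σ * swap x y) ^ m) x = x := by rw [hp m hm le_rfl, hx]
    have hred : ((σ * swap x y) ^ (n % m)) x = c := by
      rw [← hnc]
      conv_rhs => rw [← Nat.mod_add_div n m, pow_add, pow_mul, Perm.mul_apply]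
      congr 1
      exact (Function.IsFixedPt.perm_pow hmx (n / m)).symm
    rcases Nat.eq_zero_or_pos (n % m) with h0 | h0
    · rw [h0] at hred
      exact ⟨m, hm, le_rfl, by rw [hx]; simpa using hred⟩
    · have hl := (Nat.mod_lt n hm).le
      exact ⟨n % m, h0, hl, by rw [← hp _ h0 hl, hred]⟩
  · rintro ⟨i, hi, him, rfl⟩
    rw [← hp i hi him]
    exact ⟨i, by simp⟩

/-- The new cycle of `x` runs through the old cycle from behind `y` up to the first visit of `x`,
and `y` is not met on this stretch. -/
theorem cut_not_sameCycle [Finite D] {σ : Perm D} {x y : D} (hxy : x ≠ y) (h : σ.SameCycle x y) :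
    ¬ (σ * swap x y).SameCycle x y := by
  have hex : ∃ i, 0 < i ∧ (σ ^ i) y = x := sameCycle_exists_pow h.symm
  classical
  obtain ⟨h0, h1⟩ := Nat.find_spec hex
  have hmin : ∀ i, 0 < i → i < Nat.find hex → (σ ^ i) y ≠ x := by
    intro i hi him hy
    exact Nat.find_min hex him ⟨hi, hy⟩
  rw [cut_sameCycle_iff h0 h1 hmin]
  rintro ⟨i, hi, him, hiy⟩
  rcases him.lt_or_eq with hlt | rfl
  · exact (cut_pow h1 hmin).1 i hi hlt hiy
  · exact hxy (h1.symm.trans hiy)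

theorem orb_cut {σ : Perm D} {x y : D} (h : σ.SameCycle x y) :
    orb σ = glue (orb (σ * swap x y)) x y := by
  have := orb_mul_swap_of_sameCycle (σ := σ * swap x y) (x := x) (y := y)
  rw [mul_assoc, swap_mul_self, mul_one] at this
  exact this h

end Swap

/-! ### Euler's formula under contraction, cutting and deletion of edges -/

/-- Euler's formula for a possibly disconnected map with glued faces: every component is a sphere,
and the gluing pattern is a forest. Here `σ` rotates the corners around the vertices, the orbits of
`τ` are the edges and the marks, and the classes of `R` are the regions. -/
def Euler {D : Type} (σ τ : Perm D) (R : Setoid D) : Prop :=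
  nc (orb σ) + nc (orb τ) + nc R = nc (orb σ ⊔ orb τ) + nc (orb σ ⊔ orb τ ⊔ R) + Nat.card D

theorem nc_le_card {D : Type} [Finite D] (r : Setoid D) : nc r ≤ Nat.card D :=
  Nat.card_le_card_of_surjective _ (Quotient.mk_surjective (s := r))

section
variable {D : Type} [DecidableEq D]

theorem swap_conj_invol {τ : Perm D} {x y : D} (hx : τ x = y) (hy : τ y = x) (c : D) :
    swap x y (τ (swap x y c)) = τ c := by
  by_cases h1 : c = x
  · subst h1; simp [hx, hy]
  by_cases h2 : c = y
  · subst h2; simp [hx, hy]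
  rw [swap_apply_of_ne_of_ne h1 h2, swap_apply_of_ne_of_ne]
  · intro h; exact h2 (τ.injective (h.trans hy.symm))
  · intro h; exact h1 (τ.injective (h.trans hx.symm))

/-- The modified rotation and the modified involution have the same composite as the original ones.
Therefore contraction and cutting leave all faces alone, and `R` can be kept. -/
theorem face_mul_swap (σ : Perm D) {τ : Perm D} {x y : D} (hx : τ x = y) (hy : τ y = x) (c : D) :
    (σ * swap x y) ((τ * swap x y) c) = σ (τ c) := by
  simp only [Perm.mul_apply]
  rw [swap_conj_invol hx hy]

theorem invol_mul_swap {τ : Perm D} (hτ : ∀ c, τ (τ c) = c) {x y : D} (hx : τ x = y) (c : D) :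
    (τ * swap x y) ((τ * swap x y) c) = c := by
  have hy : τ y = x := by rw [← hx, hτ]
  rw [face_mul_swap τ hx hy, hτ]

variable [Finite D] {σ τ : Perm D} {x y : D}

theorem invol_cut_not (hxy : x ≠ y) (hx : τ x = y) : ¬ (τ * swap x y).SameCycle x y :=
  cut_not_sameCycle hxy ⟨1, by simp [hx]⟩

omit [Finite D] in
theorem orb_invol (hx : τ x = y) : orb τ = glue (orb (τ * swap x y)) x y :=
  orb_cut ⟨1, by simp [hx]⟩

theorem nc_invol (hxy : x ≠ y) (hx : τ x = y) : nc (orb (τ * swap x y)) = nc (orb τ) + 1 := by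
  rw [orb_invol hx]
  exact nc_glue (invol_cut_not hxy hx)

theorem merge_sup (hx : τ x = y) (h : ¬ σ.SameCycle x y) :
    orb (σ * swap x y) ⊔ orb (τ * swap x y) = orb σ ⊔ orb τ := by
  rw [orb_merge h, orb_invol hx, glue_sup, sup_glue]

theorem nc_merge (h : ¬ σ.SameCycle x y) : nc (orb σ) = nc (orb (σ * swap x y)) + 1 := by
  rw [orb_merge h]
  exact nc_glue h

theorem nc_cut (hxy : x ≠ y) (h : σ.SameCycle x y) :
    nc (orb (σ * swap x y)) = nc (orb σ) + 1 := by
  rw [orb_cut h]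
  exact nc_glue (cut_not_sameCycle hxy h)

omit [Finite D] in
theorem cut_sup (hx : τ x = y) (h : σ.SameCycle x y) :
    orb σ ⊔ orb τ = glue (orb (σ * swap x y) ⊔ orb (τ * swap x y)) x y := by
  rw [orb_cut h, orb_invol hx, glue_sup, sup_glue, glue_eq_self (glue_rel _ _ _)]

/-- Contraction loses one vertex and turns one class of `τ`, the edge, into two marks; the
components do not change. -/
theorem euler_merge (hxy : x ≠ y) (hx : τ x = y) (h : ¬ σ.SameCycle x y) (R : Setoid D) :
    Euler (σ * swap x y) (τ * swap x y) R ↔ Euler σ τ R := by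
  have h1 := nc_merge h
  have h2 := nc_invol hxy hx
  unfold Euler
  rw [merge_sup hx h]
  omega

-- The genus is nonnegative and the gluing pattern has a nonnegative number of cycles. Edges are
-- removed one by one: contraction changes neither side. Cutting a loop raises the left side by two
-- and the right side by at most two, so the inequality before the cut follows from the one after
-- it. Without edges, `R` is coarser than the vertices and both sides agree.
omit [DecidableEq D] in
theorem euler_le (hτ : ∀ c, τ (τ c) = c) {R : Setoid D} (hf : ∀ c, R c (σ (τ c))) :
    nc (orb σ) + nc (orb τ) + nc R
      ≤ nc (orb σ ⊔ orb τ) + nc (orb σ ⊔ orb τ ⊔ R) + Nat.card D := by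
  classical
  -- This difference is the number of edges, since each 2-cycle of `τ` accounts for one class less
  -- than corners.
  induction hn : Nat.card D - nc (orb τ) using Nat.strong_induction_on generalizing σ τ with
  | _ n ih =>
  by_cases h1 : ∃ x, τ x ≠ x
  · obtain ⟨x, hxy⟩ := h1
    have hyx : τ (τ x) = x := hτ x
    generalize hx : τ x = y at hxy hyx
    have hxy' : x ≠ y := hxy.symm
    have e1 := nc_invol hxy' hx
    have e2 := nc_le_card (orb (τ * swap x y))
    have key := ih _ (by omega) (σ := σ * swap x y) (τ := τ * swap x y) (invol_mul_swap hτ hx)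
      (fun c => by rw [face_mul_swap σ hx hyx]; exact hf c) rfl
    by_cases h : σ.SameCycle x y
    · have e3 := nc_cut hxy' h
      rw [cut_sup hx h, glue_sup]
      have e4 := nc_glue_le (orb (σ * swap x y) ⊔ orb (τ * swap x y)) x y
      have e5 := nc_glue_le (orb (σ * swap x y) ⊔ orb (τ * swap x y) ⊔ R) x y
      omega
    · have e3 := nc_merge h
      rw [merge_sup hx h] at key
      omega
  · push Not at h1
    have : τ = 1 := Equiv.ext h1
    subst this
    have hR : orb σ ≤ R := orb_le.2 (by simpa using hf)
    rw [orb_one, sup_bot_eq, sup_eq_right.2 hR, nc_bot]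
    omega

/-- Cutting along a loop separates a map on the sphere. -/
theorem euler_cut (hτ : ∀ c, τ (τ c) = c) {R : Setoid D} (hf : ∀ c, R c (σ (τ c)))
    (hxy : x ≠ y) (hx : τ x = y) (h : σ.SameCycle x y) :
    Euler σ τ R ↔ Euler (σ * swap x y) (τ * swap x y) R ∧
      ¬ (orb (σ * swap x y) ⊔ orb (τ * swap x y) ⊔ R) x y := by
  have hyx : τ y = x := by rw [← hx, hτ]
  have e1 := nc_invol hxy hx
  have e3 := nc_cut hxy h
  have key := euler_le (σ := σ * swap x y) (τ := τ * swap x y) (R := R) (invol_mul_swap hτ hx)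
      (fun c => by rw [face_mul_swap σ hx hyx]; exact hf c)
  unfold Euler
  rw [cut_sup hx h, glue_sup]
  set G := orb (σ * swap x y) ⊔ orb (τ * swap x y) with hG
  -- If both sides of the loop remain joined, the right side of Euler's formula grows by at most one
  -- while the left side grows by two, against the inequality for the cut map.
  by_cases hGR : (G ⊔ R) x y
  · rw [glue_eq_self hGR]
    have e4 := nc_glue_le G x y
    constructor
    · intro; exfalso; omega
    · exact fun h => absurd hGR h.2
  · have hG' : ¬ G x y := fun h => hGR ((le_sup_left : G ≤ G ⊔ R) h)
    have e4 := nc_glue hG'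
    have e5 := nc_glue hGR
    simp only [hGR, not_false_eq_true, and_true]
    omega

omit [Finite D] in
theorem face_delete {R : Setoid D} (hf : ∀ c, R c (σ (τ c)))
    (hx : τ x = y) (hyx : τ y = x) (c : D) : glue R x y c (σ ((τ * swap x y) c)) := by
  by_cases h1 : c = x
  · subst h1
    rw [mul_swap_left, hyx]
    have := hf y
    rw [hyx] at this
    exact Or.inr (Or.inl ⟨R.refl _, this⟩)
  by_cases h2 : c = y
  · subst h2
    rw [mul_swap_right, hx]
    have := hf x
    rw [hx] at this
    exact Or.inr (Or.inr ⟨R.refl _, this⟩)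
  rw [mul_swap_other τ h1 h2]
  exact Or.inl (hf c)

omit [Finite D] in
theorem delete_sup (R : Setoid D) (hx : τ x = y) :
    orb σ ⊔ orb (τ * swap x y) ⊔ glue R x y = orb σ ⊔ orb τ ⊔ R := by
  rw [orb_invol hx, sup_glue, sup_glue, glue_sup]

/-- Removing an edge that is no bridge adds a class of `τ` and lowers the number of regions by at
most one; `euler_le` leaves only the case of equality. Removing a bridge adds a component and leaves
the regions as they are. -/
theorem euler_delete (hτ : ∀ c, τ (τ c) = c) {R : Setoid D} (hf : ∀ c, R c (σ (τ c)))
    (hxy : x ≠ y) (hx : τ x = y) (hE : Euler σ τ R) :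
    Euler σ (τ * swap x y) (glue R x y) := by
  have hyx : τ y = x := by rw [← hx, hτ]
  have e1 := nc_invol hxy hx
  have key := euler_le (σ := σ) (τ := τ * swap x y) (R := glue R x y) (invol_mul_swap hτ hx)
      (face_delete hf hx hyx)
  unfold Euler at hE ⊢
  rw [delete_sup R hx] at key ⊢
  have e2 := nc_glue_le R x y
  have e3 : orb σ ⊔ orb τ = glue (orb σ ⊔ orb (τ * swap x y)) x y := by
    rw [orb_invol hx, sup_glue]
  by_cases hC : (orb σ ⊔ orb (τ * swap x y)) x y
  · rw [glue_eq_self hC] at e3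
    rw [e3] at hE key ⊢
    omega
  · have e4 := nc_glue hC
    rw [← e3] at e4
    -- Both sides of a bridge belong to one face. Otherwise its removal would join two faces, and a
    -- walk along the joined face would still connect `x` to `y`.
    have hR : R x y := by
      have hle : orb (σ * τ) ≤ R := orb_le.2 hf
      apply hle
      by_contra hn
      have h5 := merge_sameCycle (σ := σ * τ) (x := x) (y := y) hn
      refine hC ((orb_le.2 ?_ : orb (σ * τ * swap x y) ≤ _) h5)
      intro c
      have h6 : orb σ ⊔ orb (τ * swap x y) ≤ orb σ ⊔ orb (τ * swap x y) := le_rfl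
      have h7 := (sup_le_iff.1 h6).2 (orb_apply (τ * swap x y) c)
      have h8 := (sup_le_iff.1 h6).1 (orb_apply σ ((τ * swap x y) c))
      exact Setoid.trans' _ h7 h8
    rw [glue_eq_self hR] at key ⊢
    omega

end

/-- The regions after the deletion of the edges outside `S`. -/
def delRel {D : Type} (τ : Perm D) (R : Setoid D) (S : Set D) : Setoid D :=
  R ⊔ Relation.EqvGen.setoid fun a b => a ∉ S ∧ b = τ a

theorem delRel_le {D : Type} {τ : Perm D} {R G : Setoid D} {S : Set D} :
    delRel τ R S ≤ G ↔ R ≤ G ∧ ∀ c, c ∉ S → G c (τ c) := by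
  rw [delRel, sup_le_iff]
  refine and_congr_right fun _ => ⟨fun h c hc => h (Relation.EqvGen.rel _ _ ⟨hc, rfl⟩), fun h => ?_⟩
  apply Setoid.eqvGen_le
  rintro a b ⟨ha, rfl⟩
  exact h a ha

theorem delRel_spec {D : Type} [Finite D] {σ τ τS : Perm D} {R : Setoid D} {S : Set D}
    (hτ : ∀ c, τ (τ c) = c) (hf : ∀ c, R c (σ (τ c))) (hE : Euler σ τ R)
    (hS : ∀ c, c ∈ S → τS c = τ c) (hS' : ∀ c, c ∉ S → τS c = c) :
    (∀ c, delRel τ R S c (σ (τS c))) ∧ Euler σ τS (delRel τ R S) ∧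
      orb σ ⊔ orb τS ⊔ delRel τ R S = orb σ ⊔ orb τ ⊔ R := by
  classical
  induction hn : Nat.card D - nc (orb τ) using Nat.strong_induction_on generalizing τ R with
  | _ n ih =>
  by_cases h1 : ∃ x, x ∉ S ∧ τ x ≠ x
  · obtain ⟨x, hxS, hxy⟩ := h1
    have hyx : τ (τ x) = x := hτ x
    have hyS : τ x ∉ S := by
      intro h
      have e1 := hS _ h
      rw [hτ] at e1
      exact hxy (τS.injective (by rw [e1, hS' x hxS]))
    generalize hx : τ x = y at hxy hyx hyS
    have hxy' : x ≠ y := hxy.symm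
    have e1 := nc_invol hxy' hx
    have e2 := nc_le_card (orb (τ * swap x y))
    have hother : ∀ c ∈ S, (τ * swap x y) c = τ c := fun c hc =>
      mul_swap_other τ (fun h => hxS (h ▸ hc)) (fun h => hyS (h ▸ hc))
    have key := ih _ (by omega) (τ := τ * swap x y) (R := glue R x y) (invol_mul_swap hτ hx)
      (face_delete hf hx hyx) (euler_delete hτ hf hxy' hx hE)
      (fun c hc => by rw [hother c hc, hS c hc]) rfl
    have hdel : delRel (τ * swap x y) (glue R x y) S = delRel τ R S := by
      have hle := delRel_le.1 (le_refl (delRel τ R S))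
      have hle' := delRel_le.1 (le_refl (delRel (τ * swap x y) (glue R x y) S))
      apply le_antisymm
      · refine delRel_le.2 ⟨glue_le.2 ⟨hle.1, ?_⟩, fun c hc => ?_⟩
        · have := hle.2 x hxS
          rwa [hx] at this
        · by_cases h1 : c = x
          · subst h1; rw [mul_swap_left, hyx]
          by_cases h2 : c = y
          · subst h2; rw [mul_swap_right, hx]
          rw [mul_swap_other τ h1 h2]
          exact hle.2 c hc
      · refine delRel_le.2 ⟨(le_glue _ _ _).trans hle'.1, fun c hc => ?_⟩
        by_cases h1 : c = x
        · subst h1; rw [hx]; exact hle'.1 (glue_rel _ _ _)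
        by_cases h2 : c = y
        · subst h2; rw [hyx]; exact Setoid.symm' _ (hle'.1 (glue_rel _ _ _))
        have := hle'.2 c hc
        rwa [mul_swap_other τ h1 h2] at this
    rw [hdel, delete_sup R hx] at key
    exact key
  · push Not at h1
    have hττ : τS = τ := Equiv.ext fun c => by
      by_cases hc : c ∈ S
      · exact hS c hc
      · rw [hS' c hc, h1 c hc]
    have hR : delRel τ R S = R := by
      refine le_antisymm (delRel_le.2 ⟨le_rfl, fun c hc => ?_⟩) (delRel_le.1 le_rfl).1
      rw [h1 c hc]
    rw [hττ, hR]
    exact ⟨hf, hE, rfl⟩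

/-! ### Sets of maps with a given rotation -/

/-- The pairs `(τ, R)` that form a connected gluing of spheres together with the rotation `σ` and
the set `X` of marks, such that no region is a single corner. -/
structure IsMap {D : Type} (σ : Perm D) (X : Set D) (τ : Perm D) (R : Setoid D) : Prop where
  invol : ∀ c, τ (τ c) = c
  fix : ∀ c, τ c = c ↔ c ∈ X
  face : ∀ c, R c (σ (τ c))
  euler : Euler σ τ R
  conn : orb σ ⊔ orb τ ⊔ R = ⊤
  nosing : ∀ c, ∃ c', c' ≠ c ∧ R c c'

def maps {D : Type} (σ : Perm D) (X : Set D) : Set (Perm D × Setoid D) := {p | IsMap σ X p.1 p.2}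

noncomputable def cnt {D : Type} (σ : Perm D) (X : Set D) : ℕ := (maps σ X).ncard

instance finite_setoid {D : Type} [Finite D] : Finite (Setoid D) :=
  Finite.of_injective (fun r : Setoid D => fun a b => r a b) fun _ _ h =>
    Setoid.ext fun a b => iff_of_eq (congrFun (congrFun h a) b)

/-- The transposition exchanges the edge between `x` and `y` for a pair of marks, and conversely. -/
theorem toggle_iff {D : Type} [DecidableEq D] {X : Set D} {x y : D} (hxy : x ≠ y)
    (hx : x ∉ X) (hy : y ∉ X) {τ : Perm D} :
    ((∀ c, τ (τ c) = c) ∧ (∀ c, τ c = c ↔ c ∈ X) ∧ τ x = y) ↔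
      (∀ c, (τ * swap x y) ((τ * swap x y) c) = c) ∧
        (∀ c, (τ * swap x y) c = c ↔ c ∈ X ∪ {x, y}) := by
  constructor
  · rintro ⟨hi, hf, h⟩
    refine ⟨invol_mul_swap hi h, fun c => ?_⟩
    by_cases h1 : c = x
    · subst h1; rw [mul_swap_left, ← h, hi]; simp
    by_cases h2 : c = y
    · subst h2; rw [mul_swap_right, h]; simp
    rw [mul_swap_other τ h1 h2, hf]
    simp [h1, h2]
  · rintro ⟨hi, hf⟩
    have h1 : τ y = x := by simpa using (hf x).2 (by simp)
    have h2 : τ x = y := by simpa using (hf y).2 (by simp)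
    refine ⟨fun c => ?_, fun c => ?_, h2⟩
    · by_cases e1 : c = x
      · rw [e1, h2, h1]
      by_cases e2 : c = y
      · rw [e2, h1, h2]
      have := hi c
      rwa [mul_swap_other τ e1 e2, mul_swap_other τ] at this
      · exact fun h => e2 (τ.injective (h.trans h1.symm))
      · exact fun h => e1 (τ.injective (h.trans h2.symm))
    · by_cases e1 : c = x
      · rw [e1, h2]; simp [hx, hxy.symm]
      by_cases e2 : c = y
      · rw [e2, h1]; simp [hy, hxy]
      have := hf c
      rw [mul_swap_other τ e1 e2] at this
      simpa [e1, e2] using this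

theorem ncard_toggle {D : Type} [DecidableEq D] (x y : D) {A B : Set (Perm D × Setoid D)}
    (h : ∀ τ R, (τ, R) ∈ A ↔ (τ * swap x y, R) ∈ B) : A.ncard = B.ncard := by
  have finv : Function.Involutive
      (fun p : Perm D × Setoid D => ((p.1 * swap x y, p.2) : Perm D × Setoid D)) := by
    rintro ⟨τ, R⟩
    simp [mul_assoc]
  rw [← Set.ncard_image_of_injective B finv.injective, finv.image_eq_preimage_symm]
  congr 1
  ext ⟨τ, R⟩
  exact h τ R

theorem cnt_merge {D : Type} [Finite D] [DecidableEq D] {σ : Perm D} {X : Set D} {x y : D}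
    (hx : x ∉ X) (hy : y ∉ X) (h : ¬ σ.SameCycle x y) :
    {p ∈ maps σ X | p.1 x = y}.ncard = cnt (σ * swap x y) (X ∪ {x, y}) := by
  have hxy : x ≠ y := fun e => h (e ▸ Perm.SameCycle.refl _ _)
  refine ncard_toggle x y fun τ R => ?_
  simp only [Set.mem_ofPred_eq, maps]
  constructor
  · rintro ⟨hm, hxy'⟩
    have hyx : τ y = x := by rw [← hxy', hm.invol]
    obtain ⟨t1, t2⟩ := (toggle_iff hxy hx hy).1 ⟨hm.invol, hm.fix, hxy'⟩
    refine ⟨t1, t2, fun c => ?_, (euler_merge hxy hxy' h R).2 hm.euler, ?_, hm.nosing⟩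
    · rw [face_mul_swap σ hxy' hyx]; exact hm.face c
    · rw [merge_sup hxy' h]; exact hm.conn
  · intro hm
    obtain ⟨t1, t2, hxy'⟩ := (toggle_iff hxy hx hy).2 ⟨hm.invol, hm.fix⟩
    have hyx : τ y = x := by rw [← hxy', t1]
    refine ⟨⟨t1, t2, fun c => ?_, (euler_merge hxy hxy' h R).1 hm.euler, ?_, hm.nosing⟩, hxy'⟩
    · rw [← face_mul_swap σ hxy' hyx]; exact hm.face c
    · rw [← merge_sup hxy' h]; exact hm.conn

/-! ### Maps on complementary sets of corners -/

section Restrict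
variable {D : Type}

/-- No class meets both `p` and its complement. -/
def Resp (p : D → Prop) (r : Setoid D) : Prop := r ≤ Setoid.ker p

theorem resp_iff {p : D → Prop} {r : Setoid D} : Resp p r ↔ ∀ a b, r a b → (p a ↔ p b) :=
  ⟨fun h _ _ hab => iff_of_eq (h hab), fun h a b hab => propext (h a b hab)⟩

theorem resp_orb {p : D → Prop} {f : Perm D} (h : ∀ c, p (f c) ↔ p c) : Resp p (orb f) :=
  orb_le.2 fun c => propext (h c).symm

theorem Resp.not {p : D → Prop} {r : Setoid D} (h : Resp p r) : Resp (fun c => ¬ p c) r :=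
  resp_iff.2 fun a b hab => not_congr (resp_iff.1 h a b hab)

theorem Resp.sup {p : D → Prop} {r s : Setoid D} (h : Resp p r) (h' : Resp p s) :
    Resp p (r ⊔ s) := sup_le h h'

/-- The restriction of a partition. -/
abbrev res (p : D → Prop) (r : Setoid D) : Setoid {c // p c} := r.comap Subtype.val

theorem res_orb {p : D → Prop} {f : Perm D} (h : ∀ c, p (f c) ↔ p c) :
    res p (orb f) = orb (f.subtypePerm h) := by
  ext a b
  exact Perm.sameCycle_subtypePerm.symm

theorem res_sup {p : D → Prop} {r s : Setoid D} (h : Resp p r) (h' : Resp p s) :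
    res p (r ⊔ s) = res p r ⊔ res p s := by
  apply le_antisymm
  · let t : Setoid D :=
      { r := fun a b => (∃ ha hb, (res p r ⊔ res p s) ⟨a, ha⟩ ⟨b, hb⟩) ∨ (¬ p a ∧ ¬ p b)
        iseqv := by
          refine ⟨fun a => ?_, ?_, ?_⟩
          · by_cases ha : p a
            · exact Or.inl ⟨ha, ha, Setoid.refl' _ _⟩
            · exact Or.inr ⟨ha, ha⟩
          · rintro a b (⟨ha, hb, h⟩ | ⟨ha, hb⟩)
            · exact Or.inl ⟨hb, ha, Setoid.symm' _ h⟩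
            · exact Or.inr ⟨hb, ha⟩
          · rintro a b c (⟨ha, hb, h⟩ | ⟨ha, hb⟩) (⟨hb', hc, k⟩ | ⟨hb', hc⟩)
            · exact Or.inl ⟨ha, hc, Setoid.trans' _ h k⟩
            · exact absurd hb hb'
            · exact absurd hb' hb
            · exact Or.inr ⟨ha, hc⟩ }
    have key : ∀ q : Setoid D, Resp p q → res p q ≤ res p r ⊔ res p s → q ≤ t := by
      intro q hq hle a b hab
      by_cases ha : p a
      · have hb := (resp_iff.1 hq a b hab).1 ha
        exact Or.inl ⟨ha, hb, hle (x := ⟨a, ha⟩) (y := ⟨b, hb⟩) hab⟩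
      · exact Or.inr ⟨ha, fun hb => ha ((resp_iff.1 hq a b hab).2 hb)⟩
    have ht : r ⊔ s ≤ t := sup_le (key r h le_sup_left) (key s h' le_sup_right)
    rintro ⟨a, ha⟩ ⟨b, hb⟩ hab
    rcases ht hab with ⟨_, _, k⟩ | ⟨k, _⟩
    · exact k
    · exact absurd ha k
  · refine sup_le ?_ ?_ <;> intro a b hab
    · exact (le_sup_left : r ≤ r ⊔ s) hab
    · exact (le_sup_right : s ≤ r ⊔ s) hab

theorem nc_split [Finite D] {p : D → Prop} {r : Setoid D} (h : Resp p r) :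
    nc r = nc (res p r) + nc (res (fun c => ¬ p c) r) := by
  rw [resp_iff] at h
  unfold nc
  rw [← Nat.card_sum]
  symm
  refine Nat.card_congr (Equiv.ofBijective (Sum.elim
    (Quotient.map (sa := res p r) (sb := r) Subtype.val fun a b hab => hab)
    (Quotient.map (sa := res (fun c => ¬ p c) r) (sb := r) Subtype.val fun a b hab => hab))
    ⟨?_, ?_⟩)
  · rintro (a | a) (b | b) <;>
    induction a using Quotient.inductionOn with | _ a <;>
    induction b using Quotient.inductionOn with | _ b <;> intro hab <;>
    have hab' : r a.1 b.1 := Quotient.exact hab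
    · exact congrArg Sum.inl (Quotient.sound hab')
    · exact absurd ((h _ _ hab').1 a.2) b.2
    · exact absurd ((h _ _ hab').2 b.2) a.2
    · exact congrArg Sum.inr (Quotient.sound hab')
  · intro q
    induction q using Quotient.inductionOn with | _ a
    by_cases ha : p a
    · exact ⟨Sum.inl (Quotient.mk _ ⟨a, ha⟩), rfl⟩
    · exact ⟨Sum.inr (Quotient.mk _ ⟨a, ha⟩), rfl⟩

theorem res_eq_top {p : D → Prop} {r : Setoid D} : res p r = ⊤ ↔ ∀ a b, p a → p b → r a b := by
  rw [eq_top_iff]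
  exact ⟨fun h a b ha hb => h (x := ⟨a, ha⟩) (y := ⟨b, hb⟩) trivial, fun h a b _ => h _ _ a.2 b.2⟩

/-- All numbers of classes are additive. By `euler_le` each part satisfies an inequality, so
equality of the sums is equality in both parts. -/
theorem euler_split [Finite D] {p : D → Prop} {σ τ : Perm D} {R : Setoid D}
    (hσ : ∀ c, p (σ c) ↔ p c) (hτ : ∀ c, p (τ c) ↔ p c) (hR : Resp p R)
    (hi : ∀ c, τ (τ c) = c) (hf : ∀ c, R c (σ (τ c))) :
    Euler σ τ R ↔ Euler (σ.subtypePerm hσ) (τ.subtypePerm hτ) (res p R) ∧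
      Euler (σ.subtypePerm (p := fun c => ¬ p c) fun c => not_congr (hσ c))
        (τ.subtypePerm (p := fun c => ¬ p c) fun c => not_congr (hτ c))
        (res (fun c => ¬ p c) R) := by
  have rσ := resp_orb hσ
  have rτ := resp_orb hτ
  have key1 := euler_le (σ := σ.subtypePerm hσ) (τ := τ.subtypePerm hτ) (R := res p R)
    (fun c => Subtype.ext (hi c)) (fun c => hf c)
  have key2 := euler_le (σ := σ.subtypePerm (p := fun c => ¬ p c) fun c => not_congr (hσ c))
    (τ := τ.subtypePerm (p := fun c => ¬ p c) fun c => not_congr (hτ c))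
    (R := res (fun c => ¬ p c) R) (fun c => Subtype.ext (hi c)) (fun c => hf c)
  have hcard : Nat.card D = Nat.card {c // p c} + Nat.card {c // ¬ p c} := by
    classical
    rw [← Nat.card_sum]
    exact Nat.card_congr (Equiv.sumCompl p).symm
  unfold Euler
  rw [nc_split rσ, nc_split rτ, nc_split hR, nc_split (rσ.sup rτ), nc_split ((rσ.sup rτ).sup hR),
    hcard, res_sup (rσ.sup rτ) hR, res_sup rσ rτ, res_sup (rσ.sup rτ).not hR.not,
    res_sup rσ.not rτ.not, res_orb hσ, res_orb hτ, res_orb (p := fun c => ¬ p c) (fun c => not_congr (hσ c)),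
    res_orb (p := fun c => ¬ p c) (fun c => not_congr (hτ c))]
  omega

/-- The union of partitions of a subset and of its complement. -/
def joinRel {p : D → Prop} (r : Setoid {c // p c}) (s : Setoid {c // ¬ p c}) : Setoid D where
  r a b := (∃ ha hb, r ⟨a, ha⟩ ⟨b, hb⟩) ∨ (∃ ha hb, s ⟨a, ha⟩ ⟨b, hb⟩)
  iseqv := by
    refine ⟨fun a => ?_, ?_, ?_⟩
    · by_cases ha : p a
      · exact Or.inl ⟨ha, ha, Setoid.refl' _ _⟩
      · exact Or.inr ⟨ha, ha, Setoid.refl' _ _⟩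
    · rintro a b (⟨ha, hb, h⟩ | ⟨ha, hb, h⟩)
      · exact Or.inl ⟨hb, ha, Setoid.symm' _ h⟩
      · exact Or.inr ⟨hb, ha, Setoid.symm' _ h⟩
    · rintro a b c (⟨ha, hb, h⟩ | ⟨ha, hb, h⟩) (⟨hb', hc, k⟩ | ⟨hb', hc, k⟩)
      · exact Or.inl ⟨ha, hc, Setoid.trans' _ h k⟩
      · exact absurd hb hb'
      · exact absurd hb' hb
      · exact Or.inr ⟨ha, hc, Setoid.trans' _ h k⟩

theorem res_joinRel {p : D → Prop} (r : Setoid {c // p c}) (s : Setoid {c // ¬ p c}) :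
    res p (joinRel r s) = r := by
  ext ⟨a, ha⟩ ⟨b, hb⟩
  constructor
  · rintro (⟨_, _, h⟩ | ⟨h, _, _⟩)
    · exact h
    · exact absurd ha h
  · exact fun h => Or.inl ⟨ha, hb, h⟩

theorem res_not_joinRel {p : D → Prop} (r : Setoid {c // p c}) (s : Setoid {c // ¬ p c}) :
    res (fun c => ¬ p c) (joinRel r s) = s := by
  ext ⟨a, ha⟩ ⟨b, hb⟩
  constructor
  · rintro (⟨h, _, _⟩ | ⟨_, _, h⟩)
    · exact absurd h ha
    · exact h
  · exact fun h => Or.inr ⟨ha, hb, h⟩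

theorem resp_joinRel {p : D → Prop} (r : Setoid {c // p c}) (s : Setoid {c // ¬ p c}) :
    Resp p (joinRel r s) := by
  refine resp_iff.2 ?_
  rintro a b (⟨ha, hb, _⟩ | ⟨ha, hb, _⟩)
  · exact iff_of_true ha hb
  · exact iff_of_false ha hb

theorem joinRel_res {p : D → Prop} {R : Setoid D} (h : Resp p R) :
    joinRel (res p R) (res (fun c => ¬ p c) R) = R := by
  ext a b
  constructor
  · rintro (⟨_, _, h⟩ | ⟨_, _, h⟩) <;> exact h
  · intro hab
    by_cases ha : p a
    · exact Or.inl ⟨ha, (resp_iff.1 h a b hab).1 ha, hab⟩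
    · exact Or.inr ⟨ha, fun hb => ha ((resp_iff.1 h a b hab).2 hb), hab⟩

end Restrict

section Product
variable {D : Type} [Finite D] {σ τ : Perm D} {X : Set D} {R : Setoid D} {p : D → Prop}

/-- A pair of maps on complementary sets of corners. -/
theorem isMap_split (hσ : ∀ c, p (σ c) ↔ p c) (hτ : ∀ c, p (τ c) ↔ p c) (hR : Resp p R) :
    (IsMap (σ.subtypePerm hσ) (Subtype.val ⁻¹' X) (τ.subtypePerm hτ) (res p R) ∧
      IsMap (σ.subtypePerm (p := fun c => ¬ p c) fun c => not_congr (hσ c)) (Subtype.val ⁻¹' X)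
        (τ.subtypePerm (p := fun c => ¬ p c) fun c => not_congr (hτ c))
        (res (fun c => ¬ p c) R)) ↔
    ((∀ c, τ (τ c) = c) ∧ (∀ c, τ c = c ↔ c ∈ X) ∧ (∀ c, R c (σ (τ c))) ∧ Euler σ τ R ∧
      (∀ a b, p a → p b → (orb σ ⊔ orb τ ⊔ R) a b) ∧
      (∀ a b, ¬ p a → ¬ p b → (orb σ ⊔ orb τ ⊔ R) a b) ∧ (∀ c, ∃ c', c' ≠ c ∧ R c c')) := by
  have rσ := resp_orb hσ
  have rτ := resp_orb hτ
  have c1 : orb (σ.subtypePerm hσ) ⊔ orb (τ.subtypePerm hτ) ⊔ res p R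
      = res p (orb σ ⊔ orb τ ⊔ R) := by
    rw [res_sup (rσ.sup rτ) hR, res_sup rσ rτ, res_orb hσ, res_orb hτ]
  have c2 : orb (σ.subtypePerm (p := fun c => ¬ p c) fun c => not_congr (hσ c))
        ⊔ orb (τ.subtypePerm (p := fun c => ¬ p c) fun c => not_congr (hτ c))
        ⊔ res (fun c => ¬ p c) R
      = res (fun c => ¬ p c) (orb σ ⊔ orb τ ⊔ R) := by
    rw [res_sup (rσ.sup rτ).not hR.not, res_sup rσ.not rτ.not,
      res_orb (p := fun c => ¬ p c) (fun c => not_congr (hσ c)), res_orb (p := fun c => ¬ p c) (fun c => not_congr (hτ c))]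
  constructor
  · rintro ⟨h1, h2⟩
    have hi : ∀ c, τ (τ c) = c := fun c => by
      by_cases hc : p c
      · exact congrArg Subtype.val (h1.invol ⟨c, hc⟩)
      · exact congrArg Subtype.val (h2.invol ⟨c, hc⟩)
    have hf : ∀ c, R c (σ (τ c)) := fun c => by
      by_cases hc : p c
      · exact h1.face ⟨c, hc⟩
      · exact h2.face ⟨c, hc⟩
    refine ⟨hi, fun c => ?_, hf, (euler_split hσ hτ hR hi hf).2 ⟨h1.euler, h2.euler⟩,
      res_eq_top.1 (c1 ▸ h1.conn), res_eq_top.1 (c2 ▸ h2.conn), fun c => ?_⟩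
    · by_cases hc : p c
      · simpa [Subtype.ext_iff] using h1.fix ⟨c, hc⟩
      · simpa [Subtype.ext_iff] using h2.fix ⟨c, hc⟩
    · by_cases hc : p c
      · obtain ⟨c', h, h'⟩ := h1.nosing ⟨c, hc⟩
        exact ⟨c', fun e => h (Subtype.ext e), h'⟩
      · obtain ⟨c', h, h'⟩ := h2.nosing ⟨c, hc⟩
        exact ⟨c', fun e => h (Subtype.ext e), h'⟩
  · rintro ⟨hi, hfix, hf, hE, hc1, hc2, hns⟩
    have hE' := (euler_split hσ hτ hR hi hf).1 hE
    refine ⟨⟨fun c => Subtype.ext (hi c), fun c => ?_, fun c => hf c, hE'.1, ?_, fun c => ?_⟩,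
      ⟨fun c => Subtype.ext (hi c), fun c => ?_, fun c => hf c, hE'.2, ?_, fun c => ?_⟩⟩
    · simpa [Subtype.ext_iff] using hfix c
    · rw [c1]; exact res_eq_top.2 hc1
    · obtain ⟨c', h, h'⟩ := hns c
      exact ⟨⟨c', (resp_iff.1 hR _ _ h').1 c.2⟩, fun e => h (congrArg Subtype.val e), h'⟩
    · simpa [Subtype.ext_iff] using hfix c
    · rw [c2]; exact res_eq_top.2 hc2
    · obtain ⟨c', h, h'⟩ := hns c
      exact ⟨⟨c', (resp_iff.1 hR.not _ _ h').1 c.2⟩, fun e => h (congrArg Subtype.val e), h'⟩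

/-- The number of pairs of maps on complementary sets of corners. -/
theorem cnt_product (hσ : ∀ c, p (σ c) ↔ p c) :
    {q : Perm D × Setoid D | (∀ c, p (q.1 c) ↔ p c) ∧ Resp p q.2 ∧
      (∀ c, q.1 (q.1 c) = c) ∧ (∀ c, q.1 c = c ↔ c ∈ X) ∧ (∀ c, q.2 c (σ (q.1 c))) ∧
      Euler σ q.1 q.2 ∧ (∀ a b, p a → p b → (orb σ ⊔ orb q.1 ⊔ q.2) a b) ∧
      (∀ a b, ¬ p a → ¬ p b → (orb σ ⊔ orb q.1 ⊔ q.2) a b) ∧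
      (∀ c, ∃ c', c' ≠ c ∧ q.2 c c')}.ncard =
    cnt (σ.subtypePerm hσ) (Subtype.val ⁻¹' X) *
    cnt (σ.subtypePerm (p := fun c => ¬ p c) fun c => not_congr (hσ c)) (Subtype.val ⁻¹' X) := by
  classical
  let F : (Perm {c // p c} × Setoid {c // p c}) × (Perm {c // ¬ p c} × Setoid {c // ¬ p c}) →
      Perm D × Setoid D := fun q => (q.1.1.subtypeCongr q.2.1, joinRel q.1.2 q.2.2)
  have hF1 : ∀ q c, p ((F q).1 c) ↔ p c := by
    intro q c
    by_cases hc : p c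
    · have : (F q).1 c = q.1.1 ⟨c, hc⟩ := Perm.subtypeCongr.left_apply _ _ hc
      rw [this]
      exact iff_of_true (q.1.1 ⟨c, hc⟩).2 hc
    · have : (F q).1 c = q.2.1 ⟨c, hc⟩ := Perm.subtypeCongr.right_apply _ _ hc
      rw [this]
      exact iff_of_false (q.2.1 ⟨c, hc⟩).2 hc
  have hF2 : ∀ q, (F q).1.subtypePerm (hF1 q) = q.1.1 := by
    intro q
    ext ⟨c, hc⟩
    exact Perm.subtypeCongr.left_apply _ _ hc
  have hF3 : ∀ q, (F q).1.subtypePerm (p := fun c => ¬ p c) (fun c => not_congr (hF1 q c))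
      = q.2.1 := by
    intro q
    ext ⟨c, hc⟩
    exact Perm.subtypeCongr.right_apply _ _ hc
  have hF4 : ∀ q, res p (F q).2 = q.1.2 := fun q => res_joinRel _ _
  have hF5 : ∀ q, res (fun c => ¬ p c) (F q).2 = q.2.2 := fun q => res_not_joinRel _ _
  have hinj : Function.Injective F := by
    intro q q' h
    have e1 := hF2 q
    have e2 := hF3 q
    have e3 := hF4 q
    have e4 := hF5 q
    simp only [h] at e1 e2 e3 e4
    rw [hF2] at e1
    rw [hF3] at e2
    rw [hF4] at e3
    rw [hF5] at e4
    exact Prod.ext (Prod.ext e1.symm e3.symm) (Prod.ext e2.symm e4.symm)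
  rw [cnt, cnt, ← Set.ncard_prod, ← Set.ncard_image_of_injective _ hinj]
  congr 1
  ext q
  simp only [Set.mem_ofPred_eq, Set.mem_image, Set.mem_prod, maps]
  constructor
  · rintro ⟨h1, h2, h⟩
    refine ⟨((q.1.subtypePerm h1, res p q.2),
      (q.1.subtypePerm (p := fun c => ¬ p c) (fun c => not_congr (h1 c)),
      res (fun c => ¬ p c) q.2)), (isMap_split hσ h1 h2).2 h, ?_⟩
    refine Prod.ext (Equiv.ext fun c => ?_) (joinRel_res h2)
    by_cases hc : p c
    · exact Perm.subtypeCongr.left_apply _ _ hc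
    · exact Perm.subtypeCongr.right_apply _ _ hc
  · rintro ⟨q, hq, rfl⟩
    refine ⟨hF1 q, resp_joinRel _ _, (isMap_split hσ (hF1 q) (resp_joinRel _ _)).1 ?_⟩
    have e3 := hF4 q
    have e4 := hF5 q
    rw [hF2, hF3]
    change IsMap _ _ _ (res p (F q).2) ∧ IsMap _ _ _ (res (fun c => ¬ p c) (F q).2)
    rw [e3, e4]
    exact hq

end Product

/-- The predicate `p` prescribes which corners lie on the side of `x`. A map with the loop from `x`
to `y` and this side is the same as two independent maps, on `p` and on its complement, in which `x`
and `y` are marks. -/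
theorem cnt_cut {D : Type} [Finite D] [DecidableEq D] {σ : Perm D} {X : Set D} {x y : D}
    (hx : x ∉ X) (hy : y ∉ X) (hxy : x ≠ y) (h : σ.SameCycle x y) {p : D → Prop} (hpx : p x)
    (hpy : ¬ p y) (hp : ∀ c, p ((σ * swap x y) c) ↔ p c) :
    {q ∈ maps σ X | q.1 x = y ∧
      ∀ c, p c ↔ (orb (σ * swap x y) ⊔ orb (q.1 * swap x y) ⊔ q.2) x c}.ncard =
    cnt ((σ * swap x y).subtypePerm hp) (Subtype.val ⁻¹' (X ∪ {x, y})) *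
    cnt ((σ * swap x y).subtypePerm (p := fun c => ¬ p c) fun c => not_congr (hp c))
      (Subtype.val ⁻¹' (X ∪ {x, y})) := by
  rw [← cnt_product hp]
  refine ncard_toggle x y fun τ R => ?_
  simp only [Set.mem_ofPred_eq, maps]
  generalize hG : orb (σ * swap x y) ⊔ orb (τ * swap x y) ⊔ R = G
  have hGσ : orb (σ * swap x y) ≤ G := hG ▸ le_sup_left.trans le_sup_left
  have hGτ : orb (τ * swap x y) ≤ G := hG ▸ le_sup_right.trans le_sup_left
  have hGR : R ≤ G := hG ▸ le_sup_right
  constructor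
  · rintro ⟨hm, hxy', hpG⟩
    have hyx : τ y = x := by rw [← hxy', hm.invol]
    obtain ⟨t1, t2⟩ := (toggle_iff hxy hx hy).1 ⟨hm.invol, hm.fix, hxy'⟩
    have hresp : ∀ a b, G a b → (p a ↔ p b) := fun a b hab => by
      rw [hpG, hpG]
      exact ⟨fun h => G.trans h hab, fun h => G.trans h (G.symm hab)⟩
    have hglue : glue G x y = ⊤ := by
      rw [← hm.conn, cut_sup hxy' h, glue_sup, hG]
    refine ⟨fun c => (hresp _ _ (hGτ (orb_apply _ c))).symm, fun a b hab =>
      propext (hresp a b (hGR hab)), t1, t2, fun c => ?_,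
      ((euler_cut hm.invol hm.face hxy hxy' h).1 hm.euler).1, fun a b ha hb => ?_,
      fun a b ha hb => ?_, hm.nosing⟩
    · rw [face_mul_swap σ hxy' hyx]; exact hm.face c
    · exact G.trans (G.symm ((hpG a).1 ha)) ((hpG b).1 hb)
    · have key : ∀ a, ¬ p a → G y a := fun a ha => by
        have h1 : glue G x y y a := by rw [hglue]; trivial
        rcases h1 with h1 | h1 | h1
        · exact h1
        · exact h1.2
        · exact absurd ((hpG a).2 h1.2) ha
      exact G.trans (G.symm (key a ha)) (key b hb)
  · rintro ⟨h1, h2, t1, t2, h3, h4, h5, h6, h7⟩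
    obtain ⟨t1, t2, hxy'⟩ := (toggle_iff hxy hx hy).2 ⟨t1, t2⟩
    have hyx : τ y = x := by rw [← hxy', t1]
    have hresp : Resp p G := hG ▸ ((resp_orb hp).sup (resp_orb h1)).sup h2
    rw [resp_iff] at hresp
    have hface : ∀ c, R c (σ (τ c)) := fun c => by
      rw [← face_mul_swap σ hxy' hyx]; exact h3 c
    refine ⟨⟨t1, t2, hface, (euler_cut t1 hface hxy hxy' h).2 ⟨h4, ?_⟩, ?_, h7⟩, hxy',
      fun c => ⟨h5 x c hpx, fun hc => (hresp x c hc).1 hpx⟩⟩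
    · rw [hG]
      exact fun hc => hpy ((hresp x y hc).1 hpx)
    · rw [cut_sup hxy' h, glue_sup, hG, eq_top_iff]
      intro a b _
      by_cases ha : p a <;> by_cases hb : p b
      · exact Or.inl (h5 a b ha hb)
      · exact Or.inr (Or.inl ⟨h5 a x ha hpx, h6 y b hpy hb⟩)
      · exact Or.inr (Or.inr ⟨h6 a y ha hpy, h5 x b hpx hb⟩)
      · exact Or.inl (h6 a b ha hb)

/-! ### Removal of a mark -/

section Retract
variable {D : Type} [Finite D] {z : D}

omit [Finite D] in
theorem nc_comap {E : Type} {ρ : D → E} (hρ : Function.Surjective ρ) (s : Setoid E) :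
    nc (s.comap ρ) = nc s := by
  refine Nat.card_congr (Equiv.ofBijective
    (Quotient.map (sa := s.comap ρ) (sb := s) ρ fun a b hab => hab) ⟨?_, ?_⟩)
  · intro a b
    induction a using Quotient.inductionOn with | _ a
    induction b using Quotient.inductionOn with | _ b
    intro hab
    exact Quotient.sound (s := s.comap ρ) (Quotient.exact hab : s (ρ a) (ρ b))
  · intro q
    induction q using Quotient.inductionOn with | _ a
    obtain ⟨a, rfl⟩ := hρ a
    exact ⟨Quotient.mk _ a, rfl⟩

/-- The map that moves `z` to `w`. -/
noncomputable def retr (w : {c : D // c ≠ z}) (c : D) : {c : D // c ≠ z} :=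
  open Classical in if h : c = z then w else ⟨c, h⟩

omit [Finite D] in
theorem retr_self (w : {c : D // c ≠ z}) : retr w z = w := by simp [retr]

omit [Finite D] in
theorem retr_of_ne (w : {c : D // c ≠ z}) {c : D} (h : c ≠ z) : retr w c = ⟨c, h⟩ := by
  simp [retr, h]

omit [Finite D] in
theorem retr_val (w c : {c : D // c ≠ z}) : retr w c.1 = c := retr_of_ne w c.2

-- A partition in which `z` is equivalent to `w` is determined by its restriction to the other
-- elements.
omit [Finite D] in
theorem comap_retr_eq {w : {c : D // c ≠ z}} {r : Setoid D} {s : Setoid {c : D // c ≠ z}}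
    (hz : r z w) (h1 : r ≤ s.comap (retr w)) (h2 : s ≤ res (fun c => c ≠ z) r) :
    r = s.comap (retr w) := by
  refine le_antisymm h1 fun a b hab => ?_
  have key : ∀ c, r c (retr w c).1 := fun c => by
    by_cases hc : c = z
    · rw [hc, retr_self]; exact hz
    · rw [retr_of_ne w hc]
  exact r.trans (key a) (r.trans (h2 hab) (r.symm (key b)))

/-- The rotation without the corner `z`. -/
def skip [DecidableEq D] (σ : Perm D) (z : D) : Perm {c : D // c ≠ z} :=
  (σ * swap (σ.symm z) z).subtypePerm fun c => not_congr (by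
    by_cases hc : c = z
    · subst hc
      simp
    · refine iff_of_false (fun h => ?_) hc
      by_cases hu : c = σ.symm z
      · rw [hu, mul_swap_left] at h
        exact hc (by rw [hu, σ.symm_apply_eq, h])
      · rw [mul_swap_other σ hu hc] at h
        exact hu (by rw [← h, σ.symm_apply_apply]))

variable [DecidableEq D] {σ : Perm D}

omit [Finite D] in
theorem skip_apply {c : {c : D // c ≠ z}} (h : σ c ≠ z) : (skip σ z c).1 = σ c := by
  refine mul_swap_other σ (fun e => h ?_) c.2
  rw [e, σ.apply_symm_apply]

omit [Finite D] in
theorem skip_apply' {c : {c : D // c ≠ z}} (h : σ c = z) : (skip σ z c).1 = σ z := by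
  have : c.1 = σ.symm z := (σ.symm_apply_eq.2 h.symm).symm
  change (σ * swap (σ.symm z) z) c.1 = _
  rw [this, mul_swap_left]

omit [Finite D] in
theorem orb_skip (hw : σ z ≠ z) : orb σ = (orb (skip σ z)).comap (retr ⟨σ z, hw⟩) := by
  set w : {c : D // c ≠ z} := ⟨σ z, hw⟩ with hwdef
  refine comap_retr_eq (orb_apply σ z) (orb_le.2 fun c => ?_) (orb_le.2 fun c => ?_)
  · change orb (skip σ z) (retr w c) (retr w (σ c))
    by_cases hc : c = z
    · subst hc
      rw [retr_self, retr_of_ne w hw]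
    rw [retr_of_ne w hc]
    have := orb_apply (skip σ z) ⟨c, hc⟩
    by_cases hσ : σ c = z
    · rw [hσ, retr_self]
      rwa [show skip σ z ⟨c, hc⟩ = w from Subtype.ext (skip_apply' hσ)] at this
    · rw [retr_of_ne w hσ]
      rwa [show skip σ z ⟨c, hc⟩ = ⟨σ c, hσ⟩ from Subtype.ext (skip_apply hσ)] at this
  · change orb σ c.1 (skip σ z c).1
    by_cases hσ : σ c.1 = z
    · rw [skip_apply' hσ]
      have h1 := orb_apply σ c.1
      rw [hσ] at h1
      exact h1.trans (orb_apply σ z)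
    · rw [skip_apply hσ]
      exact orb_apply σ c.1

/-- Removal of a mark. -/
theorem isMap_skip {X : Set D} {τ' : Perm {c : D // c ≠ z}} {R' : Setoid {c : D // c ≠ z}}
    (hz : z ∈ X) (hw : σ z ≠ z) (hns : ∃ c, c ≠ z ∧ c ≠ σ z ∧ R' ⟨σ z, hw⟩ (retr ⟨σ z, hw⟩ c)) :
    IsMap σ X (Perm.ofSubtype τ') (R'.comap (retr ⟨σ z, hw⟩)) ↔
      IsMap (skip σ z) (Subtype.val ⁻¹' X) τ' R' := by
  set w : {c : D // c ≠ z} := ⟨σ z, hw⟩ with hwdef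
  set τ := Perm.ofSubtype τ' with hτdef
  have hτz : τ z = z := Perm.ofSubtype_apply_of_not_mem τ' (by simp)
  have hτc : ∀ c : {c : D // c ≠ z}, τ c.1 = (τ' c).1 := fun c => Perm.ofSubtype_apply_coe τ' c
  have hτp : ∀ c, τ c ≠ z ↔ c ≠ z := fun c => by
    by_cases hc : c = z
    · simp [hc, hτz]
    · exact iff_of_true (by rw [hτc ⟨c, hc⟩]; exact (τ' _).2) hc
  have hτsub : τ.subtypePerm hτp = τ' := by
    ext c
    exact hτc c
  have hsurj : Function.Surjective (retr w) := fun c => ⟨c.1, retr_val w c⟩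
  -- the four partitions
  have eσ : orb σ = (orb (skip σ z)).comap (retr w) := orb_skip hw
  have rτ : Resp (fun c => c ≠ z) (orb τ) := resp_orb hτp
  have eτ : res (fun c => c ≠ z) (orb τ) = orb τ' := by rw [res_orb hτp, hτsub]
  have eτ1 : nc (orb τ) = nc (orb τ') + 1 := by
    rw [nc_split rτ, eτ]
    have : Nonempty {c // ¬ c ≠ z} := ⟨⟨z, by simp⟩⟩
    rw [nc_eq_one (r := res (fun c => ¬ c ≠ z) (orb τ))]
    refine res_eq_top.2 fun a b ha hb => ?_
    rw [not_not] at ha hb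
    rw [ha, hb]
  have eστ : orb σ ⊔ orb τ = (orb (skip σ z) ⊔ orb τ').comap (retr w) := by
    refine comap_retr_eq ((le_sup_left : orb σ ≤ _) (orb_apply σ z)) (sup_le ?_ ?_) (sup_le ?_ ?_)
    · rw [eσ]
      intro a b hab
      exact (le_sup_left : orb (skip σ z) ≤ _) hab
    · refine orb_le.2 fun c => ?_
      change (orb (skip σ z) ⊔ orb τ') (retr w c) (retr w (τ c))
      by_cases hc : c = z
      · rw [hc, hτz]
      · rw [retr_of_ne w hc, retr_of_ne w ((hτp c).2 hc)]
        have := (le_sup_right : orb τ' ≤ orb (skip σ z) ⊔ orb τ') (orb_apply τ' ⟨c, hc⟩)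
        rwa [show τ' ⟨c, hc⟩ = ⟨τ c, (hτp c).2 hc⟩ from Subtype.ext (hτc ⟨c, hc⟩).symm] at this
    · intro a b hab
      refine (le_sup_left : orb σ ≤ orb σ ⊔ orb τ) ?_
      rw [eσ]
      change orb (skip σ z) _ _
      rwa [retr_val, retr_val]
    · rw [← eτ]
      intro a b hab
      exact (le_sup_right : orb τ ≤ orb σ ⊔ orb τ) hab
  set R := R'.comap (retr w) with hR
  have eR : orb σ ⊔ orb τ ⊔ R = (orb (skip σ z) ⊔ orb τ' ⊔ R').comap (retr w) := by
    refine comap_retr_eq ((le_sup_left.trans le_sup_left : orb σ ≤ _) (orb_apply σ z))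
      (sup_le ?_ ?_) (sup_le ?_ ?_)
    · rw [eστ]
      intro a b hab
      exact (le_sup_left : orb (skip σ z) ⊔ orb τ' ≤ _) hab
    · intro a b hab
      exact (le_sup_right : R' ≤ _) hab
    · intro a b hab
      refine (le_sup_left : orb σ ⊔ orb τ ≤ orb σ ⊔ orb τ ⊔ R) ?_
      rw [eστ]
      change (orb (skip σ z) ⊔ orb τ') _ _
      rwa [retr_val, retr_val]
    · intro a b hab
      refine (le_sup_right : R ≤ orb σ ⊔ orb τ ⊔ R) ?_
      change R' _ _
      rwa [retr_val, retr_val]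
  have hcard : Nat.card D = Nat.card {c : D // c ≠ z} + 1 := by
    rw [← Finite.card_option]
    exact Nat.card_congr (Equiv.optionSubtypeNe z).symm
  have hE : Euler σ τ R ↔ Euler (skip σ z) τ' R' := by
    unfold Euler
    rw [eR, eστ, eτ1, eσ, nc_comap hsurj, nc_comap hsurj, nc_comap hsurj, nc_comap hsurj, hcard]
    omega
  have hC : orb σ ⊔ orb τ ⊔ R = ⊤ ↔ orb (skip σ z) ⊔ orb τ' ⊔ R' = ⊤ := by
    rw [eR, eq_top_iff, eq_top_iff]
    constructor
    · intro h a b _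
      have := h (x := a.1) (y := b.1) trivial
      change (orb (skip σ z) ⊔ orb τ' ⊔ R') _ _ at this
      rwa [retr_val, retr_val] at this
    · intro h a b _
      exact h trivial
  have hface : ∀ c : {c : D // c ≠ z}, retr w (σ (τ c.1)) = skip σ z (τ' c) := fun c => by
    rw [hτc c]
    by_cases hσ : σ (τ' c).1 = z
    · rw [hσ, retr_self]
      exact Subtype.ext (skip_apply' hσ).symm
    · rw [retr_of_ne w hσ]
      exact Subtype.ext (skip_apply hσ).symm
  constructor
  · intro h
    refine ⟨fun c => ?_, fun c => ?_, fun c => ?_, hE.1 h.euler, hC.1 h.conn, fun c => ?_⟩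
    · apply Subtype.ext
      rw [← hτc, ← hτc, h.invol]
    · rw [Subtype.ext_iff, ← hτc, h.fix]; rfl
    · have := h.face c.1
      change R' _ _ at this
      rwa [retr_val, hface] at this
    · by_cases hc : c = w
      · obtain ⟨c', h1, h2, h3⟩ := hns
        rw [retr_of_ne w h1] at h3
        exact ⟨⟨c', h1⟩, fun e => h2 (by rw [hc] at e; exact congrArg Subtype.val e), hc ▸ h3⟩
      · obtain ⟨c', h1, h2⟩ := h.nosing c.1
        change R' _ _ at h2
        rw [retr_val] at h2
        refine ⟨retr w c', fun e => ?_, h2⟩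
        by_cases hcz : c' = z
        · rw [hcz, retr_self] at e
          exact hc e.symm
        · rw [retr_of_ne w hcz] at e
          exact h1 (congrArg Subtype.val e)
  · intro h
    refine ⟨fun c => ?_, fun c => ?_, fun c => ?_, hE.2 h.euler, hC.2 h.conn, fun c => ?_⟩
    · by_cases hc : c = z
      · rw [hc, hτz, hτz]
      · rw [hτc ⟨c, hc⟩, hτc, h.invol]
    · by_cases hc : c = z
      · rw [hc]; exact iff_of_true hτz hz
      · rw [hτc ⟨c, hc⟩]
        have := h.fix ⟨c, hc⟩
        rwa [Subtype.ext_iff] at this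
    · change R' _ _
      by_cases hc : c = z
      · rw [hc, hτz, retr_self, retr_of_ne w hw]
      · rw [hface ⟨c, hc⟩, retr_of_ne w hc]
        exact h.face _
    · by_cases hc : c = z
      · refine ⟨σ z, hc ▸ hw, ?_⟩
        change R' _ _
        rw [hc, retr_self, retr_of_ne w hw]
      · obtain ⟨c', h1, h2⟩ := h.nosing ⟨c, hc⟩
        refine ⟨c'.1, fun e => h1 (Subtype.ext e), ?_⟩
        change R' _ _
        rwa [retr_val, retr_of_ne w hc]

end Retract

/-- Without edges the regions contain the vertices, so connectedness leaves a single region. -/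
theorem cnt_all_marks {D : Type} [Finite D] [Nontrivial D] (σ : Perm D) {X : Set D}
    (hX : ∀ c, c ∈ X) : cnt σ X = 1 := by
  rw [cnt, Set.ncard_eq_one]
  refine ⟨(1, ⊤), ?_⟩
  ext ⟨τ, R⟩
  simp only [maps, Set.mem_ofPred_eq, Set.mem_singleton_iff, Prod.mk.injEq]
  constructor
  · intro h
    have hτ : τ = 1 := Equiv.ext fun c => (h.fix c).2 (hX c)
    subst hτ
    have hR : orb σ ≤ R := orb_le.2 (by simpa using h.face)
    have := h.conn
    rw [orb_one, sup_bot_eq, sup_eq_right.2 hR] at this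
    exact ⟨rfl, this⟩
  · rintro ⟨rfl, rfl⟩
    refine ⟨fun c => rfl, fun c => iff_of_true rfl (hX c), fun c => trivial, ?_, by simp,
      fun c => ?_⟩
    · unfold Euler
      rw [orb_one, sup_bot_eq, sup_top_eq, nc_bot, nc_eq_one rfl]
      omega
    · obtain ⟨c', h⟩ := exists_ne c
      exact ⟨c', h, trivial⟩

section
variable {D : Type} [Finite D] [DecidableEq D] {σ : Perm D} {X : Set D} {z : D}

/-- A mark `z` lies in the same region as `σ z`, so nothing is lost when it is identified with `σ
z`. A third corner in the region guarantees that no region becomes a single corner. -/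
theorem cnt_skip (hz : z ∈ X) (hw : σ z ≠ z) :
    {q ∈ maps σ X | ∃ c, c ≠ z ∧ c ≠ σ z ∧ q.2 z c}.ncard
      = cnt (skip σ z) (Subtype.val ⁻¹' X) := by
  classical
  let w : {c : D // c ≠ z} := ⟨σ z, hw⟩
  let F : Perm {c : D // c ≠ z} × Setoid {c : D // c ≠ z} → Perm D × Setoid D :=
    fun q => (Perm.ofSubtype q.1, q.2.comap (retr w))
  have hinj : Function.Injective F := by
    intro q q' h
    have h1 := congrArg Prod.fst h
    have h2 := congrArg Prod.snd h
    refine Prod.ext (Perm.ofSubtype_injective h1) (Setoid.ext fun a b => ?_)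
    have : (q.2.comap (retr w)) a.1 b.1 ↔ (q'.2.comap (retr w)) a.1 b.1 := by
      change (F q).2 _ _ ↔ (F q').2 _ _
      rw [h]
    change q.2 _ _ ↔ q'.2 _ _ at this
    rwa [retr_val, retr_val] at this
  rw [cnt, ← Set.ncard_image_of_injective _ hinj]
  congr 1
  ext ⟨τ, R⟩
  simp only [maps, Set.mem_ofPred_eq, Set.mem_image]
  constructor
  · rintro ⟨hm, c, hc, hcw, hR⟩
    have hτz : τ z = z := (hm.fix z).2 hz
    have hzw : R z (σ z) := by
      have := hm.face z
      rwa [hτz] at this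
    have hτ : ∀ c, τ c ≠ z ↔ c ≠ z := fun c => not_congr
      ⟨fun h => τ.injective (h.trans hτz.symm), fun h => by rw [h, hτz]⟩
    have key : ∀ c, R c (retr w c).1 := fun c => by
      by_cases hc : c = z
      · rw [hc, retr_self]; exact hzw
      · rw [retr_of_ne w hc]
    have eR : R = (res (fun c => c ≠ z) R).comap (retr w) :=
      comap_retr_eq hzw (fun a b hab => R.trans (R.symm (key a)) (R.trans hab (key b))) le_rfl
    have eτ : Perm.ofSubtype (τ.subtypePerm hτ) = τ :=
      Perm.ofSubtype_subtypePerm (p := fun c => c ≠ z) _ fun c hc e => hc (by rw [e, hτz])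
    refine ⟨(τ.subtypePerm hτ, res (fun c => c ≠ z) R), (isMap_skip hz hw ?_).1 ?_,
      Prod.ext eτ eR.symm⟩
    · refine ⟨c, hc, hcw, ?_⟩
      rw [retr_of_ne _ hc]
      exact R.trans (R.symm hzw) hR
    · rw [eτ]
      change IsMap σ X τ ((res (fun c => c ≠ z) R).comap (retr w))
      rwa [← eR]
  · rintro ⟨⟨τ', R'⟩, hm, h⟩
    have h1 : Perm.ofSubtype τ' = τ := congrArg Prod.fst h
    have h2 : R'.comap (retr w) = R := congrArg Prod.snd h
    obtain ⟨c, hc, hR⟩ := hm.nosing w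
    subst h1 h2
    refine ⟨(isMap_skip hz hw ⟨c.1, c.2, fun e => hc (Subtype.ext e), ?_⟩).2 hm,
      c.1, c.2, fun e => hc (Subtype.ext e), ?_⟩
    · rw [retr_val]
      exact hR
    · change R' _ _
      rwa [retr_self, retr_val]

theorem cnt_eq_skip_add (hz : z ∈ X) (hw : σ z ≠ z) :
    cnt σ X = cnt (skip σ z) (Subtype.val ⁻¹' X)
      + {q ∈ maps σ X | ∀ c, c ≠ z → c ≠ σ z → ¬ q.2 z c}.ncard := by
  rw [← cnt_skip hz hw, cnt, ← Set.ncard_union_eq]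
  · congr 1
    ext q
    simp only [Set.mem_union, Set.mem_ofPred_eq]
    by_cases h : ∃ c, c ≠ z ∧ c ≠ σ z ∧ q.2 z c
    · simp [h]
    · simp only [h, and_false, false_or]
      refine (and_iff_left ?_).symm
      exact fun c h1 h2 h3 => h ⟨c, h1, h2, h3⟩
  · rw [Set.disjoint_left]
    rintro q ⟨_, c, h1, h2, h3⟩ ⟨_, h⟩
    exact h c h1 h2 h3

omit [Finite D] [DecidableEq D] in
/-- A mark enclosed in a region of two corners. -/
theorem region_pair {τ : Perm D} {R : Setoid D} (hm : IsMap σ X τ R) (hz : z ∈ X) (hw : σ z ≠ z)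
    (h : ∀ c, c ≠ z → c ≠ σ z → ¬ R z c) :
    R z (σ z) ∧ σ (τ (σ z)) = z ∧ ∀ c, R z c → c = z ∨ c = σ z := by
  have hτz : τ z = z := (hm.fix z).2 hz
  have hzw : R z (σ z) := by
    have := hm.face z
    rwa [hτz] at this
  have h3 : ∀ c, R z c → c = z ∨ c = σ z := fun c hc => by
    by_contra hn
    push Not at hn
    exact h c hn.1 hn.2 hc
  refine ⟨hzw, ?_, h3⟩
  rcases h3 _ (R.trans hzw (hm.face (σ z))) with h4 | h4
  · exact h4
  · exfalso
    have h5 : τ (σ z) = z := σ.injective h4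
    exact hw (by rw [← hm.invol (σ z), h5, hτz])

/-- A region consisting of `z` and `σ z` requires an edge from `σ z` to the corner before `z`. This
is impossible if the two coincide or if the latter is a mark. -/
theorem cnt_mark_of_no_monogon (hz : z ∈ X) (hw : σ z ≠ z) (hwX : σ z ∉ X)
    (hu : σ.symm z = σ z ∨ σ.symm z ∈ X) :
    cnt σ X = cnt (skip σ z) (Subtype.val ⁻¹' X) := by
  rw [cnt_eq_skip_add hz hw, Nat.add_eq_left, Set.ncard_eq_zero]
  refine Set.eq_empty_of_forall_notMem ?_
  rintro ⟨τ, R⟩ ⟨hm, h⟩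
  obtain ⟨_, h2, _⟩ := region_pair hm hz hw h
  have h3 : τ (σ z) = σ.symm z := (σ.symm_apply_eq.2 h2.symm).symm
  rcases hu with hu | hu
  · exact hwX ((hm.fix _).1 (h3.trans hu))
  · have h4 := (hm.fix _).2 hu
    rw [← h3, hm.invol] at h4
    exact hwX ((hm.fix _).1 h4.symm)

/-- If two consecutive marks formed a whole region, they would be closed under `σ`, `τ` and `R`,
against connectedness as soon as there is a third corner. -/
theorem cnt_mark_of_mark (hz : z ∈ X) (hw : σ z ≠ z) (hwX : σ z ∈ X)
    (hD : ∃ c, c ≠ z ∧ c ≠ σ z) :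
    cnt σ X = cnt (skip σ z) (Subtype.val ⁻¹' X) := by
  rw [cnt_eq_skip_add hz hw, Nat.add_eq_left, Set.ncard_eq_zero]
  refine Set.eq_empty_of_forall_notMem ?_
  rintro ⟨τ, R⟩ ⟨hm, h⟩
  obtain ⟨h1, h2, h3⟩ := region_pair hm hz hw h
  have hτz : τ z = z := (hm.fix z).2 hz
  have hτw : τ (σ z) = σ z := (hm.fix _).2 hwX
  rw [hτw] at h2
  obtain ⟨c, hc1, hc2⟩ := hD
  have hresp : Resp (fun c => c = z ∨ c = σ z) (orb σ ⊔ orb τ ⊔ R) := by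
    refine ((resp_orb fun c => ?_).sup (resp_orb fun c => ?_)).sup (resp_iff.2 fun a b hab => ?_)
    · constructor
      · rintro (h | h)
        · right; exact σ.injective (h.trans h2.symm)
        · left; exact σ.injective h
      · rintro (rfl | rfl)
        · right; rfl
        · left; exact h2
    · constructor
      · rintro (h | h)
        · left; exact τ.injective (h.trans hτz.symm)
        · right; exact τ.injective (h.trans hτw.symm)
      · rintro (rfl | rfl)
        · left; exact hτz
        · right; exact hτw
    · have key : ∀ c, (c = z ∨ c = σ z) ↔ R z c := fun c =>
        ⟨by rintro (rfl | rfl); exacts [R.refl _, h1], h3 c⟩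
      rw [key, key]
      exact ⟨fun h => R.trans h hab, fun h => R.trans h (R.symm hab)⟩
  rw [hm.conn, resp_iff] at hresp
  rcases (hresp z c trivial).1 (Or.inl rfl) with h | h
  · exact hc1 h
  · exact hc2 h

-- Once the loop around `z` is cut, `z` and `σ z` form a cycle of their own.
omit [Finite D] in
theorem monogon_invariant (hw : σ z ≠ z) (huw : σ.symm z ≠ σ z) (c : D) :
    ((σ * swap (σ z) (σ.symm z)) c = z ∨ (σ * swap (σ z) (σ.symm z)) c = σ z) ↔
      (c = z ∨ c = σ z) := by
  have hu : σ (σ.symm z) = z := σ.apply_symm_apply z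
  have huz : σ.symm z ≠ z := fun h => hw (by rw [h] at hu; exact hu)
  by_cases h1 : c = σ z
  · subst h1
    rw [mul_swap_left, hu]; simp
  by_cases h2 : c = σ.symm z
  · subst h2
    rw [mul_swap_right]
    have e1 : σ (σ z) ≠ z := fun h => huw (σ.symm_apply_eq.2 h.symm)
    have e2 : σ (σ z) ≠ σ z := fun h => hw (σ.injective h)
    simp [e1, e2, huz, huw]
  rw [mul_swap_other σ h1 h2]
  have e1 : σ c ≠ z := fun h => h2 (σ.symm_apply_eq.2 h.symm).symm
  simp [e1, h1]

/-- Removal of a mark at which a monogon may be attached. -/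
theorem cnt_mark_of_monogon (hz : z ∈ X) (hw : σ z ≠ z) (hwX : σ z ∉ X)
    (huX : σ.symm z ∉ X) (huw : σ.symm z ≠ σ z) :
    cnt σ X = cnt (skip σ z) (Subtype.val ⁻¹' X) +
      cnt ((σ * swap (σ z) (σ.symm z)).subtypePerm (p := fun c => ¬ (c = z ∨ c = σ z))
        fun c => not_congr (monogon_invariant hw huw c))
        (Subtype.val ⁻¹' (X ∪ {σ z, σ.symm z})) := by
  have hu : σ (σ.symm z) = z := σ.apply_symm_apply z
  have huz : σ.symm z ≠ z := fun h => hw (by rw [h] at hu; exact hu)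
  have hsame : σ.SameCycle (σ z) (σ.symm z) := by
    rw [Perm.sameCycle_apply_left, Perm.sameCycle_symm_apply_right]
  have key := cnt_cut hwX huX huw.symm hsame (p := fun c => c = z ∨ c = σ z) (Or.inr rfl)
    (by simp [huz, huw]) (monogon_invariant hw huw)
  rw [cnt_eq_skip_add hz hw]
  congr 1
  have h1 : Nontrivial {c : D // c = z ∨ c = σ z} :=
    ⟨⟨⟨z, Or.inl rfl⟩, ⟨σ z, Or.inr rfl⟩, fun h => hw (congrArg Subtype.val h).symm⟩⟩
  rw [cnt_all_marks ((σ * swap (σ z) (σ.symm z)).subtypePerm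
    (p := fun c => c = z ∨ c = σ z) (monogon_invariant hw huw)), one_mul] at key
  · rw [← key]
    congr 1
    ext ⟨τ, R⟩
    simp only [maps, Set.mem_ofPred_eq]
    refine and_congr_right fun hm => ?_
    have hτz : τ z = z := (hm.fix z).2 hz
    generalize hG : orb (σ * swap (σ z) (σ.symm z)) ⊔ orb (τ * swap (σ z) (σ.symm z)) ⊔ R = G
    have hGR : R ≤ G := hG ▸ le_sup_right
    constructor
    · intro h
      obtain ⟨h1, h2, h3⟩ := region_pair hm hz hw h
      have h4 : τ (σ z) = σ.symm z := (σ.symm_apply_eq.2 h2.symm).symm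
      have hu' : τ (σ.symm z) = σ z := by rw [← h4, hm.invol]
      -- The two corners are closed under the cut rotation, the cut involution and `R`. So they are
      -- exactly what the loop encloses, and the counts for the two sides of the cut apply.
      have hresp : Resp (fun c => c = z ∨ c = σ z) G := by
        rw [← hG]
        refine ((resp_orb (monogon_invariant hw huw)).sup
          (resp_orb fun c => ?_)).sup (resp_iff.2 fun a b hab => ?_)
        · have e1 : (τ * swap (σ z) (σ.symm z)) z = z := by
            rw [mul_swap_other τ hw.symm huz.symm, hτz]
          have e2 : (τ * swap (σ z) (σ.symm z)) (σ z) = σ z := by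
            rw [mul_swap_left, hu']
          constructor
          · rintro (h | h)
            · left; exact (τ * swap (σ z) (σ.symm z)).injective (h.trans e1.symm)
            · right; exact (τ * swap (σ z) (σ.symm z)).injective (h.trans e2.symm)
          · rintro (rfl | rfl)
            · left; exact e1
            · right; exact e2
        · have key : ∀ c, (c = z ∨ c = σ z) ↔ R z c := fun c =>
            ⟨by rintro (rfl | rfl); exacts [R.refl _, h1], h3 c⟩
          rw [key, key]
          exact ⟨fun h => R.trans h hab, fun h => R.trans h (R.symm hab)⟩
      rw [resp_iff] at hresp
      refine ⟨h4, fun c => ⟨?_, fun hc => (hresp _ _ hc).1 (Or.inr rfl)⟩⟩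
      rintro (rfl | rfl)
      · exact G.symm (hGR h1)
      · exact G.refl _
    · rintro ⟨_, h2⟩ c hc1 hc2 hR
      rcases (h2 c).2 (G.trans ((h2 z).1 (Or.inl rfl)) (hGR hR)) with h | h
      · exact hc1 h
      · exact hc2 h
  · rintro ⟨c, rfl | rfl⟩
    · exact Or.inl hz
    · exact Or.inr (Or.inl rfl)

end

/-! ### Vertices with prescribed valencies and at most two marks -/

section Sets
variable {D : Type} [Finite D]

/-- `A` consists of the `e` corners at a vertex of valency `e` without marks; a vertex of valency
zero has one corner, which is a mark. -/
def RegSet (X A : Set D) (e : ℕ) : Prop := A.ncard = max e 1 ∧ ∀ c ∈ A, (c ∈ X ↔ e = 0)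

/-- `A` consists of the corners at a vertex of valency `e` with one mark. -/
def OneSet (X A : Set D) (e : ℕ) : Prop :=
  A.ncard = e + 1 ∧ ∃ z ∈ A, z ∈ X ∧ ∀ c ∈ A, c ∈ X → c = z

/-- `A` consists of the corners at a vertex with two marks, between which there are `a` half-edges
on one side and `b` half-edges on the other. -/
def TwoSet (σ : Perm D) (X A : Set D) (a b : ℕ) : Prop :=
  A.ncard = a + b + 2 ∧ ∃ z ∈ A, ∃ z' ∈ A, z ∈ X ∧ z' ∈ X ∧ z ≠ z' ∧
    (∀ c ∈ A, c ∈ X → c = z ∨ c = z') ∧ (σ ^ (a + 1)) z = z'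

omit [Finite D] in
theorem ncard_preimage_val {q : D → Prop} (A : Set D) :
    (Subtype.val ⁻¹' A : Set {c // q c}).ncard = (A ∩ {c | q c}).ncard := by
  rw [← Set.ncard_image_of_injective _ Subtype.val_injective]
  congr 1
  ext c
  simp [and_comm]

omit [Finite D] in
theorem ncard_preimage_val_of_subset {q : D → Prop} {A : Set D} (h : ∀ c ∈ A, q c) :
    (Subtype.val ⁻¹' A : Set {c // q c}).ncard = A.ncard := by
  rw [ncard_preimage_val, Set.inter_eq_left.2 (show A ⊆ {c | q c} from h)]

omit [Finite D] in
theorem RegSet.sub {q : D → Prop} {X A : Set D} {e : ℕ} (h : RegSet X A e) (hq : ∀ c ∈ A, q c)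
    {X₁ : Set {c // q c}} (hX : ∀ c : {c // q c}, c.1 ∈ A → (c ∈ X₁ ↔ c.1 ∈ X)) :
    RegSet X₁ (Subtype.val ⁻¹' A) e :=
  ⟨by rw [ncard_preimage_val_of_subset hq, h.1], fun c hc => (hX c hc).trans (h.2 _ hc)⟩

end Sets

/-- The vertices other than the special one, which is labelled by `none`: they are labelled by the
elements of `I`, with valencies `dg`. -/
structure Base {D ι : Type} (σ : Perm D) (X : Set D) (v : D → Option ι) (I : Finset ι)
    (dg : ι → ℕ) : Prop where
  same : ∀ a b, σ.SameCycle a b ↔ v a = v b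
  reg : ∀ i ∈ I, RegSet X (v ⁻¹' {some i}) (dg i)
  out : ∀ c i, v c = some i → i ∈ I

section Values
variable {ι : Type} (I : Finset ι) (dg : ι → ℕ)

def PlainVal (d n : ℕ) : Prop :=
  ∀ (D : Type) [Finite D] (σ : Perm D) (X : Set D) (v : D → Option ι), Base σ X v I dg →
    RegSet X (v ⁻¹' {none}) d → cnt σ X = n

def OneVal (e n : ℕ) : Prop :=
  ∀ (D : Type) [Finite D] (σ : Perm D) (X : Set D) (v : D → Option ι), Base σ X v I dg →
    OneSet X (v ⁻¹' {none}) e → cnt σ X = n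

def TwoVal (a b n : ℕ) : Prop :=
  ∀ (D : Type) [Finite D] (σ : Perm D) (X : Set D) (v : D → Option ι), Base σ X v I dg →
    TwoSet σ X (v ⁻¹' {none}) a b → cnt σ X = n

/-- The product of the numbers of maps on both sides of a loop. -/
def ProdVal (J : Finset ι) (e f n : ℕ) : Prop :=
  ∀ (D D' : Type) [Finite D] [Finite D'] (σ : Perm D) (X : Set D) (v : D → Option ι)
    (σ' : Perm D') (X' : Set D') (v' : D' → Option ι), Base σ X v I dg →
    OneSet X (v ⁻¹' {none}) e → Base σ' X' v' J dg → OneSet X' (v' ⁻¹' {none}) f →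
    cnt σ X * cnt σ' X' = n

end Values

/-! ### Cycle lengths at labelled vertices -/

section Period
variable {D ι : Type} [Finite D] {σ : Perm D} {v : D → ι}

theorem period_eq (h : ∀ a b, σ.SameCycle a b ↔ v a = v b) (z : D) :
    Function.minimalPeriod σ z = (v ⁻¹' {v z}).ncard := by
  have : Fintype D := Fintype.ofFinite D
  classical
  have e1 : Function.minimalPeriod (σ • · : D → D) z =
      Fintype.card (MulAction.orbit (Subgroup.zpowers σ) z) :=
    MulAction.minimalPeriod_eq_card σ z
  have e2 : Function.minimalPeriod σ z = Function.minimalPeriod (σ • · : D → D) z := rfl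
  rw [e2, e1, ← Nat.card_eq_fintype_card, Nat.card_coe_set_eq]
  congr 1
  ext c
  rw [Set.mem_preimage, Set.mem_singleton_iff, eq_comm, ← h]
  constructor
  · rintro ⟨⟨_, i, rfl⟩, rfl⟩
    exact ⟨i, rfl⟩
  · rintro ⟨i, rfl⟩
    exact ⟨⟨_, i, rfl⟩, rfl⟩

theorem pow_period (h : ∀ a b, σ.SameCycle a b ↔ v a = v b) {z : D} {n : ℕ}
    (hn : (v ⁻¹' {v z}).ncard = n) : (σ ^ n) z = z := by
  rw [← hn, ← period_eq h z]
  exact Function.isPeriodicPt_minimalPeriod σ z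

theorem pow_inj (h : ∀ a b, σ.SameCycle a b ↔ v a = v b) {z : D} {n : ℕ}
    (hn : (v ⁻¹' {v z}).ncard = n) {i j : ℕ} (hi : i < n) (hj : j < n) :
    (σ ^ i) z = (σ ^ j) z ↔ i = j := by
  rw [← hn, ← period_eq h z] at hi hj
  exact Function.iterate_eq_iterate_iff_of_lt_minimalPeriod hi hj

theorem exists_pow_lt (h : ∀ a b, σ.SameCycle a b ↔ v a = v b) {z c : D} {n : ℕ}
    (hn : (v ⁻¹' {v z}).ncard = n) (hc : v c = v z) : ∃ i < n, (σ ^ i) z = c := by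
  obtain ⟨i, _, hi⟩ := sameCycle_exists_pow ((h z c).2 hc.symm)
  have hp : 0 < Function.minimalPeriod σ z :=
    Function.minimalPeriod_pos_of_mem_periodicPts (Function.mem_periodicPts.2
      (let ⟨m, hm, e⟩ := sameCycle_exists_pow (Perm.SameCycle.refl σ z); ⟨m, hm, e⟩))
  refine ⟨i % n, ?_, ?_⟩
  · rw [← hn, ← period_eq h z]; exact Nat.mod_lt _ hp
  · rw [← hn, ← period_eq h z, ← hi]
    exact Function.iterate_mod_minimalPeriod_eq

omit [Finite D] in
theorem label_pow (h : ∀ a b, σ.SameCycle a b ↔ v a = v b) (z : D) (i : ℕ) :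
    v ((σ ^ i) z) = v z := ((h _ _).1 ⟨i, by simp⟩).symm

omit [Finite D] in
theorem label_apply (h : ∀ a b, σ.SameCycle a b ↔ v a = v b) (z : D) : v (σ z) = v z :=
  label_pow h z 1

end Period

/-! ### Vertex labels after the removal of a mark -/

section Steps
variable {D ι : Type} [Finite D] {σ : Perm D} {X : Set D} {v : D → Option ι} {I : Finset ι}
  {dg : ι → ℕ}

omit [Finite D] in
/-- Restriction to a subset of the corners. -/
theorem Base.sub (h : Base σ X v I dg) {q : D → Prop} {J : Finset ι} {σ₁ : Perm {c // q c}}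
    {X₁ : Set {c // q c}} (hsame : ∀ a b, σ₁.SameCycle a b ↔ v a.1 = v b.1)
    (hJI : J ⊆ I) (hJ : ∀ c, q c → ∀ i, v c = some i → i ∈ J)
    (hq : ∀ i ∈ J, ∀ c, v c = some i → q c)
    (hX : ∀ c : {c // q c}, v c.1 ≠ none → (c ∈ X₁ ↔ c.1 ∈ X)) :
    Base σ₁ X₁ (fun c => v c.1) J dg :=
  ⟨hsame, fun i hi => (h.reg i (hJI hi)).sub (fun c hc => hq i hi c hc)
    fun c hc => hX c (by rw [show v c.1 = some i from hc]; simp),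
    fun c i hi => hJ c.1 c.2 i hi⟩

omit [Finite D] in
theorem skip_sameCycle [DecidableEq D] {z : D} (hw : σ z ≠ z) (a b : {c // c ≠ z}) :
    (skip σ z).SameCycle a b ↔ σ.SameCycle a b := by
  have eσ : orb σ = (orb (skip σ z)).comap (retr ⟨σ z, hw⟩) := orb_skip hw
  have : orb σ a b ↔ orb (skip σ z) (retr ⟨σ z, hw⟩ a.1) (retr ⟨σ z, hw⟩ b.1) := by
    rw [eσ]; rfl
  rw [retr_val, retr_val] at this
  exact this.symm

-- The cut only separates the cycles of `x` and `y`. A part that does not contain both of them meets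
-- each old cycle in at most one new one.
omit [Finite D] in
theorem cut_sub_sameCycle [DecidableEq D] {x y : D} (hxy : σ.SameCycle x y) {q : D → Prop}
    (hq : ∀ c, q ((σ * swap x y) c) ↔ q c) (hn : ¬ (q x ∧ q y)) (a b : {c // q c}) :
    ((σ * swap x y).subtypePerm hq).SameCycle a b ↔ σ.SameCycle a b := by
  rw [Perm.sameCycle_subtypePerm]
  have e : orb σ a b ↔ glue (orb (σ * swap x y)) x y a b := by rw [orb_cut hxy]
  have hr := resp_iff.1 (resp_orb hq)
  refine Iff.trans ?_ e.symm
  constructor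
  · exact fun h => Or.inl h
  · rintro (h | ⟨h, h'⟩ | ⟨h, h'⟩)
    · exact h
    · exact absurd ⟨(hr _ _ h).1 a.2, (hr _ _ h').2 b.2⟩ hn
    · exact absurd ⟨(hr _ _ h').2 b.2, (hr _ _ h).1 a.2⟩ hn

omit [Finite D] in
theorem Base.skip [DecidableEq D] (h : Base σ X v I dg) {z : D} (hz : v z = none)
    (hw : σ z ≠ z) : Base (skip σ z) (Subtype.val ⁻¹' X) (fun c => v c.1) I dg :=
  h.sub (fun a b => (skip_sameCycle hw a b).trans (h.same _ _)) subset_rfl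
    (fun c _ i hi => h.out c i hi) (fun i _ c hc => by rintro rfl; rw [hz] at hc; cases hc)
    (fun c _ => Iff.rfl)

omit [Finite D] in
theorem ncard_skip {z : D} (hz : v z = none) {n : ℕ} (hn : (v ⁻¹' {none}).ncard = n + 1) :
    ((fun c : {c // c ≠ z} => v c.1) ⁻¹' {none}).ncard = n := by
  change (Subtype.val ⁻¹' (v ⁻¹' {none}) : Set {c // c ≠ z}).ncard = n
  rw [ncard_preimage_val]
  have : v ⁻¹' {none} ∩ {c | c ≠ z} = v ⁻¹' {none} \ {z} := by ext c; simp
  rw [this, Set.ncard_sdiff_singleton_of_mem (by simpa using hz), hn, Nat.add_sub_cancel]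

omit [Finite D] in
theorem Base.monogon [DecidableEq D] (h : Base σ X v I dg) {z : D} (hz : v z = none)
    (hw : σ z ≠ z) (huw : σ.symm z ≠ σ z) :
    Base ((σ * swap (σ z) (σ.symm z)).subtypePerm (p := fun c => ¬ (c = z ∨ c = σ z))
        fun c => not_congr (monogon_invariant hw huw c))
        (Subtype.val ⁻¹' (X ∪ {σ z, σ.symm z})) (fun c => v c.1) I dg := by
  have hsame : σ.SameCycle (σ z) (σ.symm z) := by
    rw [Perm.sameCycle_apply_left, Perm.sameCycle_symm_apply_right]
  have hvw : v (σ z) = none := (label_apply h.same z).trans hz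
  have hvu : v (σ.symm z) = none := by
    rw [← label_apply h.same, σ.apply_symm_apply, hz]
  refine h.sub (fun a b => (cut_sub_sameCycle hsame _ ?_ a b).trans (h.same _ _)) subset_rfl
    (fun c _ i hi => h.out c i hi) (fun i _ c hc => ?_) (fun c hc => ?_)
  · simp
  · rintro (rfl | rfl)
    · rw [hz] at hc; cases hc
    · rw [hvw] at hc; cases hc
  · have h1 : c.1 ≠ σ z := fun e => hc (by rw [e]; exact hvw)
    have h2 : c.1 ≠ σ.symm z := fun e => hc (by rw [e]; exact hvu)
    simp [h1, h2]

omit [Finite D] in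
theorem ncard_monogon {z : D} (hz : v z = none) (hw : σ z ≠ z) (hvw : v (σ z) = none) {n : ℕ}
    (hn : (v ⁻¹' {none}).ncard = n + 2) :
    ((fun c : {c // ¬ (c = z ∨ c = σ z)} => v c.1) ⁻¹' {none}).ncard = n := by
  change (Subtype.val ⁻¹' (v ⁻¹' {none}) : Set {c // ¬ (c = z ∨ c = σ z)}).ncard = n
  rw [ncard_preimage_val]
  have : v ⁻¹' {none} ∩ {c | ¬ (c = z ∨ c = σ z)} = (v ⁻¹' {none} \ {z}) \ {σ z} := by
    ext c; simp; tauto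
  rw [this, Set.ncard_sdiff_singleton_of_mem (by simp [hvw, hw]),
    Set.ncard_sdiff_singleton_of_mem (by simpa using hz), hn]
  rfl

end Steps

/-! ### Recursions for vertices with marks -/

section ValueSteps
variable {ι : Type} {I : Finset ι} {dg : ι → ℕ}

/-- A single corner that is a mark is the same as a vertex of valency zero. -/
theorem one_zero {n : ℕ} (h : PlainVal I dg 0 n) : OneVal I dg 0 n := by
  rintro D _ σ X v hB ⟨hn, z, hz, hzX, hu⟩
  refine h D σ X v hB ⟨hn, fun c hc => iff_of_true ?_ rfl⟩
  obtain ⟨a, ha⟩ := Set.ncard_eq_one.1 hn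
  rw [ha] at hz hc
  rw [Set.mem_singleton_iff.1 hc, ← Set.mem_singleton_iff.1 hz]
  exact hzX

theorem sigma_ne {D : Type} [Finite D] {σ : Perm D} {v : D → Option ι}
    (h : ∀ a b, σ.SameCycle a b ↔ v a = v b) {z : D} (hz : v z = none)
    (hn : 1 < (v ⁻¹' {none}).ncard) : σ z ≠ z := by
  have := (pow_inj h (z := z) (by rw [hz]) (i := 1) (j := 0) hn (by omega)).not.2 one_ne_zero
  simpa using this

theorem RegSet.of_skip {D : Type} [Finite D] {X : Set D} {v : D → Option ι} {z : D}
    (hz : v z = none) {e : ℕ} (hn : (v ⁻¹' {none}).ncard = e + 1 + 1)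
    (hu : ∀ c ∈ v ⁻¹' {none}, c ∈ X → c = z) :
    RegSet (Subtype.val ⁻¹' X : Set {c // c ≠ z}) ((fun c => v c.1) ⁻¹' {none}) (e + 1) :=
  ⟨by rw [ncard_skip hz hn]; simp, fun c hc => iff_of_false (fun hX => c.2 (hu c.1 hc hX)) (by simp)⟩

/-- A loop around the mark would need two half-edges. -/
theorem one_one {n : ℕ} (h : PlainVal I dg 1 n) : OneVal I dg 1 n := by
  classical
  rintro D _ σ X v hB ⟨hn, z, hz, hzX, hu⟩
  replace hz : v z = none := hz
  have hw := sigma_ne hB.same hz (by omega)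
  have hvw : v (σ z) = none := (label_apply hB.same z).trans hz
  have h2 : (σ ^ 2) z = z := pow_period hB.same (by rw [hz, hn])
  rw [cnt_mark_of_no_monogon hzX hw (fun h => hw (hu _ hvw h))
    (Or.inl (σ.symm_apply_eq.2 h2.symm))]
  exact h _ _ _ _ (hB.skip hz hw) (RegSet.of_skip hz hn hu)

theorem pow_pred {D : Type} {σ : Perm D} {z : D} {n : ℕ} (h : (σ ^ (n + 1)) z = z) :
    σ.symm z = (σ ^ n) z := by
  rw [σ.symm_apply_eq, ← Perm.mul_apply, ← pow_succ', h]

/-- Either the mark can be erased, or it is enclosed by a loop between its two neighbours. In the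
second case the loop is cut off, and its outer end takes over the role of the mark. -/
theorem one_step {e n₁ n₂ : ℕ} (h₁ : PlainVal I dg (e + 2) n₁) (h₂ : OneVal I dg e n₂) :
    OneVal I dg (e + 2) (n₁ + n₂) := by
  classical
  rintro D _ σ X v hB ⟨hn, z, hz, hzX, hu⟩
  replace hz : v z = none := hz
  have hw := sigma_ne hB.same hz (by omega)
  have hvw : v (σ z) = none := (label_apply hB.same z).trans hz
  have hvu : v (σ.symm z) = none := by
    rw [← label_apply hB.same, σ.apply_symm_apply, hz]
  have hsymm : σ.symm z = (σ ^ (e + 2)) z := pow_pred (pow_period hB.same (by rw [hz, hn]))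
  have huz : σ.symm z ≠ z := fun h => hw (by rw [σ.symm_apply_eq] at h; exact h.symm)
  have huw : σ.symm z ≠ σ z := by
    rw [hsymm]
    exact (pow_inj hB.same (z := z) (by rw [hz, hn]) (i := e + 2) (j := 1) (by omega)
      (by omega)).not.2 (by omega)
  rw [cnt_mark_of_monogon hzX hw (fun h => hw (hu _ hvw h)) (fun h => huz (hu _ hvu h)) huw]
  congr 1
  · exact h₁ _ _ _ _ (hB.skip hz hw) (RegSet.of_skip hz hn hu)
  · refine h₂ _ _ _ _ (hB.monogon hz hw huw) ⟨ncard_monogon hz hw hvw (by omega), ?_⟩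
    refine ⟨⟨σ.symm z, by simp [huz, huw]⟩, hvu, by simp, ?_⟩
    rintro ⟨c, hc⟩ hcn hcX
    apply Subtype.ext
    rcases hcX with hcX | hcX | hcX
    · exact absurd (Or.inl (hu c hcn hcX)) hc
    · exact absurd (Or.inr hcX) hc
    · exact hcX

theorem two_symm {D : Type} [Finite D] {σ : Perm D} {X : Set D} {v : D → Option ι}
    (hB : Base σ X v I dg) {a b : ℕ} (h : TwoSet σ X (v ⁻¹' {none}) a b) :
    TwoSet σ X (v ⁻¹' {none}) b a := by
  obtain ⟨hn, z, hz, z', hz', hzX, hzX', hzz, hu, hp⟩ := h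
  refine ⟨by omega, z', hz', z, hz, hzX', hzX, hzz.symm, fun c hc hcX => (hu c hc hcX).symm, ?_⟩
  rw [← hp, ← Perm.mul_apply, ← pow_add]
  exact pow_period hB.same (by rw [show v z = none from hz, hn]; omega)

/-- Of two adjacent marks one is redundant. The assumption provides a third corner, without which
the remaining mark would be alone in its region. -/
theorem two_zero_left {b n : ℕ} (hne : I.Nonempty ∨ 0 < b) (h : OneVal I dg b n) :
    TwoVal I dg 0 b n := by
  classical
  rintro D _ σ X v hB ⟨hn, z, hz, z', hz', hzX, hzX', hzz, hu, hp⟩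
  replace hz : v z = none := hz
  replace hz' : v z' = none := hz'
  have hp' : σ z = z' := by simpa using hp
  have hw : σ z ≠ z := by rw [hp']; exact hzz.symm
  rw [cnt_mark_of_mark hzX hw (hp' ▸ hzX')]
  · refine h _ _ _ _ (hB.skip hz hw) ⟨ncard_skip hz (by omega), ⟨z', hzz.symm⟩, hz', hzX', ?_⟩
    rintro ⟨c, hc⟩ hcn hcX
    exact Subtype.ext ((hu c hcn hcX).resolve_left hc)
  · rcases hne with ⟨i, hi⟩ | hb
    · have h1 : (v ⁻¹' {some i}).ncard ≠ 0 := by rw [(hB.reg i hi).1]; omega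
      obtain ⟨c, hc⟩ := Set.nonempty_of_ncard_ne_zero h1
      replace hc : v c = some i := hc
      refine ⟨c, ?_, ?_⟩
      · rintro rfl; rw [hz] at hc; cases hc
      · rintro rfl; rw [hp', hz'] at hc; cases hc
    · have hn' : (v ⁻¹' {v z}).ncard = 0 + b + 2 := by rw [hz, hn]
      refine ⟨(σ ^ 2) z, ?_, ?_⟩
      · exact (pow_inj hB.same hn' (i := 2) (j := 0) (by omega) (by omega)).not.2 (by omega)
      · exact (pow_inj hB.same hn' (i := 2) (j := 1) (by omega) (by omega)).not.2 (by omega)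

theorem two_zero_right {a n : ℕ} (hne : I.Nonempty ∨ 0 < a) (h : OneVal I dg a n) :
    TwoVal I dg a 0 n :=
  fun D _ σ X v hB hT => two_zero_left hne h D σ X v hB (two_symm hB hT)

theorem two_step {a b n₁ n₂ : ℕ} (h₁ : OneVal I dg (a + b + 2) n₁) (h₂ : TwoVal I dg a b n₂) :
    TwoVal I dg (a + 1) (b + 1) (n₁ + n₂) := by
  classical
  rintro D _ σ X v hB ⟨hn, z, hz, z', hz', hzX, hzX', hzz, hu, hp⟩
  replace hz : v z = none := hz
  replace hz' : v z' = none := hz'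
  have hn' : (v ⁻¹' {v z}).ncard = a + b + 4 := by rw [hz, hn]; omega
  have hw := sigma_ne hB.same hz (by omega)
  have hvw : v (σ z) = none := (label_apply hB.same z).trans hz
  have hvu : v (σ.symm z) = none := by
    rw [← label_apply hB.same, σ.apply_symm_apply, hz]
  have hsymm : σ.symm z = (σ ^ (a + b + 3)) z := pow_pred (pow_period hB.same hn')
  have hinj : ∀ i j, i < a + b + 4 → j < a + b + 4 → i ≠ j → (σ ^ i) z ≠ (σ ^ j) z :=
    fun i j hi hj hij => (pow_inj hB.same hn' hi hj).not.2 hij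
  have huz : σ.symm z ≠ z := by
    rw [hsymm]; exact hinj (a + b + 3) 0 (by omega) (by omega) (by omega)
  have huw : σ.symm z ≠ σ z := by
    rw [hsymm]; exact hinj (a + b + 3) 1 (by omega) (by omega) (by omega)
  have hwz' : σ z ≠ z' := by
    rw [← hp]; exact hinj 1 (a + 1 + 1) (by omega) (by omega) (by omega)
  have huz' : σ.symm z ≠ z' := by
    rw [← hp, hsymm]; exact hinj _ _ (by omega) (by omega) (by omega)
  have hmem : ∀ c, v c = none → c ≠ z → c ≠ z' → c ∉ X := fun c h h1 h2 hX =>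
    (hu c h hX).elim h1 h2
  rw [cnt_mark_of_monogon hzX hw (hmem _ hvw hw hwz') (hmem _ hvu huz huz') huw]
  congr 1
  · refine h₁ _ _ _ _ (hB.skip hz hw) ⟨ncard_skip hz (by omega), ⟨z', hzz.symm⟩, hz', hzX', ?_⟩
    rintro ⟨c, hc⟩ hcn hcX
    exact Subtype.ext ((hu c hcn hcX).resolve_left hc)
  · refine h₂ _ _ _ _ (hB.monogon hz hw huw) ⟨ncard_monogon hz hw hvw (by omega),
      ⟨σ.symm z, by simp [huz, huw]⟩, hvu, ⟨z', by simp [hzz.symm, hwz'.symm]⟩, hz', by simp,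
      Or.inl hzX', fun h => huz' (congrArg Subtype.val h), ?_, ?_⟩
    · rintro ⟨c, hc⟩ hcn hcX
      rcases hcX with hcX | hcX | hcX
      · rcases hu c hcn hcX with h | h
        · exact absurd (Or.inl h) hc
        · exact Or.inr (Subtype.ext h)
      · exact absurd (Or.inr hcX) hc
      · exact Or.inl (Subtype.ext hcX)
    · apply Subtype.ext
      rw [Perm.subtypePerm_pow]
      change ((σ * swap (σ z) (σ.symm z)) ^ (a + 1)) (σ.symm z) = z'
      -- The new mark is `σ.symm z`, from which the cut rotation continues as `σ` does from `σ z`.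
      -- After `a + 1` steps it arrives at `(σ ^ (a + 2)) z = z'`.
      rw [swap_comm, (cut_pow (m := a + b + 2) ?_ ?_).2 (a + 1) (by omega) (by omega), ← hp]
      · rw [pow_succ σ (a + 1)]; rfl
      · rw [hsymm, pow_succ σ (a + b + 2)]; rfl
      · intro i _ hi
        have e : (σ ^ i) (σ z) = (σ ^ (i + 1)) z := by rw [pow_succ]; rfl
        rw [e, hsymm]
        exact hinj _ _ (by omega) (by omega) (by omega)

end ValueSteps

theorem ncard_eq_sum_fiber {α β : Type} [Finite α] (A : Set α) (f : α → β) (T : Finset β)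
    (h : ∀ q ∈ A, f q ∈ T) : A.ncard = ∑ b ∈ T, {q ∈ A | f q = b}.ncard := by
  classical
  have : Fintype α := Fintype.ofFinite α
  rw [Set.ncard_eq_toFinset_card']
  rw [Finset.card_eq_sum_card_fiberwise (f := f) (t := T) (fun q hq => h q (by simpa using hq))]
  refine Finset.sum_congr rfl fun b _ => ?_
  rw [Set.ncard_eq_toFinset_card']
  congr 1
  ext q
  simp

/-! ### Recursion at a vertex without marks -/

section
variable {D ι : Type} [Finite D] {σ : Perm D} {X : Set D} {v : D → Option ι} {I : Finset ι}
  {dg : ι → ℕ} {d : ℕ}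

theorem merge_val [DecidableEq D] [DecidableEq ι] (hB : Base σ X v I dg)
    (hN : RegSet X (v ⁻¹' {none}) d) (hd : 0 < d) {x y : D} {j : ι} (hx : v x = none)
    (hy : v y = some j) (hj : 0 < dg j) {n : ℕ}
    (h2 : TwoVal (I.erase j) dg (d - 1) (dg j - 1) n) :
    {q ∈ maps σ X | q.1 x = y}.ncard = n := by
  have hjI : j ∈ I := hB.out y j hy
  have hRj := hB.reg j hjI
  have hxX : x ∉ X := fun h => hd.ne' ((hN.2 x hx).1 h)
  have hyX : y ∉ X := fun h => hj.ne' ((hRj.2 y hy).1 h)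
  have hs : ¬ σ.SameCycle x y := by rw [hB.same, hx, hy]; simp
  have hxy : x ≠ y := fun e => hs (e ▸ Perm.SameCycle.refl _ _)
  rw [cnt_merge hxX hyX hs]
  have hfib : ∀ i, i ≠ j → (fun c => if v c = some j then none else v c) ⁻¹' {some i}
      = v ⁻¹' {some i} := fun i hi => by
    ext c
    simp only [Set.mem_preimage, Set.mem_singleton_iff]
    by_cases hc : v c = some j
    · simp [hc, hi.symm]
    · simp [hc]
  -- The vertex `j` is absorbed by the special vertex, so its corners receive the label `none`.
  refine h2 D _ _ (fun c => if v c = some j then none else v c) ⟨fun a b => ?_, fun i hi => ?_,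
    fun c i hc => ?_⟩ ?_
  · change orb (σ * swap x y) a b ↔ _
    rw [orb_merge hs, glue_iff]
    change σ.SameCycle a b ∨ (σ.SameCycle a x ∧ σ.SameCycle y b) ∨
      (σ.SameCycle a y ∧ σ.SameCycle x b) ↔ _
    rw [hB.same, hB.same, hB.same, hB.same, hB.same, hx, hy]
    by_cases ha : v a = some j <;> by_cases hb : v b = some j
    · simp [ha, hb]
    · simp [ha, hb, Ne.symm hb]
    · simp [ha, hb]
    · simp [ha, hb, Ne.symm hb]
  · have hij := Finset.ne_of_mem_erase hi
    rw [hfib i hij]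
    have hR := hB.reg i (Finset.mem_of_mem_erase hi)
    refine ⟨hR.1, fun c hc => ?_⟩
    rw [← hR.2 c hc]
    have h1 : c ≠ x := by rintro rfl; rw [Set.mem_preimage, hx] at hc; cases hc
    have h2 : c ≠ y := by
      rintro rfl; rw [Set.mem_preimage, hy] at hc
      exact hij (Option.some.inj hc).symm
    simp [h1, h2]
  · change (if v c = some j then none else v c) = some i at hc
    split_ifs at hc with h
    refine Finset.mem_erase.2 ⟨?_, hB.out c i hc⟩
    rintro rfl
    exact h hc
  · have hset : (fun c => if v c = some j then none else v c) ⁻¹' {none}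
        = v ⁻¹' {none} ∪ v ⁻¹' {some j} := by
      ext c
      simp only [Set.mem_preimage, Set.mem_singleton_iff, Set.mem_union]
      by_cases hc : v c = some j
      · simp [hc]
      · simp [hc]
    have hcx : (v ⁻¹' {v x}).ncard = d := by rw [hx, hN.1]; omega
    rw [hset]
    refine ⟨?_, y, Or.inr hy, x, Or.inl hx, by simp, by simp, hxy.symm, ?_, ?_⟩
    · rw [Set.ncard_union_eq, hN.1, hRj.1]
      · omega
      · rw [Set.disjoint_left]
        intro c h1 h2
        rw [Set.mem_preimage, Set.mem_singleton_iff] at h1 h2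
        rw [h1] at h2
        cases h2
    · rintro c hc (hcX | hcX | hcX)
      · rcases hc with hc | hc
        · exact absurd ((hN.2 c hc).1 hcX) hd.ne'
        · exact absurd ((hRj.2 c hc).1 hcX) hj.ne'
      · exact Or.inr hcX
      · exact Or.inl hcX
    · rw [show d - 1 + 1 = d by omega, swap_comm,
        merge_pow (m := d) (fun h => hs h.symm) (fun i h0 h1 => ?_) d hd le_rfl]
      · exact pow_period hB.same hcx
      · exact (pow_inj hB.same hcx h1 hd).not.2 h0.ne'

/-- The corners on the side of `x` after a cut that leaves the vertices `J` on this side. -/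
def side (σ' : Perm D) (v : D → Option ι) (x : D) (J : Finset ι) (c : D) : Prop :=
  (v c = none ∧ σ'.SameCycle x c) ∨ ∃ i ∈ J, v c = some i

omit [Finite D] in
theorem side_none {σ' : Perm D} {x : D} {J : Finset ι} {c : D} (hc : v c = none) :
    side σ' v x J c ↔ σ'.SameCycle x c := by
  simp [side, hc]

omit [Finite D] in
theorem side_some {σ' : Perm D} {x : D} {J : Finset ι} {c : D} {i : ι} (hc : v c = some i) :
    side σ' v x J c ↔ i ∈ J := by
  simp [side, hc]

omit [Finite D] in
theorem label_cut [DecidableEq D] (hB : Base σ X v I dg) {x y : D} (h : v x = v y) (c : D) :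
    v ((σ * swap x y) c) = v c := by
  by_cases h1 : c = x
  · subst h1; rw [mul_swap_left, label_apply hB.same, h]
  by_cases h2 : c = y
  · subst h2; rw [mul_swap_right, label_apply hB.same, h]
  rw [mul_swap_other σ h1 h2, label_apply hB.same]

omit [Finite D] in
theorem side_invariant [DecidableEq D] (hB : Base σ X v I dg) {x y : D} (h : v x = v y)
    (J : Finset ι) (c : D) :
    side (σ * swap x y) v x J ((σ * swap x y) c) ↔ side (σ * swap x y) v x J c := by
  unfold side
  rw [label_cut hB h, Perm.sameCycle_apply_right]

theorem side_iff [DecidableEq D] (hB : Base σ X v I dg) {x y : D} (hx : v x = none)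
    (hy : v y = none) (hxy : x ≠ y) {τ : Perm D} {R : Setoid D} (hm : IsMap σ X τ R)
    (hτ : τ x = y) {J : Finset ι} (hJ : J ⊆ I) :
    (∀ i, i ∈ J ↔ i ∈ I ∧
      ∃ c, v c = some i ∧ (orb (σ * swap x y) ⊔ orb (τ * swap x y) ⊔ R) x c) ↔
    ∀ c, side (σ * swap x y) v x J c ↔ (orb (σ * swap x y) ⊔ orb (τ * swap x y) ⊔ R) x c := by
  have hs : σ.SameCycle x y := (hB.same x y).2 (hx.trans hy.symm)
  have hn := ((euler_cut hm.invol hm.face hxy hτ hs).1 hm.euler).2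
  generalize hG : orb (σ * swap x y) ⊔ orb (τ * swap x y) ⊔ R = G at hn ⊢
  have hGσ : orb (σ * swap x y) ≤ G := hG ▸ le_sup_left.trans le_sup_left
  -- The cut affects the special vertex only; all other vertices stay whole.
  have hcut : ∀ a b, σ.SameCycle a b → v a ≠ none → (σ * swap x y).SameCycle a b := by
    intro a b hab ha
    have : orb σ a b := hab
    rw [orb_cut hs] at this
    have key : ∀ w, v w = none → ¬ (σ * swap x y).SameCycle a w := by
      intro w hw ⟨i, hi⟩
      apply ha
      have : ∀ c, v c = v ((σ * swap x y) c) := fun c => (label_cut hB (hx.trans hy.symm) c).symm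
      have h2 : orb (σ * swap x y) ≤ Setoid.ker v := orb_le.2 this
      have h3 : v a = v w := h2 ⟨i, hi⟩
      rw [h3, hw]
    rcases this with h | ⟨h, _⟩ | ⟨h, _⟩
    · exact h
    · exact absurd h (key x hx)
    · exact absurd h (key y hy)
  have hfib : ∀ i ∈ I, ∃ c, v c = some i := fun i hi => by
    have h1 : (v ⁻¹' {some i}).ncard ≠ 0 := by rw [(hB.reg i hi).1]; omega
    exact Set.nonempty_of_ncard_ne_zero h1
  constructor
  · intro h c
    rcases hc : v c with _ | i
    · rw [side_none hc]
      refine ⟨fun h => hGσ h, fun h => ?_⟩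
      have h1 : orb σ x c := (hB.same x c).2 (hx.trans hc.symm)
      rw [orb_cut hs] at h1
      rcases h1 with h1 | ⟨_, h1⟩ | ⟨h1, _⟩
      · exact h1
      · exact absurd (G.trans h (G.symm (hGσ h1))) hn
      · exact absurd (hGσ h1) hn
    · rw [side_some hc, h]
      constructor
      · rintro ⟨_, c', hc', hGc'⟩
        refine G.trans hGc' (hGσ (hcut _ _ ((hB.same _ _).2 (hc'.trans hc.symm)) ?_))
        rw [hc']; simp
      · intro hGc
        exact ⟨hB.out c i hc, c, hc, hGc⟩
  · intro h i
    constructor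
    · intro hi
      obtain ⟨c, hc⟩ := hfib i (hJ hi)
      exact ⟨hJ hi, c, hc, (h c).1 ((side_some hc).2 hi)⟩
    · rintro ⟨_, c, hc, hGc⟩
      exact (side_some hc).1 ((h c).2 hGc)

theorem cut_val_of_side [DecidableEq D] [DecidableEq ι] (hB : Base σ X v I dg)
    (hN : RegSet X (v ⁻¹' {none}) d) {x : D} (hx : v x = none) {a : ℕ} (ha : a + 2 ≤ d)
    {J : Finset ι} (hJ : J ⊆ I) {n : ℕ} (h : ProdVal J dg (I \ J) (d - 2 - a) a n) :
    {q ∈ maps σ X | q.1 x = (σ ^ (a + 1)) x ∧ ∀ c, side (σ * swap x ((σ ^ (a + 1)) x)) v x J c ↔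
      (orb (σ * swap x ((σ ^ (a + 1)) x)) ⊔ orb (q.1 * swap x ((σ ^ (a + 1)) x)) ⊔ q.2) x c}.ncard
      = n := by
  have hcx : (v ⁻¹' {v x}).ncard = d := by rw [hx, hN.1]; omega
  have hinj : ∀ i j, i < d → j < d → ((σ ^ i) x = (σ ^ j) x ↔ i = j) :=
    fun i j hi hj => pow_inj hB.same hcx hi hj
  have hadd : ∀ i, (σ ^ i) ((σ ^ (a + 1)) x) = (σ ^ (i + (a + 1))) x := fun i => by
    rw [pow_add σ i (a + 1)]; rfl
  have hvy : v ((σ ^ (a + 1)) x) = none := (label_pow hB.same x _).trans hx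
  have hmx : (σ ^ (d - 1 - a)) ((σ ^ (a + 1)) x) = x := by
    rw [hadd, show d - 1 - a + (a + 1) = d by omega]
    exact pow_period hB.same hcx
  have hmin : ∀ i, 0 < i → i < d - 1 - a → (σ ^ i) ((σ ^ (a + 1)) x) ≠ x := fun i h0 hi => by
    rw [hadd]
    exact (hinj (i + (a + 1)) 0 (by omega) (by omega)).not.2 (by omega)
  have hxy : x ≠ (σ ^ (a + 1)) x := (hinj 0 (a + 1) (by omega) (by omega)).not.2 (by omega)
  generalize hy : (σ ^ (a + 1)) x = y at hvy hmx hmin hxy hadd ⊢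
  have hxX : x ∉ X := fun h => by have := (hN.2 x hx).1 h; omega
  have hyX : y ∉ X := fun h => by have := (hN.2 y hvy).1 h; omega
  have hs : σ.SameCycle x y := (hB.same x y).2 (hx.trans hvy.symm)
  have hpx : side (σ * swap x y) v x J x := (side_none hx).2 (Perm.SameCycle.refl _ _)
  have hpy : ¬ side (σ * swap x y) v x J y := fun h =>
    cut_not_sameCycle hxy hs ((side_none hvy).1 h)
  have hinv := side_invariant hB (hx.trans hvy.symm) J
  rw [cnt_cut hxX hyX hxy hs hpx hpy hinv]
  -- The side of `x` consists of the corners `(σ ^ i) y` with `0 < i ≤ d - 1 - a`, the last of which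
  -- is `x`: one mark and `d - 2 - a` half-edges. The other `a + 1` corners contain the mark `y`.
  have hside : {c | (σ * swap x y).SameCycle x c}.ncard = d - 1 - a := by
    have : {c | (σ * swap x y).SameCycle x c}
        = (fun i => (σ ^ i) y) '' (Finset.Ioc 0 (d - 1 - a) : Finset ℕ) := by
      ext c
      simp only [Set.mem_ofPred_eq, Set.mem_image, Finset.coe_Ioc, Set.mem_Ioc]
      rw [cut_sameCycle_iff (m := d - 1 - a) (by omega) hmx hmin]
      simp only [and_assoc]
    rw [this, Set.InjOn.ncard_image, Set.ncard_coe_finset]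
    · simp
    · intro i hi j hj hij
      simp only [Finset.coe_Ioc, Set.mem_Ioc] at hi hj
      have hb : ∀ k, k ≤ d - 1 - a → (σ ^ k) y = (σ ^ (k + (a + 1))) x := fun k _ => hadd k
      simp only [hadd] at hij
      -- At the endpoint of the range the exponent is the full period `d`, which has to be reduced
      -- to `0` before injectivity of the powers below `d` can be used.
      by_cases e1 : i + (a + 1) = d
      · by_cases e2 : j + (a + 1) = d
        · omega
        · rw [e1, show (σ ^ d) x = (σ ^ 0) x from pow_period hB.same hcx,
            hinj 0 _ (by omega) (by omega)] at hij
          omega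
      · by_cases e2 : j + (a + 1) = d
        · rw [e2, show (σ ^ d) x = (σ ^ 0) x from pow_period hB.same hcx,
            hinj _ 0 (by omega) (by omega)] at hij
          omega
        · rw [hinj _ _ (by omega) (by omega)] at hij
          omega
  have hsub : {c | (σ * swap x y).SameCycle x c} ⊆ v ⁻¹' {none} := by
    intro c hc
    have h2 : orb (σ * swap x y) ≤ Setoid.ker v :=
      orb_le.2 fun c => (label_cut hB (hx.trans hvy.symm) c).symm
    have h3 : v x = v c := h2 hc
    rw [Set.mem_preimage, ← h3, hx]; rfl
  have hmark : ∀ c, v c ≠ none → (c ∈ X ∪ {x, y} ↔ c ∈ X) := fun c hc => by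
    have h1 : c ≠ x := by rintro rfl; exact hc hx
    have h2 : c ≠ y := by rintro rfl; exact hc hvy
    simp [h1, h2]
  have hb1 := hB.sub (q := side (σ * swap x y) v x J) (fun a b =>
      (cut_sub_sameCycle hs hinv (fun h => hpy h.2) a b).trans (hB.same _ _)) hJ
      (fun c hc i hi => (side_some hi).1 hc) (fun i hi c hc => (side_some hc).2 hi)
      (X₁ := Subtype.val ⁻¹' (X ∪ {x, y})) (fun c hc => hmark c hc)
  have hb2 := hB.sub (q := fun c => ¬ side (σ * swap x y) v x J c) (fun a b =>
      (cut_sub_sameCycle hs (fun c => not_congr (hinv c)) (fun h : _ ∧ _ => (h.1 : ¬ _) hpx) a b).trans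
        (hB.same _ _)) Finset.sdiff_subset
      (fun c hc i hi => Finset.mem_sdiff.2 ⟨hB.out c i hi, fun h => hc ((side_some hi).2 h)⟩)
      (fun i hi c hc h => (Finset.mem_sdiff.1 hi).2 ((side_some hc).1 h))
      (X₁ := Subtype.val ⁻¹' (X ∪ {x, y})) (fun c hc => hmark c hc)
  refine h _ _ _ _ _ _ _ _ hb1 ⟨?_, ⟨x, hpx⟩, hx, by simp, ?_⟩
    hb2 ⟨?_, ⟨y, hpy⟩, hvy, by simp, ?_⟩
  · change (Subtype.val ⁻¹' (v ⁻¹' {none}) : Set {c // side (σ * swap x y) v x J c}).ncard = _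
    rw [ncard_preimage_val]
    have : v ⁻¹' {none} ∩ {c | side (σ * swap x y) v x J c}
        = {c | (σ * swap x y).SameCycle x c} := by
      ext c
      constructor
      · rintro ⟨h1, h2⟩
        exact (side_none h1).1 h2
      · intro h
        exact ⟨hsub h, (side_none (hsub h)).2 h⟩
    rw [this, hside]
    omega
  · rintro ⟨c, hc⟩ hcn (hcX | hcX | hcX)
    · exact absurd ((hN.2 c hcn).1 hcX) (by omega)
    · exact Subtype.ext hcX
    · exact absurd (show c = y from hcX ▸ rfl) (fun e => hpy (e ▸ hc))
  · change (Subtype.val ⁻¹' (v ⁻¹' {none}) : Set {c // ¬ side (σ * swap x y) v x J c}).ncard = _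
    rw [ncard_preimage_val]
    have : v ⁻¹' {none} ∩ {c | ¬ side (σ * swap x y) v x J c}
        = v ⁻¹' {none} \ {c | (σ * swap x y).SameCycle x c} := by
      ext c
      constructor
      · rintro ⟨h1, h2⟩
        exact ⟨h1, fun h => h2 ((side_none h1).2 h)⟩
      · rintro ⟨h1, h2⟩
        exact ⟨h1, fun h => h2 ((side_none h1).1 h)⟩
    rw [this, Set.ncard_sdiff hsub, hside, hN.1]
    omega
  · rintro ⟨c, hc⟩ hcn (hcX | hcX | hcX)
    · exact absurd ((hN.2 c hcn).1 hcX) (by omega)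
    · exact absurd hpx (fun h => hc ((show c = x from hcX) ▸ h))
    · exact Subtype.ext hcX

theorem cut_val [DecidableEq D] [DecidableEq ι] (hB : Base σ X v I dg)
    (hN : RegSet X (v ⁻¹' {none}) d) {x : D} (hx : v x = none) {a : ℕ} (ha : a + 2 ≤ d)
    {F : Finset ι → ℕ → ℕ}
    (hF : ∀ J ⊆ I, ∀ a, a + 2 ≤ d → ProdVal J dg (I \ J) (d - 2 - a) a (F J a)) :
    {q ∈ maps σ X | q.1 x = (σ ^ (a + 1)) x}.ncard
      = ∑ J ∈ I.powerset, F J a := by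
  classical
  have hcx : (v ⁻¹' {v x}).ncard = d := by rw [hx, hN.1]; omega
  have hxy : x ≠ (σ ^ (a + 1)) x :=
    (pow_inj hB.same hcx (i := 0) (j := a + 1) (by omega) (by omega)).not.2 (by omega)
  have hvy : v ((σ ^ (a + 1)) x) = none := (label_pow hB.same x _).trans hx
  have key := fun (J : Finset ι) (hJ : J ⊆ I) => cut_val_of_side hB hN hx ha hJ
    (hF J hJ a ha)
  generalize (σ ^ (a + 1)) x = y at hxy hvy key ⊢
  -- The maps with this loop are sorted by the set of vertices that lie on the side of `x`.
  let f : Perm D × Setoid D → Finset ι := fun q => I.filter fun i => ∃ c, v c = some i ∧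
    (orb (σ * swap x y) ⊔ orb (q.1 * swap x y) ⊔ q.2) x c
  have hf : ∀ q i, i ∈ f q ↔ i ∈ I ∧ ∃ c, v c = some i ∧
      (orb (σ * swap x y) ⊔ orb (q.1 * swap x y) ⊔ q.2) x c := fun q i => Finset.mem_filter
  rw [ncard_eq_sum_fiber _ f I.powerset
    (fun q _ => Finset.mem_powerset.2 fun i hi => ((hf q i).1 hi).1)]
  clear_value f
  refine Finset.sum_congr rfl fun J hJ => ?_
  rw [Finset.mem_powerset] at hJ
  rw [← key J hJ]
  congr 1
  ext ⟨τ, R⟩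
  constructor
  · rintro ⟨⟨hm, hτ⟩, h⟩
    refine ⟨hm, hτ, (side_iff hB hx hvy hxy hm hτ hJ).1 fun i => ?_⟩
    rw [← h, hf]
  · rintro ⟨hm, hτ, h⟩
    refine ⟨⟨hm, hτ⟩, ?_⟩
    ext i
    rw [hf, (side_iff hB hx hvy hxy hm hτ hJ).2 h]

end

/-- The partner of a fixed half-edge `x` is one of the `dg j` half-edges at another vertex `j`, or
the half-edge `a + 1` steps further at the same vertex. In the first case the edge is contracted, in
the second the map is cut along the loop. -/
theorem plain_step {ι : Type} [DecidableEq ι] {I : Finset ι} {dg : ι → ℕ} {d : ℕ} (hd : 0 < d)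
    (F₂ : ι → ℕ) (F₁ : Finset ι → ℕ → ℕ)
    (h2 : ∀ j ∈ I, 0 < dg j → TwoVal (I.erase j) dg (d - 1) (dg j - 1) (F₂ j))
    (h1 : ∀ J ⊆ I, ∀ a, a + 2 ≤ d → ProdVal J dg (I \ J) (d - 2 - a) a (F₁ J a)) :
    PlainVal I dg d (∑ j ∈ I, dg j * F₂ j + ∑ a ∈ Finset.range (d - 1),
      ∑ J ∈ I.powerset, F₁ J a) := by
  classical
  intro D _ σ X v hB hN
  have : Fintype D := Fintype.ofFinite D
  have hne : (v ⁻¹' {none}).ncard ≠ 0 := by rw [hN.1]; omega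
  obtain ⟨x, hx⟩ := Set.nonempty_of_ncard_ne_zero hne
  replace hx : v x = none := hx
  have hcx : (v ⁻¹' {v x}).ncard = d := by rw [hx, hN.1]; omega
  rw [cnt, ncard_eq_sum_fiber (maps σ X) (fun q => q.1 x) Finset.univ (fun _ _ => Finset.mem_univ _),
    ← Finset.sum_fiberwise_of_maps_to (s := Finset.univ) (t := Finset.insertNone I) (g := v)
      (fun c _ => ?_)]
  · rw [Finset.sum_insertNone, add_comm]
    congr 1
    · refine Finset.sum_congr rfl fun j hj => ?_
      -- The only corner of a vertex of valency zero is a mark and cannot be the partner of `x`.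
      rcases Nat.eq_zero_or_pos (dg j) with h0 | h0
      · rw [h0, zero_mul]
        refine Finset.sum_eq_zero fun y hy => ?_
        rw [Set.ncard_eq_zero]
        refine Set.eq_empty_of_forall_notMem ?_
        rintro ⟨τ, R⟩ ⟨hm, hxy⟩
        replace hxy : τ x = y := hxy
        have hyv : v y = some j := (Finset.mem_filter.1 hy).2
        have hyX : y ∈ X := ((hB.reg j hj).2 y hyv).2 h0
        have h3 := (hm.fix y).2 hyX
        rw [← hxy, hm.invol] at h3
        rw [← hxy, ← h3, hx] at hyv
        cases hyv
      · rw [Finset.sum_congr rfl fun y hy => merge_val hB hN hd hx (Finset.mem_filter.1 hy).2 h0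
          (h2 j hj h0), Finset.sum_const, smul_eq_mul]
        congr 1
        have := (hB.reg j hj).1
        rw [Set.ncard_eq_toFinset_card'] at this
        rw [show dg j = max (dg j) 1 by omega, ← this]
        congr 1
        ext c
        simp
    · have himg : Finset.univ.filter (fun c => v c = none)
          = (Finset.range d).image fun i => (σ ^ i) x := by
        ext c
        simp only [Finset.mem_filter, Finset.mem_univ, true_and, Finset.mem_image,
          Finset.mem_range]
        constructor
        · intro hc
          exact exists_pow_lt hB.same hcx (hc.trans hx.symm)
        · rintro ⟨i, _, rfl⟩
          exact (label_pow hB.same x i).trans hx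
      rw [himg, Finset.sum_image (fun i hi j hj h => (pow_inj hB.same hcx
        (by simpa using hi) (by simpa using hj)).1 h)]
      obtain ⟨d', rfl⟩ : ∃ d', d = d' + 1 := ⟨d - 1, by omega⟩
      rw [Finset.sum_range_succ']
      -- The shift by `0` would make `x` its own partner, but `x` is not a mark.
      have hzero : {q ∈ maps σ X | q.1 x = (σ ^ 0) x}.ncard = 0 := by
        rw [Set.ncard_eq_zero]
        refine Set.eq_empty_of_forall_notMem ?_
        rintro ⟨τ, R⟩ ⟨hm, hxy⟩
        have h3 := (hN.2 x hx).1 ((hm.fix x).1 hxy)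
        omega
      rw [hzero, add_zero]
      refine Finset.sum_congr rfl fun a ha => ?_
      rw [Finset.mem_range] at ha
      exact cut_val hB hN hx (by omega) h1
  · rcases hc : v c with _ | i
    · simp
    · simp [hB.out c i hc]

/-! ### Sums in steps of two -/

/-- `f e + f (e - 2) + ⋯` -/
def oneSum (f : ℕ → ℕ) : ℕ → ℕ
  | 0 => f 0
  | 1 => f 1
  | e + 2 => f (e + 2) + oneSum f e

/-- `g (a + b) + g (a + b - 2) + ⋯ + g |a - b|` -/
def twoSum (g : ℕ → ℕ) : ℕ → ℕ → ℕ
  | 0, b => g b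
  | a + 1, 0 => g (a + 1)
  | a + 1, b + 1 => g (a + b + 2) + twoSum g a b

/-- `g (n - 2) + g (n - 4) + ⋯` -/
def cum (g : ℕ → ℕ) : ℕ → ℕ
  | 0 => 0
  | 1 => 0
  | n + 2 => cum g n + g n

/-- The sum from `|a - b|` to `a + b` in steps of two is a difference of two cumulated sums. It is
stated additively, and `(a - b) + (b - a)` is `|a - b|` for truncated subtraction. -/
theorem twoSum_add (g : ℕ → ℕ) (a b : ℕ) :
    twoSum g a b + cum g ((a - b) + (b - a)) = cum g (a + b + 2) := by
  induction a, b using twoSum.induct with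
  | case1 b => simp [twoSum, cum, add_comm]
  | case2 a => simp [twoSum, cum, add_comm]
  | case3 a b ih =>
    rw [twoSum, show a + 1 + (b + 1) + 2 = (a + b + 2) + 2 by ring, cum, ← ih]
    rw [show a + 1 - (b + 1) + (b + 1 - (a + 1)) = a - b + (b - a) by omega]
    ring

theorem cum_eq_sum (g : ℕ → ℕ) (n : ℕ) :
    cum g n = ∑ a ∈ Finset.range (n - 1), if Even (n + a) then g a else 0 := by
  induction n using cum.induct with
  | case1 => rfl
  | case2 => rfl
  | case3 n ih =>
    rw [cum, ih, show n + 2 - 1 = n + 1 by omega, Finset.sum_range_succ]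
    have h0 : Even (n + 2 + n) := ⟨n + 1, by ring⟩
    rw [if_pos h0]
    congr 1
    rcases n with _ | n
    · rfl
    · have h1 : ¬ Even (n + 1 + 2 + n) := by
        rw [Nat.not_even_iff_odd]; exact ⟨n + 1, by ring⟩
      rw [Finset.sum_range_succ, if_neg h1, add_zero]
      refine Finset.sum_congr rfl fun a _ => ?_
      rw [show n + 1 + 2 + a = n + 1 + a + 2 by ring]
      simp [Nat.even_add]

/-- The first factor is the count for two vertices, one of them with a mark. It is constant on a
range of fixed parity, so the convolution over the position of the loop is a cumulated sum. -/
theorem cum_conv (h : ℕ → ℕ) (c m d : ℕ) :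
    ∑ a ∈ Finset.range (d - 1), (if m ≤ d - 2 - a ∧ Even (d - 2 - a + m) then c else 0) * h a
      = c * cum h (d - m) := by
  rw [cum_eq_sum, Finset.mul_sum]
  symm
  refine Finset.sum_subset_zero_on_sdiff (Finset.range_mono (by omega)) ?_ ?_
  · intro a ha
    simp only [Finset.mem_sdiff, Finset.mem_range] at ha
    rw [if_neg (by omega), zero_mul]
  · intro a ha
    rw [Finset.mem_range] at ha
    have h1 : Even (d - m + a) ↔ Even (d - 2 - a + m) := by
      simp only [Nat.even_iff]
      omega
    by_cases h2 : Even (d - m + a)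
    · rw [if_pos h2, if_pos ⟨by omega, h1.1 h2⟩]
    · rw [if_neg h2, if_neg fun h => h2 (h1.2 h.2)]
      simp

theorem cum_conv' (h : ℕ → ℕ) (c m d : ℕ) :
    ∑ a ∈ Finset.range (d - 1), h (d - 2 - a) * (if m ≤ a ∧ Even (a + m) then c else 0)
      = c * cum h (d - m) := by
  rw [← cum_conv, ← Finset.sum_range_reflect]
  refine Finset.sum_congr rfl fun a ha => ?_
  rw [Finset.mem_range] at ha
  rw [show d - 2 - (d - 1 - 1 - a) = a by omega, show d - 1 - 1 - a = d - 2 - a by omega, mul_comm]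

theorem oneSum_single (m c e : ℕ) :
    oneSum (fun d => if d = m then c else 0) e = if m ≤ e ∧ Even (e + m) then c else 0 := by
  induction e using oneSum.induct with
  | case1 =>
    simp only [oneSum]
    refine if_congr ?_ rfl rfl
    rw [Nat.even_iff]; omega
  | case2 =>
    simp only [oneSum]
    refine if_congr ?_ rfl rfl
    rw [Nat.even_iff]; omega
  | case3 e ih =>
    rw [oneSum, ih]
    simp only [Nat.even_iff]
    split_ifs <;> first | rfl | omega

theorem cum_single (m c e : ℕ) :
    cum (fun e => if m ≤ e ∧ Even (e + m) then c else 0) e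
      = if Even (e + m) then c * ((e - m) / 2) else 0 := by
  induction e using cum.induct with
  | case1 => simp [cum]
  | case2 =>
    simp only [cum]
    split_ifs with h
    · rw [Nat.even_iff] at h
      rw [show (1 - m) / 2 = 0 by omega, mul_zero]
    · rfl
  | case3 e ih =>
    rw [cum, ih]
    simp only [Nat.even_iff]
    by_cases h1 : (e + m) % 2 = 0
    · rw [if_pos h1, if_pos (show (e + 2 + m) % 2 = 0 by omega)]
      by_cases h2 : m ≤ e
      · rw [if_pos ⟨h2, h1⟩, show (e + 2 - m) / 2 = (e - m) / 2 + 1 by omega]; ring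
      · rw [if_neg (fun h => h2 h.1), show (e + 2 - m) / 2 = (e - m) / 2 by omega]; ring
    · rw [if_neg h1, if_neg (show ¬ (e + 2 + m) % 2 = 0 by omega), if_neg (fun h => h1 h.2)]

/-- All summands have the same parity, so a parity condition can be pulled out. -/
theorem oneSum_parity (f : ℕ → ℕ) (s c e : ℕ) :
    oneSum (fun d => if Even (d + s) then f d * c else 0) e
      = if Even (e + s) then oneSum f e * c else 0 := by
  induction e using oneSum.induct with
  | case1 => rfl
  | case2 => rfl
  | case3 e ih =>
    have h : Even (e + 2 + s) ↔ Even (e + s) := by simp only [Nat.even_iff]; omega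
    rw [oneSum, ih]
    simp only [h]
    split_ifs
    · rw [oneSum]; ring
    · rfl

theorem cum_parity (f : ℕ → ℕ) (s c e : ℕ) :
    cum (fun d => if Even (d + s) then f d * c else 0) e
      = if Even (e + s) then cum f e * c else 0 := by
  induction e using cum.induct with
  | case1 => simp [cum]
  | case2 => simp [cum]
  | case3 e ih =>
    have h : Even (e + 2 + s) ↔ Even (e + s) := by simp only [Nat.even_iff]; omega
    rw [cum, ih]
    simp only [h]
    split_ifs
    · rw [cum]; ring
    · rfl

theorem oneSum_max (e : ℕ) :
    (oneSum (fun d => max d 1) e : ℚ) = if Even e then ((e : ℚ) ^ 2 + 2 * e + 4) / 4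
      else ((e : ℚ) + 1) ^ 2 / 4 := by
  induction e using oneSum.induct with
  | case1 => simp [oneSum]
  | case2 => norm_num [oneSum]
  | case3 e ih =>
    have h : Even (e + 2) ↔ Even e := by simp only [Nat.even_iff]; omega
    rw [oneSum, Nat.cast_add, ih]
    simp only [Nat.succ_eq_add_one, add_assoc, one_add_one_eq_two, h]
    rw [max_eq_left (by omega)]
    split_ifs <;> (push_cast; ring)

/-- Both cubics are odd in `e`; this is used to combine the sums in `four_vertex_term`. -/
theorem cum_oneSum_max (e : ℕ) :
    (cum (oneSum fun d => max d 1) e : ℚ) = if Even e then ((e : ℚ) ^ 3 + 8 * e) / 24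
      else ((e : ℚ) ^ 3 - e) / 24 := by
  induction e using cum.induct with
  | case1 => simp [cum]
  | case2 => norm_num [cum]
  | case3 e ih =>
    have h : Even (e + 2) ↔ Even e := by simp only [Nat.even_iff]; omega
    rw [cum, Nat.cast_add, ih, oneSum_max]
    simp only [Nat.succ_eq_add_one, add_assoc, one_add_one_eq_two, h]
    split_ifs <;> (push_cast; ring)

/-! ### Values derived from the recursions -/

section
variable {ι : Type} {I : Finset ι} {dg : ι → ℕ}

theorem oneVal_oneSum {f : ℕ → ℕ} {e : ℕ} (h : ∀ d ≤ e, PlainVal I dg d (f d)) :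
    OneVal I dg e (oneSum f e) := by
  induction e using oneSum.induct with
  | case1 => exact one_zero (h 0 le_rfl)
  | case2 => exact one_one (h 1 le_rfl)
  | case3 e ih => exact one_step (h _ le_rfl) (ih fun d hd => h d (by omega))

theorem twoVal_twoSum (hI : I.Nonempty) {g : ℕ → ℕ} {a b : ℕ}
    (h : ∀ e, OneVal I dg e (g e)) : TwoVal I dg a b (twoSum g a b) := by
  induction a, b using twoSum.induct with
  | case1 b => exact two_zero_left (Or.inl hI) (h b)
  | case2 a => exact two_zero_right (Or.inl hI) (h _)
  | case3 a b ih => exact two_step (h _) ih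

theorem prodVal_of_left {J : Finset ι} {e f : ℕ} (h : OneVal I dg e 0) :
    ProdVal I dg J e f 0 := by
  intro D D' _ _ σ X v σ' X' v' h1 h2 _ _
  rw [h D σ X v h1 h2, zero_mul]

theorem prodVal_of_right {J : Finset ι} {e f : ℕ} (h : OneVal J dg f 0) :
    ProdVal I dg J e f 0 := by
  intro D D' _ _ σ X v σ' X' v' _ _ h1 h2
  rw [h D' σ' X' v' h1 h2, mul_zero]

theorem prodVal_mul {J : Finset ι} {e f n n' : ℕ} (h : OneVal I dg e n) (h' : OneVal J dg f n') :
    ProdVal I dg J e f (n * n') := by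
  intro D D' _ _ σ X v σ' X' v' h1 h2 h3 h4
  rw [h D σ X v h1 h2, h' D' σ' X' v' h3 h4]

theorem plain_all_zero (hI : I.Nonempty) (h : ∀ i ∈ I, dg i = 0) : PlainVal I dg 0 1 := by
  intro D _ σ X v hB hN
  have h1 : ∃ c, v c = none :=
    Set.nonempty_of_ncard_ne_zero (s := v ⁻¹' {none}) (by rw [hN.1]; omega)
  obtain ⟨i, hi⟩ := hI
  have h2 : ∃ c, v c = some i :=
    Set.nonempty_of_ncard_ne_zero (s := v ⁻¹' {some i}) (by rw [(hB.reg i hi).1]; omega)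
  obtain ⟨a, ha⟩ := h1
  obtain ⟨b, hb⟩ := h2
  have : Nontrivial D := ⟨⟨a, b, by rintro rfl; rw [ha] at hb; cases hb⟩⟩
  refine cnt_all_marks σ fun c => ?_
  rcases hc : v c with _ | j
  · exact (hN.2 c hc).2 rfl
  · exact ((hB.reg j (hB.out c j hc)).2 c hc).2 (h j (hB.out c j hc))

/-- Exchange of the special vertex with another one. -/
theorem plain_reroot [DecidableEq ι] {j : ι} (hj : j ∈ I) {d n : ℕ}
    (h : PlainVal I (Function.update dg j d) (dg j) n) : PlainVal I dg d n := by
  intro D _ σ X v hB hN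
  have key : ∀ k : Option ι, (fun c => swap none (some j) (v c)) ⁻¹' {k}
      = v ⁻¹' {swap none (some j) k} := by
    intro k
    ext c
    simp only [Set.mem_preimage, Set.mem_singleton_iff]
    rw [swap_apply_eq_iff]
  refine h D σ X (fun c => swap none (some j) (v c)) ⟨fun a b => ?_, fun i hi => ?_,
    fun c i hc => ?_⟩ ?_
  · rw [hB.same, (swap none (some j)).injective.eq_iff]
  · rw [key]
    by_cases hij : i = j
    · subst hij
      rw [swap_apply_right, Function.update_self]
      exact hN
    · rw [swap_apply_of_ne_of_ne (by simp) (by simpa using hij), Function.update_of_ne hij]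
      exact hB.reg i hi
  · by_cases hij : i = j
    · rw [hij]; exact hj
    · rw [swap_apply_eq_iff, swap_apply_of_ne_of_ne (by simp) (by simpa using hij)] at hc
      exact hB.out c i hc
  · rw [key, swap_apply_left]
    exact hB.reg j hj

end

/-! ### One vertex -/

section OneVertex
variable {ι : Type} {dg : ι → ℕ}

/-- Any loop would have one side containing no other loop, and this side would be a monogon. In the
recursion, each cut leaves a side with fewer half-edges, for which the count is already known to
vanish. -/
theorem plain_empty (d : ℕ) : PlainVal ∅ dg d 0 := by
  classical
  induction d using Nat.strong_induction_on with
  | _ d ih =>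
  rcases Nat.eq_zero_or_pos d with rfl | hd
  · intro D _ σ X v hB hN
    obtain ⟨a, ha⟩ := Set.ncard_eq_one.1 hN.1
    have hall : ∀ c, c = a := fun c => by
      rcases hc : v c with _ | i
      · have : c ∈ v ⁻¹' {none} := hc
        rw [ha] at this
        exact this
      · exact absurd (hB.out c i hc) (by simp)
    rw [cnt, Set.ncard_eq_zero]
    refine Set.eq_empty_of_forall_notMem ?_
    rintro ⟨τ, R⟩ hm
    obtain ⟨c, hc, _⟩ := hm.nosing a
    exact hc (hall c)
  · have h0 : ∀ e, oneSum (fun _ => 0) e = 0 := fun e => by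
      induction e using oneSum.induct with
      | case1 => rfl
      | case2 => rfl
      | case3 e ih => rw [oneSum, ih]
    have h1 : ∀ a, a + 2 ≤ d → OneVal ∅ dg a 0 := fun a ha => by
      rw [← h0 a]
      exact oneVal_oneSum fun e he => ih e (by omega)
    have := plain_step (I := ∅) (dg := dg) hd (fun _ => 0) (fun _ _ => 0) (by simp) fun J hJ a ha => by
      rw [Finset.subset_empty.1 hJ]
      exact prodVal_of_right (h1 a ha)
    simpa using this

theorem one_empty (e : ℕ) : OneVal ∅ dg e 0 := by
  have h0 : ∀ e, oneSum (fun _ => 0) e = 0 := fun e => by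
    induction e using oneSum.induct with
    | case1 => rfl
    | case2 => rfl
    | case3 e ih => rw [oneSum, ih]
  rw [← h0 e]
  exact oneVal_oneSum fun d _ => plain_empty d

/-- Every loop has to separate the two marks. So the loops are nested around one of them, which
determines the map and forces `a = b`. -/
theorem two_empty (a b : ℕ) : TwoVal ∅ dg a b (if a = b then 1 else 0) := by
  induction a generalizing b with
  | zero =>
    rcases b with _ | b
    · rintro D _ σ X v hB ⟨hn, z, hz, z', hz', hzX, hzX', hzz, hu, hp⟩
      have : Nontrivial D := ⟨⟨z, z', hzz⟩⟩
      refine cnt_all_marks σ fun c => ?_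
      rcases hc : v c with _ | i
      · have h2 : v ⁻¹' {none} = {z, z'} := by
          refine (Set.eq_of_subset_of_ncard_le ?_ ?_).symm
          · rintro c (rfl | rfl)
            · exact hz
            · exact hz'
          · rw [hn, Set.ncard_pair hzz]
        have h3 : c ∈ v ⁻¹' {none} := hc
        rw [h2] at h3
        rcases h3 with rfl | rfl
        · exact hzX
        · exact hzX'
      · exact absurd (hB.out c i hc) (by simp)
    · exact two_zero_left (Or.inr (by omega)) (one_empty _)
  | succ a ih =>
    rcases b with _ | b
    · exact two_zero_right (Or.inr (by omega)) (one_empty _)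
    · have := two_step (one_empty (dg := dg) (a + b + 2)) (ih b)
      simpa using this

end OneVertex

/-! ### Two vertices -/

section TwoVertices
variable {ι : Type} [DecidableEq ι]

/-- A loop would have a side without another vertex, so all edges are parallel. The partner of one
half-edge can be chosen in `dg k` ways and determines the rest. -/
theorem plain_single_pos (k : ι) (dg : ι → ℕ) {d : ℕ} (hd : 0 < d) :
    PlainVal {k} dg d (if d = dg k then max d 1 else 0) := by
  have := plain_step (I := {k}) (dg := dg) hd (fun _ => if d - 1 = dg k - 1 then 1 else 0)
    (fun _ _ => 0) (fun j hj _ => by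
      rw [Finset.mem_singleton.1 hj, Finset.erase_singleton]
      exact two_empty _ _) fun J hJ a ha => by
      rcases Finset.subset_singleton_iff.1 hJ with rfl | rfl
      · exact prodVal_of_left (one_empty _)
      · rw [sdiff_self]
        exact prodVal_of_right (one_empty _)
  convert this using 1
  simp only [Finset.sum_singleton, Finset.sum_const_zero, add_zero, mul_ite, mul_one, mul_zero]
  split_ifs <;> omega

theorem plain_single (k : ι) (dg : ι → ℕ) (d : ℕ) :
    PlainVal {k} dg d (if d = dg k then max d 1 else 0) := by
  rcases Nat.eq_zero_or_pos d with rfl | hd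
  · rcases Nat.eq_zero_or_pos (dg k) with h | h
    · rw [if_pos h.symm]
      exact plain_all_zero (Finset.singleton_nonempty k) (by simpa using h)
    · rw [if_neg (by omega)]
      refine plain_reroot (Finset.mem_singleton_self k) ?_
      have := plain_single_pos k (Function.update dg k 0) h
      rwa [Function.update_self, if_neg (by omega)] at this
  · exact plain_single_pos k dg hd

theorem one_single (k : ι) (dg : ι → ℕ) (e : ℕ) :
    OneVal {k} dg e (if dg k ≤ e ∧ Even (e + dg k) then max (dg k) 1 else 0) := by
  have := oneVal_oneSum (e := e) fun d _ => plain_single k dg d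
  convert this using 1
  rw [← oneSum_single]
  congr 1
  ext d
  split_ifs with h
  · rw [h]
  · rfl

end TwoVertices

theorem cum_diff (g : ℕ → ℕ) {d m : ℕ} (hd : 0 < d) (hm : 0 < m) :
    twoSum g (d - 1) (m - 1) + cum g ((d - m) + (m - d)) = cum g (d + m) := by
  have := twoSum_add g (d - 1) (m - 1)
  rwa [show d - 1 + (m - 1) + 2 = d + m by omega,
    show d - 1 - (m - 1) + (m - 1 - (d - 1)) = (d - m) + (m - d) by omega] at this

/-! ### Three vertices -/

section ThreeVertices
variable {ι : Type} [DecidableEq ι]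

/-- All subtractions are truncated, so the terms are positive parts. The cases are those where one
valency is at least the sum of the other two, and the triangle case, in which only two terms on the
left survive. -/
theorem abs_sum_identity {d m n : ℕ} (h : (d + m + n) % 2 = 0) :
    (d + m - n) / 2 + (d + n - m) / 2 + (d - m - n) / 2 + (d - n - m) / 2
      = d + (d - m + (m - d) - n) / 2 + (d - n + (n - d) - m) / 2 := by
  rcases le_total (m + n) d with h1 | h1
  · obtain ⟨t, rfl⟩ : ∃ t, d = m + n + 2 * t := ⟨(d - (m + n)) / 2, by omega⟩
    rw [show m + n + 2 * t + m - n = 2 * (m + t) by omega,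
      show m + n + 2 * t + n - m = 2 * (n + t) by omega,
      show m + n + 2 * t - m - n = 2 * t by omega, show m + n + 2 * t - n - m = 2 * t by omega,
      show m + n + 2 * t - m + (m - (m + n + 2 * t)) - n = 2 * t by omega,
      show m + n + 2 * t - n + (n - (m + n + 2 * t)) - m = 2 * t by omega]
    omega
  rw [show d - m - n = 0 by omega, show d - n - m = 0 by omega]
  rcases le_total (d + n) m with h2 | h2
  · obtain ⟨t, rfl⟩ : ∃ t, m = d + n + 2 * t := ⟨(m - (d + n)) / 2, by omega⟩
    rw [show d + (d + n + 2 * t) - n = 2 * (d + t) by omega,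
      show d + n - (d + n + 2 * t) = 0 by omega,
      show d - (d + n + 2 * t) + (d + n + 2 * t - d) - n = 2 * t by omega,
      show d - n + (n - d) - (d + n + 2 * t) = 0 by omega]
    omega
  rcases le_total (d + m) n with h3 | h3
  · obtain ⟨t, rfl⟩ : ∃ t, n = d + m + 2 * t := ⟨(n - (d + m)) / 2, by omega⟩
    rw [show d + (d + m + 2 * t) - m = 2 * (d + t) by omega,
      show d + m - (d + m + 2 * t) = 0 by omega,
      show d - (d + m + 2 * t) + (d + m + 2 * t - d) - m = 2 * t by omega,
      show d - m + (m - d) - (d + m + 2 * t) = 0 by omega]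
    omega
  rw [show d - m + (m - d) - n = 0 by omega, show d - n + (n - d) - m = 0 by omega]
  omega

/-- The first two terms come from contractions with the vertices `m` and `n`, the last two from
loops that separate these vertices. Each is a constant times a positive part, and `abs_sum_identity`
adds them up. -/
theorem three_vertex_sum {d : ℕ} (hd : 0 < d) (m n : ℕ) :
    m * twoSum (fun e => if n ≤ e ∧ Even (e + n) then max n 1 else 0) (d - 1) (m - 1)
      + n * twoSum (fun e => if m ≤ e ∧ Even (e + m) then max m 1 else 0) (d - 1) (n - 1)
      + (max m 1 * cum (fun e => if n ≤ e ∧ Even (e + n) then max n 1 else 0) (d - m)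
      + max n 1 * cum (fun e => if m ≤ e ∧ Even (e + m) then max m 1 else 0) (d - n))
      = if Even (d + m + n) then max d 1 * max m 1 * max n 1 else 0 := by
  have h1 : ∀ m n : ℕ, 0 < m →
      (max m 1 * twoSum (fun e => if n ≤ e ∧ Even (e + n) then max n 1 else 0) (d - 1) (m - 1)
        + if Even (d + m + n) then max m 1 * max n 1 * (((d - m) + (m - d) - n) / 2) else 0)
        = if Even (d + m + n) then max m 1 * max n 1 * ((d + m - n) / 2) else 0 := by
    intro m n hm
    have := cum_diff (fun e => if n ≤ e ∧ Even (e + n) then max n 1 else 0) hd hm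
    rw [cum_single, cum_single] at this
    have e1 : Even ((d - m) + (m - d) + n) ↔ Even (d + m + n) := by
      simp only [Nat.even_iff]; omega
    simp only [e1] at this
    split_ifs at this ⊢
    · rw [mul_assoc, mul_assoc, ← mul_add, this]
    · rw [add_zero] at this ⊢
      rw [this, mul_zero]
  have h2 : ∀ m n : ℕ, max m 1 * cum (fun e => if n ≤ e ∧ Even (e + n) then max n 1 else 0) (d - m)
      = if Even (d + m + n) then max m 1 * max n 1 * ((d - m - n) / 2) else 0 := by
    intro m n
    rw [cum_single]
    by_cases h : m ≤ d
    · have e1 : Even ((d - m) + n) ↔ Even (d + m + n) := by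
        simp only [Nat.even_iff]; omega
      simp only [e1]
      split_ifs
      · ring
      · rw [mul_zero]
    · rw [show (d - m - n) / 2 = 0 by omega]
      simp
  have hc : ∀ m n : ℕ, d + n + m = d + m + n := fun m n => by ring
  rw [h2, h2, hc m n]
  rcases Nat.eq_zero_or_pos m with rfl | hm
  · rcases Nat.eq_zero_or_pos n with rfl | hn
    · rw [show max 0 1 = 1 from rfl, show max d 1 = d by omega]
      simp only [zero_mul, zero_add, add_zero, Nat.sub_zero, Nat.even_iff, one_mul, mul_one]
      split_ifs <;> omega
    · have b := h1 n 0 hn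
      rw [hc] at b
      rw [zero_mul, zero_add]
      by_cases h : Even (d + 0 + n)
      · simp only [if_pos h] at b ⊢
        rw [Nat.even_iff] at h
        rw [show max n 1 = n by omega] at b ⊢
        rw [show max d 1 = d by omega]
        rw [show max 0 1 = 1 from rfl] at *
        simp only [mul_one, one_mul, Nat.sub_zero] at b ⊢
        apply Nat.add_right_cancel (m := n * ((d - n + (n - d)) / 2))
        rw [mul_comm d n]
        calc _ = n * ((d + n) / 2) + (n * ((d - n) / 2) + n * ((d - n) / 2)) := by
              rw [← b]; ring
          _ = n * ((d + n) / 2 + (d - n) / 2 + (d - n) / 2) := by ring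
          _ = n * (d + (d - n + (n - d)) / 2) := by congr 1; omega
          _ = _ := by ring
      · simp only [if_neg h] at b ⊢
        rw [add_zero] at b
        rw [show max n 1 = n by omega] at b
        simpa using b
  · rcases Nat.eq_zero_or_pos n with rfl | hn
    · have a := h1 m 0 hm
      rw [zero_mul, add_zero]
      by_cases h : Even (d + m + 0)
      · simp only [if_pos h] at a ⊢
        rw [Nat.even_iff] at h
        rw [show max m 1 = m by omega] at a ⊢
        rw [show max d 1 = d by omega]
        rw [show max 0 1 = 1 from rfl] at *
        simp only [mul_one, one_mul, Nat.sub_zero] at a ⊢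
        apply Nat.add_right_cancel (m := m * ((d - m + (m - d)) / 2))
        rw [mul_comm d m]
        calc _ = m * ((d + m) / 2) + (m * ((d - m) / 2) + m * ((d - m) / 2)) := by
              rw [← a]; ring
          _ = m * ((d + m) / 2 + (d - m) / 2 + (d - m) / 2) := by ring
          _ = m * (d + (d - m + (m - d)) / 2) := by congr 1; omega
          _ = _ := by ring
      · simp only [if_neg h] at a ⊢
        rw [add_zero] at a
        rw [show max m 1 = m by omega] at a
        simpa using a
    · have a := h1 m n hm
      have b := h1 n m hn
      rw [hc m n] at b
      by_cases h : Even (d + m + n)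
      · simp only [if_pos h] at a b ⊢
        rw [Nat.even_iff] at h
        rw [show max m 1 = m by omega, show max n 1 = n by omega] at *
        rw [show max d 1 = d by omega]
        -- The cumulated sums at the absolute differences are added on both sides, so that the
        -- contraction terms can be replaced without subtraction.
        apply Nat.add_right_cancel
          (m := m * n * ((d - m + (m - d) - n) / 2) + n * m * ((d - n + (n - d) - m) / 2))
        calc _ = m * n * ((d + m - n) / 2) + n * m * ((d + n - m) / 2)
                + (m * n * ((d - m - n) / 2) + n * m * ((d - n - m) / 2)) := by
              rw [← a, ← b]; ring
          _ = m * n * ((d + m - n) / 2 + (d + n - m) / 2 + (d - m - n) / 2 + (d - n - m) / 2) := by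
              ring
          _ = m * n * (d + (d - m + (m - d) - n) / 2 + (d - n + (n - d) - m) / 2) := by
              congr 1; exact abs_sum_identity h
          _ = _ := by ring
      · simp only [if_neg h] at a b ⊢
        rw [add_zero] at a b
        rw [show max m 1 = m by omega] at a
        rw [show max n 1 = n by omega] at b
        simp [a, b]

theorem sum_powerset_pair {k l : ι} (hkl : k ≠ l) (f : Finset ι → ℕ) (h0 : f ∅ = 0)
    (h1 : f {k, l} = 0) : ∑ J ∈ ({k, l} : Finset ι).powerset, f J = f {k} + f {l} := by
  rw [Finset.sum_powerset_insert (by simpa using hkl)]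
  rw [show ({l} : Finset ι) = insert l ∅ by simp, Finset.sum_powerset_insert (by simp),
    Finset.sum_powerset_insert (by simp)]
  simp [h0, h1, add_comm]

theorem plain_pair_pos {k l : ι} (hkl : k ≠ l) (dg : ι → ℕ) {d : ℕ} (hd : 0 < d) :
    PlainVal {k, l} dg d (if Even (d + dg k + dg l) then
      max d 1 * max (dg k) 1 * max (dg l) 1 else 0) := by
  have ek : ({k, l} : Finset ι).erase k = {l} := by
    ext i; simp only [Finset.mem_erase, Finset.mem_insert, Finset.mem_singleton]; grind
  have el : ({k, l} : Finset ι).erase l = {k} := by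
    ext i; simp only [Finset.mem_erase, Finset.mem_insert, Finset.mem_singleton]; grind
  have sk : ({k, l} : Finset ι) \ {k} = {l} := by rw [← Finset.erase_eq, ek]
  have sl : ({k, l} : Finset ι) \ {l} = {k} := by rw [← Finset.erase_eq, el]
  have nkl : ({l} : Finset ι) ≠ {k} := by simpa using hkl.symm
  have np : ∀ i, ({k, l} : Finset ι) ≠ {i} := fun i h => by
    have h1 := h ▸ Finset.mem_insert_self k {l}
    have h2 : l ∈ ({i} : Finset ι) := h ▸ Finset.mem_insert_of_mem (Finset.mem_singleton_self l)
    rw [Finset.mem_singleton] at h1 h2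
    exact hkl (h1.trans h2.symm)
  -- `g i` is the count with one mark when `i` is the only other vertex. A loop must have one of the
  -- two other vertices on each side; otherwise one factor vanishes.
  let g : ι → ℕ → ℕ := fun i e => if dg i ≤ e ∧ Even (e + dg i) then max (dg i) 1 else 0
  have := plain_step (I := {k, l}) (dg := dg) hd
    (fun i => if i = k then twoSum (g l) (d - 1) (dg k - 1) else twoSum (g k) (d - 1) (dg l - 1))
    (fun J a => if J = {k} then g k (d - 2 - a) * g l a
      else if J = {l} then g l (d - 2 - a) * g k a else 0)
    (fun i hi _ => by
      simp only [Finset.mem_insert, Finset.mem_singleton] at hi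
      rcases hi with rfl | rfl
      · rw [if_pos rfl, ek]
        exact twoVal_twoSum (Finset.singleton_nonempty _) (one_single l dg)
      · rw [if_neg hkl.symm, el]
        exact twoVal_twoSum (Finset.singleton_nonempty _) (one_single k dg))
    (fun J hJ a ha => by
      have : J = ∅ ∨ J = {k} ∨ J = {l} ∨ J = {k, l} := by
        by_cases hk : k ∈ J <;> by_cases hl : l ∈ J
        · exact Or.inr (Or.inr (Or.inr (hJ.antisymm (by simp [Finset.insert_subset_iff, hk, hl]))))
        · exact Or.inr (Or.inl (by ext i; have := @hJ i; simp at this ⊢; grind))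
        · exact Or.inr (Or.inr (Or.inl (by ext i; have := @hJ i; simp at this ⊢; grind)))
        · exact Or.inl (by ext i; have := @hJ i; simp at this ⊢; grind)
      rcases this with rfl | rfl | rfl | rfl
      · rw [if_neg (Finset.singleton_ne_empty _).symm, if_neg (Finset.singleton_ne_empty _).symm]
        exact prodVal_of_left (one_empty _)
      · rw [if_pos rfl, sk]
        exact prodVal_mul (one_single k dg _) (one_single l dg _)
      · rw [if_neg nkl, if_pos rfl, sl]
        exact prodVal_mul (one_single l dg _) (one_single k dg _)
      · rw [if_neg (np k), if_neg (np l), sdiff_self]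
        exact prodVal_of_right (one_empty _))
  convert this using 1
  rw [Finset.sum_congr rfl fun a _ => sum_powerset_pair hkl _
      (by rw [if_neg (Finset.singleton_ne_empty _).symm, if_neg (Finset.singleton_ne_empty _).symm])
      (by rw [if_neg (np k), if_neg (np l)]),
    Finset.sum_add_distrib, Finset.sum_pair hkl]
  simp only [if_pos, if_neg hkl.symm, if_neg nkl]
  rw [cum_conv (g l), cum_conv (g k), ← three_vertex_sum hd]

theorem plain_pair {k l : ι} (hkl : k ≠ l) (dg : ι → ℕ) (d : ℕ) :
    PlainVal {k, l} dg d (if Even (d + dg k + dg l) then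
      max d 1 * max (dg k) 1 * max (dg l) 1 else 0) := by
  rcases Nat.eq_zero_or_pos d with rfl | hd
  · by_cases hk : dg k = 0
    · by_cases hl : dg l = 0
      · rw [hk, hl]
        refine plain_all_zero (Finset.insert_nonempty _ _) fun i hi => ?_
        simp only [Finset.mem_insert, Finset.mem_singleton] at hi
        rcases hi with rfl | rfl <;> assumption
      · refine plain_reroot (j := l) (by simp) ?_
        convert plain_pair_pos hkl (Function.update dg l 0) (Nat.pos_of_ne_zero hl) using 1
        rw [Function.update_self, Function.update_of_ne hkl]
        refine if_congr ?_ ?_ rfl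
        · simp only [Nat.even_iff]; omega
        · ring
    · refine plain_reroot (j := k) (by simp) ?_
      convert plain_pair_pos hkl (Function.update dg k 0) (Nat.pos_of_ne_zero hk) using 1
      rw [Function.update_self, Function.update_of_ne hkl.symm]
      refine if_congr ?_ ?_ rfl
      · simp only [Nat.even_iff]; omega
      · ring
  · exact plain_pair_pos hkl dg hd

theorem one_pair {k l : ι} (hkl : k ≠ l) (dg : ι → ℕ) (e : ℕ) :
    OneVal {k, l} dg e (if Even (e + (dg k + dg l)) then
      oneSum (fun d => max d 1) e * (max (dg k) 1 * max (dg l) 1) else 0) := by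
  rw [← oneSum_parity]
  refine oneVal_oneSum fun d _ => ?_
  convert plain_pair hkl dg d using 1
  rw [add_assoc, mul_assoc]

end ThreeVertices

/-! ### Four vertices -/

section FourVertices
variable {ι : Type} [DecidableEq ι]

/-- The numbers of plane maps with four vertices and numbered half-edges, if one of the valencies
is not zero. -/
def fourVal (d m₁ m₂ m₃ : ℕ) : ℚ :=
  if Even (d + m₁ + m₂ + m₃) then
    (max d 1 * max m₁ 1 * max m₂ 1 * max m₃ 1 : ℕ) *
      (((d : ℚ) ^ 2 + m₁ ^ 2 + m₂ ^ 2 + m₃ ^ 2) / 4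
        + if Even (d + m₁) ∧ Even (d + m₂) then 2 else 1 / 2)
  else 0

/-- This is the contribution of one other vertex of valency `m`: contraction onto it, and the two
kinds of loops that isolate it from the remaining two vertices. If `P` is the cubic for the parity
of `d + m`, the sum is `P (d + m) - P |d - m|` plus twice `P (d - m)` when `m ≤ d`. As `P` is odd,
it equals `P (d + m) + P (d - m)` in all cases. -/
theorem four_vertex_term {d : ℕ} (hd : 0 < d) (m n c : ℕ) (g : ℕ → ℕ)
    (hg : ∀ e, g e = if Even (e + n) then oneSum (fun d => max d 1) e * c else 0) :
    ((m * twoSum g (d - 1) (m - 1) + 2 * (max m 1 * cum g (d - m)) : ℕ) : ℚ)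
      = if Even (d + m + n) then (max m 1 * c : ℕ) * ((d : ℚ) *
        (2 * (d : ℚ) ^ 2 + 6 * m ^ 2 + if Even (d + m) then 16 else -2) / 24) else 0 := by
  obtain rfl : g = fun e => if Even (e + n) then oneSum (fun d => max d 1) e * c else 0 :=
    funext hg
  have e1 : Even ((d - m) + (m - d) + n) ↔ Even (d + m + n) := by simp only [Nat.even_iff]; omega
  have key : (m * twoSum (fun e => if Even (e + n) then oneSum (fun d => max d 1) e * c else 0)
        (d - 1) (m - 1) : ℚ)
      = if Even (d + m + n) then (m * c : ℚ) * (cum (oneSum fun d => max d 1) (d + m)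
        - cum (oneSum fun d => max d 1) ((d - m) + (m - d))) else 0 := by
    rcases Nat.eq_zero_or_pos m with rfl | hm
    · simp
    have := cum_diff (fun e => if Even (e + n) then oneSum (fun d => max d 1) e * c else 0) hd hm
    rw [cum_parity, cum_parity] at this
    simp only [e1] at this
    split_ifs at this ⊢
    · have h := congrArg (fun t : ℕ => (t : ℚ)) this
      push_cast at h
      linear_combination (m : ℚ) * h
    · rw [add_zero] at this
      rw [this]; simp
  rw [Nat.cast_add, Nat.cast_mul, key, cum_parity]
  rcases le_total m d with h | h
  · have e2 : Even (d - m + n) ↔ Even (d + m + n) := by simp only [Nat.even_iff]; omega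
    have e3 : Even (d - m + (m - d)) ↔ Even (d + m) := by simp only [Nat.even_iff]; omega
    have e4 : Even (d - m) ↔ Even (d + m) := by simp only [Nat.even_iff]; omega
    simp only [e2]
    split_ifs with h1 h2
    · push_cast
      simp only [cum_oneSum_max, if_pos h2, if_pos (e3.2 h2), if_pos (e4.2 h2)]
      rcases Nat.eq_zero_or_pos m with rfl | hm
      · simp; ring
      rw [max_eq_left (by exact_mod_cast hm)]
      rw [show d - m + (m - d) = d - m by omega]
      push_cast [h]
      ring
    · push_cast
      simp only [cum_oneSum_max, if_neg h2, if_neg (e3.not.2 h2), if_neg (e4.not.2 h2)]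
      rcases Nat.eq_zero_or_pos m with rfl | hm
      · simp; ring
      rw [max_eq_left (by exact_mod_cast hm)]
      rw [show d - m + (m - d) = d - m by omega]
      push_cast [h]
      ring
    · simp
  · rw [show d - m = 0 by omega, zero_add]
    have e3 : Even (m - d) ↔ Even (d + m) := by simp only [Nat.even_iff]; omega
    have h0 : (if Even (0 + n) then cum (oneSum fun d => max d 1) 0 * c else 0) = 0 := by
      simp [cum]
    rw [h0]
    split_ifs with h1 h2
    · simp only [cum_oneSum_max, if_pos h2, if_pos (e3.2 h2)]
      rw [max_eq_left (by omega)]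
      push_cast [h]
      ring
    · simp only [cum_oneSum_max, if_neg h2, if_neg (e3.not.2 h2)]
      rw [max_eq_left (by omega)]
      push_cast [h]
      ring
    · simp

theorem plain_triple_pos {j k l : ι} (hjk : j ≠ k) (hjl : j ≠ l) (hkl : k ≠ l) (dg : ι → ℕ)
    {d : ℕ} (hd : 0 < d) :
    ∃ n : ℕ, (n : ℚ) = fourVal d (dg j) (dg k) (dg l) ∧ PlainVal {j, k, l} dg d n := by
  have ej : ({j, k, l} : Finset ι).erase j = {k, l} := by
    ext i; simp only [Finset.mem_erase, Finset.mem_insert, Finset.mem_singleton]; grind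
  have ek : ({j, k, l} : Finset ι).erase k = {j, l} := by
    ext i; simp only [Finset.mem_erase, Finset.mem_insert, Finset.mem_singleton]; grind
  have el : ({j, k, l} : Finset ι).erase l = {j, k} := by
    ext i; simp only [Finset.mem_erase, Finset.mem_insert, Finset.mem_singleton]; grind
  let g : ι → ℕ → ℕ := fun i e => if dg i ≤ e ∧ Even (e + dg i) then max (dg i) 1 else 0
  let G : ι → ι → ℕ → ℕ := fun i i' e => if Even (e + (dg i + dg i')) then
    oneSum (fun d => max d 1) e * (max (dg i) 1 * max (dg i') 1) else 0
  -- `F i` is the count with one mark when the other vertices are all labels except `i`.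
  let F : ι → ℕ → ℕ := fun i => if i = j then G k l else if i = k then G j l else G j k
  have hF : ∀ i ∈ ({j, k, l} : Finset ι), ∀ e,
      OneVal (({j, k, l} : Finset ι).erase i) dg e (F i e) := by
    intro i hi e
    simp only [Finset.mem_insert, Finset.mem_singleton] at hi
    rcases hi with rfl | rfl | rfl
    · rw [ej, show F i = G k l from if_pos rfl]
      exact one_pair hkl dg e
    · rw [ek, show F i = G j l by simp only [F, if_neg hjk.symm, if_pos]]
      exact one_pair hjl dg e
    · rw [el, show F i = G j k by simp only [F, if_neg hjl.symm, if_neg hkl.symm]]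
      exact one_pair hjk dg e
  have hne : ∀ i ∈ ({j, k, l} : Finset ι), (({j, k, l} : Finset ι).erase i).Nonempty := by
    intro i hi
    simp only [Finset.mem_insert, Finset.mem_singleton] at hi
    rcases hi with rfl | rfl | rfl
    · rw [ej]; exact Finset.insert_nonempty _ _
    · rw [ek]; exact Finset.insert_nonempty _ _
    · rw [el]; exact Finset.insert_nonempty _ _
  -- A loop with other vertices on both sides isolates exactly one label `i`, either on the side of
  -- `x` or on the opposite side.
  let F₁ : Finset ι → ℕ → ℕ := fun J a => ∑ i ∈ ({j, k, l} : Finset ι),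
    ((if J = {i} then g i (d - 2 - a) * F i a else 0)
      + if J = ({j, k, l} : Finset ι).erase i then F i (d - 2 - a) * g i a else 0)
  have hstep := plain_step (I := {j, k, l}) (dg := dg) hd
    (fun i => twoSum (F i) (d - 1) (dg i - 1)) F₁
    (fun i hi _ => twoVal_twoSum (hne i hi) (hF i hi)) (fun J hJ a ha => by
      have hcard : ({j, k, l} : Finset ι).card = 3 := Finset.card_eq_three.2
        ⟨j, k, l, hjk, hjl, hkl, rfl⟩
      have hone : ∀ i e, OneVal {i} dg e (g i e) := fun i e => one_single i dg e
      change ProdVal J dg _ _ _ (∑ i ∈ ({j, k, l} : Finset ι), _)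
      generalize ({j, k, l} : Finset ι) = I at hF hcard hJ ⊢
      have hce : ∀ i ∈ I, (I.erase i).card = 2 := fun i hi => by
        rw [Finset.card_erase_of_mem hi, hcard]
      have hzero : J.card = 0 ∨ J.card = 3 → ∑ i ∈ I, ((if J = {i} then g i (d - 2 - a) * F i a
          else 0) + if J = I.erase i then F i (d - 2 - a) * g i a else 0) = 0 := fun h => by
        refine Finset.sum_eq_zero fun i hi => ?_
        rw [if_neg (by rintro rfl; simp at h), if_neg (by rintro rfl; have := hce i hi; omega),
          add_zero]
      have hle := Finset.card_le_card hJ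
      obtain h | h | h | h : J.card = 0 ∨ J.card = 1 ∨ J.card = 2 ∨ J.card = 3 := by omega
      · rw [hzero (Or.inl h), Finset.card_eq_zero.1 h]
        exact prodVal_of_left (one_empty _)
      · obtain ⟨i, rfl⟩ := Finset.card_eq_one.1 h
        have hi := Finset.singleton_subset_iff.1 hJ
        rw [Finset.sum_eq_single_of_mem i hi fun i' hi' hne => ?_, if_pos rfl, if_neg, add_zero,
          ← Finset.erase_eq]
        · exact prodVal_mul (hone i _) (hF i hi _)
        · intro he
          have := hce i hi
          rw [← he] at this; simp at this
        · rw [if_neg, if_neg, add_zero]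
          · intro he
            have := hce i' hi'
            rw [← he] at this; simp at this
          · simpa using hne.symm
      · obtain ⟨i, he⟩ := Finset.card_eq_one.1 (show (I \ J).card = 1 by
          rw [Finset.card_sdiff_of_subset hJ]; omega)
        have hi : i ∈ I := (Finset.mem_sdiff.1 (he ▸ Finset.mem_singleton_self i)).1
        have hJi : J = I.erase i := by
          rw [Finset.erase_eq, ← he, Finset.sdiff_sdiff_eq_self hJ]
        rw [he, Finset.sum_eq_single_of_mem i hi fun i' hi' hne => ?_, if_pos hJi, if_neg, zero_add]
        · rw [hJi]
          exact prodVal_mul (hF i hi _) (hone i _)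
        · rintro rfl; simp at h
        · rw [if_neg, if_neg, add_zero]
          · rw [hJi]
            exact fun h' => hne ((Finset.erase_inj I hi).1 h').symm
          · rintro rfl; simp at h
      · rw [hzero (Or.inr h), Finset.eq_of_subset_of_card_le hJ (by omega), sdiff_self]
        exact prodVal_of_right (one_empty _))
  refine ⟨_, ?_, hstep⟩
  have hsum : ∀ a, ∑ J ∈ ({j, k, l} : Finset ι).powerset, F₁ J a
      = ∑ i ∈ ({j, k, l} : Finset ι), (g i (d - 2 - a) * F i a + F i (d - 2 - a) * g i a) := by
    intro a
    rw [Finset.sum_comm]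
    refine Finset.sum_congr rfl fun i hi => ?_
    rw [Finset.sum_add_distrib, Finset.sum_ite_eq', Finset.sum_ite_eq', if_pos, if_pos]
    · exact Finset.mem_powerset.2 (Finset.erase_subset _ _)
    · exact Finset.mem_powerset.2 (Finset.singleton_subset_iff.2 hi)
  rw [Finset.sum_congr rfl fun a _ => hsum a, Finset.sum_comm, ← Finset.sum_add_distrib]
  have hterm : ∀ i, dg i * twoSum (F i) (d - 1) (dg i - 1) + ∑ a ∈ Finset.range (d - 1),
      (g i (d - 2 - a) * F i a + F i (d - 2 - a) * g i a)
      = dg i * twoSum (F i) (d - 1) (dg i - 1) + 2 * (max (dg i) 1 * cum (F i) (d - dg i)) := by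
    intro i
    rw [Finset.sum_add_distrib, cum_conv, cum_conv', two_mul]
  rw [Finset.sum_congr rfl fun i _ => hterm i, Finset.sum_insert (by simp [hjk, hjl]),
    Finset.sum_pair hkl, Nat.cast_add (_ + _) _, Nat.cast_add (_ + _) (_ + _),
    four_vertex_term hd (dg j) (dg k + dg l) (max (dg k) 1 * max (dg l) 1) (F j)
      (fun e => by simp only [F, G, if_pos]),
    four_vertex_term hd (dg k) (dg j + dg l) (max (dg j) 1 * max (dg l) 1) (F k)
      (fun e => by simp only [F, G, if_neg hjk.symm, if_pos]),
    four_vertex_term hd (dg l) (dg j + dg k) (max (dg j) 1 * max (dg k) 1) (F l)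
      (fun e => by simp only [F, G, if_neg hjl.symm, if_neg hkl.symm])]
  generalize dg j = a
  generalize dg k = b
  generalize dg l = c
  unfold fourVal
  have e1 : Even (d + a + (b + c)) ↔ Even (d + a + b + c) := by rw [← add_assoc]
  have e2 : Even (d + b + (a + c)) ↔ Even (d + a + b + c) := by simp only [Nat.even_iff]; omega
  have e3 : Even (d + c + (a + b)) ↔ Even (d + a + b + c) := by simp only [Nat.even_iff]; omega
  simp only [e1, e2, e3]
  by_cases h : Even (d + a + b + c)
  · simp only [if_pos h]
    -- As the total is even, either all three other valencies have the parity of `d`, with constants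
    -- `16 + 16 + 16`, or exactly one does, with `16 - 2 - 2`. Divided by `24`, this gives `2` or `1
    -- / 2`.
    have e4 : Even (d + c) ↔ (Even (d + a) ↔ Even (d + b)) := by
      simp only [Nat.even_iff] at h ⊢; omega
    rw [show max d 1 = d by omega]
    by_cases ha : Even (d + a) <;> by_cases hb : Even (d + b) <;>
      simp only [e4, ha, hb, and_true, and_false, if_true, if_false, iff_true,
        iff_false, not_true] <;> push_cast <;> ring
  · simp only [if_neg h, add_zero]

theorem plain_triple {j k l : ι} (hjk : j ≠ k) (hjl : j ≠ l) (hkl : k ≠ l) (dg : ι → ℕ)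
    (d : ℕ) (h0 : ¬ (d = 0 ∧ dg j = 0 ∧ dg k = 0 ∧ dg l = 0)) :
    ∃ n : ℕ, (n : ℚ) = fourVal d (dg j) (dg k) (dg l) ∧ PlainVal {j, k, l} dg d n := by
  -- The formula is symmetric, so a vertex of positive valency may take the role of the special one.
  have hs : ∀ a b c : ℕ, fourVal a 0 b c = fourVal 0 a b c ∧ fourVal a b 0 c = fourVal 0 b a c ∧
      fourVal a b c 0 = fourVal 0 b c a := by
    intro a b c
    unfold fourVal
    by_cases ha : Even a <;> by_cases hb : Even b <;> by_cases hc : Even c <;>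
      simp [Nat.even_add, ha, hb, hc] <;> ring_nf <;> simp
  rcases Nat.eq_zero_or_pos d with rfl | hd
  · by_cases hj : dg j = 0
    · by_cases hk : dg k = 0
      · by_cases hl : dg l = 0
        · exact absurd ⟨rfl, hj, hk, hl⟩ h0
        · obtain ⟨n, h1, h2⟩ := plain_triple_pos hjk hjl hkl (Function.update dg l 0)
            (Nat.pos_of_ne_zero hl)
          refine ⟨n, ?_, plain_reroot (j := l) (by simp) h2⟩
          rw [h1, Function.update_self, Function.update_of_ne hjl, Function.update_of_ne hkl]
          exact (hs _ _ _).2.2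
      · obtain ⟨n, h1, h2⟩ := plain_triple_pos hjk hjl hkl (Function.update dg k 0)
          (Nat.pos_of_ne_zero hk)
        refine ⟨n, ?_, plain_reroot (j := k) (by simp) h2⟩
        rw [h1, Function.update_self, Function.update_of_ne hjk, Function.update_of_ne hkl.symm]
        exact (hs _ _ _).2.1
    · obtain ⟨n, h1, h2⟩ := plain_triple_pos hjk hjl hkl (Function.update dg j 0)
        (Nat.pos_of_ne_zero hj)
      refine ⟨n, ?_, plain_reroot (j := j) (by simp) h2⟩
      rw [h1, Function.update_self, Function.update_of_ne hjk.symm, Function.update_of_ne hjl.symm]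
      exact (hs _ _ _).1
  · exact plain_triple_pos hjk hjl hkl dg hd

end FourVertices

/-! ### Rigidity of maps with at least three vertices -/

theorem not_isMap_one_vertex {D : Type} [Finite D] {σ : Perm D} {X : Set D} {x : D}
    (hσ : ∀ a b, σ.SameCycle a b) (hx : x ∈ X) (hX : ∀ c ∈ X, c = x) {τ : Perm D} {R : Setoid D} :
    ¬ IsMap σ X τ R := by
  intro h
  -- The corners form one vertex with one mark and `Nat.card D - 1` half-edges, for which the count
  -- is zero.
  have h0 := one_empty (ι := Empty) (dg := fun _ => 0) (Nat.card D - 1) D σ X (fun _ => none)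
    ⟨fun a b => iff_of_true (hσ a b) rfl, fun i => i.elim, fun c i => i.elim⟩
    ⟨by
      rw [Set.preimage_const_of_mem (Set.mem_singleton _), Set.ncard_univ]
      have : 0 < Nat.card D := Nat.card_pos_iff.2 ⟨⟨x⟩, inferInstance⟩
      omega, x, rfl, hx, fun c _ hc => hX c hc⟩
  rw [cnt, Set.ncard_eq_zero] at h0
  exact Set.notMem_empty (τ, R) (h0 ▸ h)

section
variable {D : Type} [Finite D] {σ τ : Perm D} {X : Set D} {R : Setoid D}

/-- There is another vertex on each side of a loop. -/
theorem exists_vertex_on_side [DecidableEq D] (h : IsMap σ X τ R) (hX : ∀ c ∈ X, σ c = c)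
    {x y : D} (hxy : x ≠ y) (hx : τ x = y) (hs : σ.SameCycle x y) :
    ∃ u, ¬ σ.SameCycle x u ∧ (orb (σ * swap x y) ⊔ orb (τ * swap x y) ⊔ R) x u := by
  by_contra! hno
  have hyx : τ y = x := by rw [← hx, h.invol]
  -- Here a mark is a vertex by itself, so it cannot lie at a vertex that carries a loop.
  have hXs : ∀ c ∈ X, ¬ σ.SameCycle x c := by
    intro c hc hxc
    have hfix : ∀ c', σ.SameCycle c c' → c = c' := by
      rintro c' ⟨i, rfl⟩
      exact (Perm.zpow_apply_eq_self_of_apply_eq_self (hX c hc) i).symm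
    exact hxy ((hfix x hxc.symm).symm.trans (hfix y (hxc.symm.trans hs)))
  have hxX : x ∉ X := fun h => hXs x h (Perm.SameCycle.refl _ _)
  have hyX : y ∉ X := fun h => hXs y h hs
  obtain ⟨hE, hn⟩ := (euler_cut h.invol h.face hxy hx hs).1 h.euler
  obtain ⟨t1, t2⟩ := (toggle_iff hxy hxX hyX).1 ⟨h.invol, h.fix, hx⟩
  have hconn : ∀ a b, glue (orb (σ * swap x y) ⊔ orb (τ * swap x y) ⊔ R) x y a b := by
    intro a b
    rw [← glue_sup, ← cut_sup hx hs, h.conn]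
    trivial
  generalize hG : orb (σ * swap x y) ⊔ orb (τ * swap x y) ⊔ R = G at hno hn hconn
  have hGσ : orb (σ * swap x y) ≤ G := hG ▸ le_sup_left.trans le_sup_left
  have hGτ : orb (τ * swap x y) ≤ G := hG ▸ le_sup_right.trans le_sup_left
  have hGR : R ≤ G := hG ▸ le_sup_right
  have hcl : ∀ f : Perm D, orb f ≤ G → ∀ c, G x (f c) ↔ G x c := fun f hf c =>
    ⟨fun hc => G.trans hc (G.symm (hf (orb_apply f c))), fun hc => G.trans hc (hf (orb_apply f c))⟩
  have hsplit := (isMap_split (X := X ∪ {x, y}) (p := fun c => G x c) (hcl _ hGσ) (hcl _ hGτ)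
    (resp_iff.2 fun a b hab => ⟨fun h => G.trans h (hGR hab), fun h => G.trans h
      (G.symm (hGR hab))⟩)).2 ⟨t1, t2, fun c => by rw [face_mul_swap σ hx hyx]; exact h.face c, hE,
      fun a b ha hb => by rw [hG]; exact G.trans (G.symm ha) hb, fun a b ha hb => by
        rw [hG]
        rcases hconn a b with h1 | ⟨h1, h2⟩ | ⟨h1, h2⟩
        · exact h1
        · exact absurd (G.symm h1) ha
        · exact absurd h2 hb, h.nosing⟩
  have hcyc : ∀ c, G x c → (σ * swap x y).SameCycle x c := by
    intro c hc
    have h1 : orb σ x c := by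
      by_contra hh
      exact hno c hh hc
    rw [orb_cut hs] at h1
    rcases h1 with h1 | ⟨_, h1⟩ | ⟨h1, _⟩
    · exact h1
    · exact absurd (G.trans hc (G.symm (hGσ h1))) hn
    · exact absurd (hGσ h1) hn
  -- If no other vertex were on the side of `x`, this side would be a map with one vertex and the
  -- single mark `x`.
  refine not_isMap_one_vertex (x := ⟨x, G.refl x⟩) (fun a b => ?_) (by simp) ?_ hsplit.1
  · rw [Perm.sameCycle_subtypePerm]
    exact (hcyc a.1 a.2).symm.trans (hcyc b.1 b.2)
  · rintro ⟨c, hc⟩ (hcX | hcX | hcX)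
    · exact absurd (by_contra fun hh => hno c hh hc) (hXs c hcX)
    · exact Subtype.ext hcX
    · exact absurd ((show c = y from hcX) ▸ hc) hn

/-- The corners of the edges in the orbit of an edge under an automorphism. -/
def edgeOrbit (τ e : Perm D) (x : D) : Set D := {c | e.SameCycle x c ∨ e.SameCycle x (τ c)}

theorem nc_add_ncard_le {f : Perm D} {A : Set D} (h : ∀ a ∈ A, f a ∉ A) :
    nc (orb f) + A.ncard ≤ Nat.card D := by
  have h1 : nc (orb f) ≤ (Aᶜ).ncard := by
    rw [← Nat.card_coe_set_eq]
    refine Nat.card_le_card_of_surjective (fun c : (Aᶜ : Set D) => Quotient.mk (orb f) c.1) ?_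
    intro q
    induction q using Quotient.inductionOn with | _ c
    by_cases hc : c ∈ A
    · exact ⟨⟨f c, h c hc⟩, Quotient.sound ((orb f).symm (orb_apply f c))⟩
    · exact ⟨⟨c, hc⟩, rfl⟩
  have := Set.ncard_add_ncard_compl A
  omega

theorem nc_le_ncard {r : Setoid D} {A : Set D} (h : ∀ c, ∃ a ∈ A, r c a) : nc r ≤ A.ncard := by
  rw [← Nat.card_coe_set_eq]
  refine Nat.card_le_card_of_surjective (fun c : A => Quotient.mk r c.1) ?_
  intro q
  induction q using Quotient.inductionOn with | _ c
  obtain ⟨a, ha, hca⟩ := h c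
  exact ⟨⟨a, ha⟩, Quotient.sound (r.symm hca)⟩

/-- An automorphism of a map with at least three vertices that fixes the vertices is trivial. -/
theorem rigid (h : IsMap σ X τ R) (hX : ∀ c ∈ X, σ c = c)
    (h3 : ∀ a b, ∃ u, ¬ σ.SameCycle a u ∧ ¬ σ.SameCycle b u) {e : Perm D}
    (hev : ∀ c, σ.SameCycle c (e c)) (heτ : ∀ c, e (τ c) = τ (e c))
    (heR : ∀ a b, R a b → R (e a) (e b)) (x : D) : e x = x := by
  classical
  by_cases hxX : x ∈ X
  · obtain ⟨i, hi⟩ := hev x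
    rw [← hi, Perm.zpow_apply_eq_self_of_apply_eq_self (hX x hxX) i]
  have hxy : x ≠ τ x := fun hh => hxX ((h.fix x).1 hh.symm)
  have hevσ : orb e ≤ orb σ := orb_le.2 hev
  -- All edges are deleted except those in the orbit of the edge of `x`, with half-edges `S`. The
  -- remaining map is still a connected gluing of spheres, and it suffices to show that it has one
  -- edge at most.
  let A : Set D := {c | e.SameCycle x c}
  let S : Set D := edgeOrbit τ e x
  have hSτ : ∀ c, c ∈ S ↔ τ c ∈ S := fun c => by
    simp only [S, edgeOrbit, Set.mem_ofPred_eq, h.invol]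
    exact or_comm
  have hSe : ∀ c, c ∈ S ↔ e c ∈ S := fun c => by
    simp only [S, edgeOrbit, Set.mem_ofPred_eq, ← heτ, Perm.sameCycle_apply_right]
  let τS : Perm D := Perm.ofSubtype (τ.subtypePerm (p := fun c => c ∈ S) fun c => (hSτ c).symm)
  have hS : ∀ c, c ∈ S → τS c = τ c := fun c hc => Perm.ofSubtype_apply_of_mem _ hc
  have hS' : ∀ c, c ∉ S → τS c = c := fun c hc => Perm.ofSubtype_apply_of_not_mem _ hc
  obtain ⟨hf, hE, hconn⟩ := delRel_spec (τS := τS) h.invol h.face h.euler hS hS'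
  have hle := delRel_le.1 (le_refl (delRel τ R S))
  have hRe : ∀ a b, delRel τ R S a b → delRel τ R S (e a) (e b) := by
    have : delRel τ R S ≤ (delRel τ R S).comap e := delRel_le.2
      ⟨fun a b hab => hle.1 (heR a b hab), fun c hc => by
        rw [Setoid.comap_rel, heτ]
        exact hle.2 _ fun hh => hc ((hSe c).2 hh)⟩
    exact fun a b hab => this hab
  have hsep : delRel τ R S ≤ (orb (σ * swap x (τ x)) ⊔ orb (τ * swap x (τ x)) ⊔ R) := by
    refine delRel_le.2 ⟨le_sup_right, fun c hc => ?_⟩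
    have h1 : c ≠ x := by rintro rfl; exact hc (Or.inl (Perm.SameCycle.refl _ _))
    have h2 : c ≠ τ x := by
      rintro rfl; refine hc (Or.inr ?_)
      rw [h.invol]
    have := orb_apply (τ * swap x (τ x)) c
    rw [mul_swap_other τ h1 h2] at this
    exact ((le_sup_right : _ ≤ orb (σ * swap x (τ x)) ⊔ _).trans le_sup_left) this
  rw [h.conn] at hconn
  generalize delRel τ R S = Q at hf hE hconn hle hRe hsep
  have hxA : x ∈ A := Perm.SameCycle.refl _ _
  have hout : ∀ c, c ∉ S → Q c (σ c) := fun c hc => by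
    have := hf c
    rwa [hS' c hc] at this
  -- A region that touches no remaining edge would be closed under everything, against
  -- connectedness.
  have hmeet : ∀ c, ∃ s ∈ S, Q c s := by
    intro c
    by_contra! hno
    have hσ : Resp (fun b => Q c b) (orb σ) := by
      have hfw : ∀ b, Q c b → Q c (σ b) := fun b hb => Q.trans hb (hout b fun hS => hno b hS hb)
      refine resp_orb fun b => ⟨fun hb => ?_, hfw b⟩
      have := Perm.perm_symm_on_of_perm_on_finite (f := σ) (p := fun b => Q c b) hfw hb
      rwa [symm_apply_apply] at this
    have hτS : Resp (fun b => Q c b) (orb τS) := by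
      refine resp_orb fun b => ?_
      by_cases hb : b ∈ S
      · rw [hS b hb]
        exact iff_of_false (hno _ ((hSτ b).1 hb)) (hno b hb)
      · rw [hS' b hb]
    have hQ : Resp (fun b => Q c b) Q :=
      resp_iff.2 fun a b hab => ⟨fun h => Q.trans h hab, fun h => Q.trans h (Q.symm hab)⟩
    have hall := (hσ.sup hτS).sup hQ
    rw [hconn] at hall
    exact hno x (Or.inl hxA) ((resp_iff.1 hall c x trivial).1 (Q.refl c))
  have hτe : ∀ a b, e.SameCycle a b → e.SameCycle (τ a) (τ b) := by
    have : orb e ≤ (orb e).comap τ := orb_le.2 fun c => by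
      rw [Setoid.comap_rel, ← heτ]
      exact orb_apply e (τ c)
    exact fun a b hab => this hab
  have hτA : ∀ c, τ c ∈ A → e.SameCycle (τ x) c := fun c hc => by
    have := hτe _ _ hc
    rwa [h.invol] at this
  have hSσ : ∀ c ∈ S, σ.SameCycle x c ∨ σ.SameCycle (τ x) c := fun c hc =>
    hc.imp (fun hc => hevσ hc) fun hc => hevσ (hτA c hc)
  -- A vertex that is not an end of the remaining edges is isolated, so it lies in a single region.
  -- As `e` fixes the vertex, it preserves this region, which therefore contains the whole orbit of
  -- each of its corners.
  have hclass : ∀ u, ¬ σ.SameCycle x u → ¬ σ.SameCycle (τ x) u → ∀ s s', Q u s →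
      e.SameCycle s s' → Q u s' := by
    intro u hu hu' s s' hs hss
    have huS : ∀ i : ℕ, (σ ^ i) u ∉ S := fun i hi => by
      have : σ.SameCycle ((σ ^ i) u) u := Perm.SameCycle.symm ⟨i, by simp⟩
      rcases hSσ _ hi with h1 | h1
      · exact hu (h1.trans this)
      · exact hu' (h1.trans this)
    have hu1 : ∀ i : ℕ, Q u ((σ ^ i) u) := fun i => by
      induction i with
      | zero => exact Q.refl u
      | succ i ih =>
        rw [pow_succ', Perm.mul_apply]
        exact Q.trans ih (hout _ (huS i))
    have hue : Q u (e u) := by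
      obtain ⟨i, _, hi⟩ := sameCycle_exists_pow (hev u)
      rw [← hi]
      exact hu1 i
    obtain ⟨i, hi, rfl⟩ := sameCycle_exists_pow hss
    clear hss hi
    induction i with
    | zero => exact hs
    | succ i ih =>
      rw [pow_succ', Perm.mul_apply]
      exact Q.trans hue (hRe _ _ ih)
  suffices hA1 : A.ncard ≤ 1 from
    (Set.ncard_le_one_iff (Set.toFinite A)).1 hA1 (Perm.sameCycle_apply_right.2 (Perm.SameCycle.refl _ _)) hxA
  have hx0 : Nonempty D := ⟨x⟩
  unfold Euler at hE
  rw [hconn, nc_eq_one (r := (⊤ : Setoid D)) rfl] at hE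
  -- For loops, Euler's formula bounds the number of edges by the number of regions minus one. There
  -- are other vertices `u` and `u'` on the two sides, and every region contains one of them.
  by_cases hs : σ.SameCycle x (τ x)
  · have hτσ : orb τS ≤ orb σ := orb_le.2 fun c => by
      by_cases hc : c ∈ S
      · rw [hS c hc]
        have h1 : ∀ c ∈ S, σ.SameCycle x c := fun c hc => (hSσ c hc).elim id hs.trans
        exact (h1 c hc).symm.trans (h1 _ ((hSτ c).1 hc))
      · rw [hS' c hc]
    rw [sup_eq_left.2 hτσ] at hE
    obtain ⟨u, hu, hGu⟩ := exists_vertex_on_side h hX hxy rfl hs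
    obtain ⟨u', hu', hGu'⟩ := exists_vertex_on_side h hX hxy.symm (h.invol x) hs.symm
    rw [swap_comm] at hGu'
    have hn := ((euler_cut h.invol h.face hxy rfl hs).1 h.euler).2
    have huu : ¬ Q u u' := fun hQ => hn (Setoid.trans' _ hGu (Setoid.trans' _ (hsep hQ)
      (Setoid.symm' _ hGu')))
    have hcu := hclass u hu fun h => hu (hs.trans h)
    have hcu' := hclass u' (fun h => hu' (hs.symm.trans h)) hu'
    obtain ⟨s, hsS, hQs⟩ := hmeet u
    obtain ⟨s', hsS', hQs'⟩ := hmeet u'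
    have hss : ¬ e.SameCycle s s' := fun hh => huu (Q.trans (hcu s s' hQs hh) (Q.symm hQs'))
    have hsame : ∀ a b, τ a ∈ A → τ b ∈ A → e.SameCycle a b := fun a b ha hb =>
      (hτA a ha).symm.trans (hτA b hb)
    -- If `e` exchanged the ends of the loop, `S` would be one orbit, and the regions of `u` and
    -- `u'` would coincide.
    have hτx : τ x ∉ A := fun hh => by
      have : ∀ c ∈ S, e.SameCycle x c := fun c hc => hc.elim id fun hc => hh.trans (hτA c hc)
      exact hss ((this s hsS).symm.trans (this s' hsS'))
    have hAτ : ∀ a ∈ A, τS a ∉ A := fun a ha hh => by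
      rw [hS a (Or.inl ha)] at hh
      exact hτx (hh.trans (hτe _ _ ha).symm)
    have h1 := nc_add_ncard_le hAτ
    have h2 : nc Q ≤ ({u, u'} : Set D).ncard := nc_le_ncard fun c => by
      obtain ⟨t, ht, hct⟩ := hmeet c
      have key : e.SameCycle s t ∨ e.SameCycle s' t := by
        rcases hsS with h1 | h1 <;> rcases hsS' with h2 | h2 <;> rcases ht with h3 | h3
        · exact Or.inl (h1.symm.trans h3)
        · exact absurd (h1.symm.trans h2) hss
        · exact Or.inl (h1.symm.trans h3)
        · exact Or.inr (hsame _ _ h2 h3)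
        · exact Or.inr (h2.symm.trans h3)
        · exact Or.inl (hsame _ _ h1 h3)
        · exact absurd (hsame _ _ h1 h2) hss
        · exact Or.inl (hsame _ _ h1 h3)
      rcases key with h1 | h1
      · exact ⟨u, by simp, Q.trans hct (Q.symm (hcu s t hQs h1))⟩
      · exact ⟨u', by simp, Q.trans hct (Q.symm (hcu' s' t hQs' h1))⟩
    have h3 := Set.ncard_insert_le u {u'}
    rw [Set.ncard_singleton] at h3
    omega
  · have hsup : orb σ ⊔ orb τS = glue (orb σ) x (τ x) := by
      refine le_antisymm (sup_le (le_glue _ _ _) (orb_le.2 fun c => ?_))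
        (glue_le.2 ⟨le_sup_left, (le_sup_right : orb τS ≤ _) ?_⟩)
      · by_cases hc : c ∈ S
        · rw [hS c hc]
          rcases hc with hc | hc
          · exact Or.inr (Or.inl ⟨(hevσ hc).symm, hevσ (hτe _ _ hc)⟩)
          · exact Or.inr (Or.inr ⟨(hevσ (hτA c hc)).symm, hevσ hc⟩)
        · rw [hS' c hc]
      · rw [← hS x (Or.inl hxA)]
        exact orb_apply τS x
    rw [hsup] at hE
    obtain ⟨u, hu, hu'⟩ := h3 x (τ x)
    have hcu := hclass u hu hu'
    -- Along the rotation towards `x`, the region does not change until a corner of `A` is reached: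
    -- corners of the other ends lie at the other vertex.
    have hwalk : ∀ (m : ℕ) c, (σ ^ m) c = x → ∃ a ∈ A, Q c a := by
      intro m
      induction m with
      | zero => rintro c rfl; exact ⟨_, hxA, Q.refl _⟩
      | succ m ih =>
        intro c hc
        by_cases hcS : c ∈ S
        · rcases hcS with h1 | h1
          · exact ⟨c, h1, Q.refl c⟩
          · have h4 : σ.SameCycle c x := ⟨(m + 1 : ℕ), by rw [zpow_natCast, hc]⟩
            exact absurd (h4.symm.trans (hevσ (hτA c h1)).symm) hs
        · rw [pow_succ, Perm.mul_apply] at hc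
          obtain ⟨a, ha, hQ⟩ := ih _ hc
          exact ⟨a, ha, Q.trans (hout c hcS) hQ⟩
    have hmeetA : ∀ c, ∃ a ∈ A, Q c a := by
      intro c
      obtain ⟨s, hsS, hcs⟩ := hmeet c
      rcases id hsS with h1 | h1
      · exact ⟨s, h1, hcs⟩
      · have h4 := hf s
        rw [hS s hsS] at h4
        have h5 : σ.SameCycle (σ (τ s)) x := Perm.sameCycle_apply_left.2 (hevσ h1).symm
        obtain ⟨m, _, hm⟩ := sameCycle_exists_pow h5
        obtain ⟨a, ha, hQ⟩ := hwalk m _ hm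
        exact ⟨a, ha, Q.trans hcs (Q.trans h4 hQ)⟩
    obtain ⟨a₀, ha₀, hua⟩ := hmeetA u
    -- The region of `u` contains the whole orbit `A`, and every region meets `A`. So there is one
    -- region only, and Euler's formula leaves room for at most one edge.
    have hQ1 : nc Q ≤ ({u} : Set D).ncard := nc_le_ncard fun c => by
      obtain ⟨a, ha, hca⟩ := hmeetA c
      exact ⟨u, rfl, Q.trans hca (Q.symm (hcu a₀ a hua (ha₀.symm.trans ha)))⟩
    rw [Set.ncard_singleton] at hQ1
    have hAτ : ∀ a ∈ A, τS a ∉ A := fun a ha hh => by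
      rw [hS a (Or.inl ha)] at hh
      exact hs (hevσ (hh.trans (hτe _ _ ha).symm))
    have h1 := nc_add_ncard_le hAτ
    have h2 := nc_glue_le (orb σ) x (τ x)
    omega

end

/-! ### From combinatorial maps to permutations of corners -/

theorem nc_eq_ncard_range {E β : Type} {r : Setoid E} {f : E → β} (h : ∀ a b, r a b ↔ f a = f b) :
    nc r = (Set.range f).ncard := by
  rw [← Nat.card_coe_set_eq]
  refine Nat.card_congr (Equiv.ofBijective (Quotient.lift (fun a => (⟨f a, a, rfl⟩ : Set.range f))
    fun a b hab => Subtype.ext ((h a b).1 hab)) ⟨?_, ?_⟩)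
  · intro a b
    induction a using Quotient.inductionOn with | _ a
    induction b using Quotient.inductionOn with | _ b
    intro hab
    exact Quotient.sound ((h a b).2 (congrArg Subtype.val hab))
  · rintro ⟨_, a, rfl⟩
    exact ⟨Quotient.mk _ a, rfl⟩

theorem invol_sameCycle {D : Type} {τ : Perm D} (hτ : ∀ c, τ (τ c) = c) {a b : D} :
    τ.SameCycle a b ↔ b = a ∨ b = τ a := by
  constructor
  · rintro ⟨i, rfl⟩
    have h2 : τ ^ (2 : ℤ) = 1 := Equiv.ext fun c => hτ c
    rcases Int.even_or_odd i with ⟨j, rfl⟩ | ⟨j, rfl⟩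
    · left
      rw [← two_mul, zpow_mul, h2]; simp
    · right
      rw [zpow_add, zpow_mul, h2]; simp
  · rintro (rfl | rfl)
    · exact Perm.SameCycle.refl _ _
    · exact ⟨1, by simp⟩

/-- Each orbit is a fixed point, counted once as an element and once as a fixed point, or a pair of
elements. -/
theorem two_mul_nc_invol {D : Type} [Finite D] {τ : Perm D} (hτ : ∀ c, τ (τ c) = c) :
    2 * nc (orb τ) = Nat.card D + {c | τ c = c}.ncard := by
  classical
  have : Fintype D := Fintype.ofFinite D
  have : Fintype (Quotient (orb τ)) := Fintype.ofFinite _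
  rw [← Set.ncard_univ, ncard_eq_sum_fiber Set.univ (Quotient.mk (orb τ)) Finset.univ (by simp),
    ncard_eq_sum_fiber {c | τ c = c} (Quotient.mk (orb τ)) Finset.univ (by simp),
    ← Finset.sum_add_distrib, nc, Nat.card_eq_fintype_card, mul_comm, ← smul_eq_mul,
    ← Finset.card_univ, ← Finset.sum_const]
  refine Finset.sum_congr rfl fun q _ => ?_
  induction q using Quotient.inductionOn with | _ c
  have key : ∀ b, Quotient.mk (orb τ) b = Quotient.mk (orb τ) c ↔ b = c ∨ b = τ c := fun b => by
    rw [eq_comm, Quotient.eq]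
    exact invol_sameCycle hτ
  simp only [key]
  by_cases hc : τ c = c
  · have h1 : {q | q ∈ Set.univ ∧ (q = c ∨ q = τ c)} = {c} := by ext q; simp [hc]
    have h2 : {q | q ∈ {c | τ c = c} ∧ (q = c ∨ q = τ c)} = {c} := by
      ext q
      simp only [hc, or_self, Set.mem_ofPred_eq, Set.mem_singleton_iff]
      exact ⟨fun h => h.2, fun h => ⟨h ▸ hc, h⟩⟩
    rw [h1, h2, Set.ncard_singleton]
  · have h1 : {q | q ∈ Set.univ ∧ (q = c ∨ q = τ c)} = {c, τ c} := by ext q; simp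
    have h2 : {q | q ∈ {c | τ c = c} ∧ (q = c ∨ q = τ c)} = ∅ := by
      ext q
      simp only [Set.mem_ofPred_eq, Set.mem_empty_iff_false, iff_false]
      rintro ⟨hq, rfl | rfl⟩
      · exact hc hq
      · rw [hτ] at hq; exact hc hq.symm
    rw [h1, h2, Set.ncard_pair (Ne.symm hc), Set.ncard_empty]

section Link
variable {n : ℕ} {d : Fin n → ℕ}

/-- The extension of a permutation of the half-edges to the corners. -/
def ext (f : Perm (HalfEdge d)) : Perm (Corner d) := Equiv.sumCongr f (Equiv.refl _)

theorem ext_inl (f : Perm (HalfEdge d)) (x : HalfEdge d) : ext f (.inl x) = .inl (f x) := rfl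

theorem ext_inr (f : Perm (HalfEdge d)) (i : {i : Fin n // d i = 0}) :
    ext f (.inr i) = .inr i := rfl

theorem exists_vertex (i : Fin n) : ∃ c : Corner d, c.vertex = i := by
  by_cases h : d i = 0
  · exact ⟨.inr ⟨i, h⟩, rfl⟩
  · exact ⟨.inl ⟨i, ⟨0, Nat.pos_of_ne_zero h⟩⟩, rfl⟩

theorem ext_pow_inl (f : Perm (HalfEdge d)) (i : ℤ) (x : HalfEdge d) :
    (ext f ^ i) (.inl x) = .inl ((f ^ i) x) := by
  have : ext f ^ i = ext (f ^ i) :=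
    (map_zpow (Perm.sumCongrHom (HalfEdge d) {i : Fin n // d i = 0}) (f, 1) i).symm.trans (by
      change Perm.sumCongr (f ^ i) (1 ^ i) = _
      rw [one_zpow]; rfl)
  rw [this]; rfl

theorem ext_sameCycle {f : Perm (HalfEdge d)} (hf : ∀ x y, f.SameCycle x y ↔ x.1 = y.1)
    (a b : Corner d) : (ext f).SameCycle a b ↔ a.vertex = b.vertex := by
  constructor
  · intro h
    have : orb (ext f) ≤ Setoid.ker Corner.vertex := orb_le.2 fun c => by
      rcases c with x | i
      · exact (hf x (f x)).1 ⟨1, by simp⟩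
      · rfl
    exact this h
  · intro h
    rcases a with x | i <;> rcases b with y | j
    · obtain ⟨k, hk⟩ := (hf x y).2 h
      exact ⟨k, by rw [ext_pow_inl, hk]⟩
    · have h' : x.1 = j.1 := h
      exact absurd (h' ▸ j.2) (Nat.pos_iff_ne_zero.1 (Fin.pos x.2))
    · have h' : i.1 = y.1 := h
      exact absurd (h' ▸ i.2) (Nat.pos_iff_ne_zero.1 (Fin.pos y.2))
    · have h' : i.1 = j.1 := h
      rw [Subtype.ext h']

variable (m : CombMap d)

theorem orb_sup_iff (c c' : Corner d) :
    (orb (ext m.rot) ⊔ orb (ext m.opp)) c c' ↔ m.comp c.vertex = m.comp c'.vertex := by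
  constructor
  · intro h
    have : orb (ext m.rot) ⊔ orb (ext m.opp) ≤ Setoid.ker fun c => m.comp c.vertex := by
      refine sup_le (orb_le.2 fun c => ?_) (orb_le.2 fun c => ?_)
      · change m.comp c.vertex = m.comp _
        rw [(ext_sameCycle m.rot_cyclic c (ext m.rot c)).1 (orb_apply _ c)]
      · rcases c with x | i
        · change m.comp x.1 = m.comp (m.opp x).1
          by_cases hx : x.1 = (m.opp x).1
          · rw [hx]
          · exact SimpleGraph.ConnectedComponent.sound
              (SimpleGraph.Adj.reachable ⟨hx, Or.inl ⟨x, rfl, rfl⟩⟩)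
        · rfl
    exact this h
  · intro h
    obtain ⟨w⟩ := SimpleGraph.ConnectedComponent.exact h
    generalize hi : c.vertex = i at w
    generalize hj : c'.vertex = j at w
    clear h
    have hle : orb (ext m.opp) ≤ orb (ext m.rot) ⊔ orb (ext m.opp) := le_sup_right
    have hv : ∀ a b : Corner d, a.vertex = b.vertex → (orb (ext m.rot) ⊔ orb (ext m.opp)) a b :=
      fun a b hab => (le_sup_left : orb (ext m.rot) ≤ _) ((ext_sameCycle m.rot_cyclic a b).2 hab)
    induction w generalizing c with
    | nil => exact hv _ _ (hi.trans hj.symm)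
    | cons hadj w ih =>
      obtain ⟨_, ⟨x, h1, h2⟩ | ⟨x, h1, h2⟩⟩ := hadj
      · exact Setoid.trans' _ (hv c (.inl x) (hi.trans h1.symm))
          (Setoid.trans' _ (hle (orb_apply (ext m.opp) (.inl x))) (ih _ h2 hj))
      · refine Setoid.trans' _ (hv c (.inl (m.opp x)) (hi.trans h2.symm))
          (Setoid.trans' _ (hle ?_) (ih (.inl x) h1 hj))
        exact (orb (ext m.opp)).symm (orb_apply (ext m.opp) (.inl x))

theorem faceStep_apply (c : Corner d) : m.faceStep c = ext m.rot (ext m.opp c) := by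
  rcases c with x | i <;> rfl

theorem region_faceStep (c : Corner d) : m.region c (ext m.rot (ext m.opp c)) := by
  rcases c with x | i
  · exact m.region_face x
  · exact m.region.refl _

theorem orb_faceStep_le : orb m.faceStep ≤ orb (ext m.rot) ⊔ orb (ext m.opp) :=
  orb_le.2 fun c => by
    rw [faceStep_apply]
    exact Setoid.trans' _ ((le_sup_right : orb (ext m.opp) ≤ _) (orb_apply _ c))
      ((le_sup_left : orb (ext m.rot) ≤ _) (orb_apply _ _))

theorem orb_faceStep_le_region : orb m.faceStep ≤ m.region :=
  orb_le.2 fun c => by rw [faceStep_apply]; exact region_faceStep m c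

theorem ext_opp_opp (c : Corner d) : ext m.opp (ext m.opp c) = c := by
  rcases c with x | i
  · rw [ext_inl, ext_inl, m.opp_opp]
  · rfl

theorem ext_opp_fix (c : Corner d) : ext m.opp c = c ↔ c ∈ Set.range (Sum.inr : _ → Corner d) := by
  rcases c with x | i
  · rw [ext_inl]
    refine iff_of_false (fun h => m.opp_ne x (Sum.inl.inj h)) ?_
    rintro ⟨i, hi⟩
    cases hi
  · exact iff_of_true rfl ⟨i, rfl⟩

end Link

section Gluing
variable {n : ℕ} {d : Fin n → ℕ} (m : CombMap d)

/-- The component to which a face belongs. -/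
def faceComp : m.Face → m.Component :=
  Quotient.lift (fun c => m.comp c.vertex) fun a b hab =>
    (orb_sup_iff m a b).1 (orb_faceStep_le m hab)

/-- The region to which a face belongs. -/
def faceRegion : m.Face → m.Region :=
  Quotient.lift (fun c => Quotient.mk _ c) fun _ _ hab => Quotient.sound (orb_faceStep_le_region m hab)

/-- Every face contributes two edges, one to its component and one to its region; hence the graph is
a tree if it is connected and the numbers of nodes and faces match. -/
theorem gluingGraph_edgeSet : m.gluingGraph.edgeSet = Set.range (Sum.elim
    (fun f => s(.inr (.inl f), .inl (faceComp m f)))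
    (fun f => s(.inr (.inl f), .inr (.inr (faceRegion m f)))) :
      m.Face ⊕ m.Face → Sym2 (m.Component ⊕ m.Face ⊕ m.Region)) := by
  ext e
  induction e using Sym2.inductionOn with | _ a b
  rw [SimpleGraph.mem_edgeSet, CombMap.gluingGraph, SimpleGraph.fromRel_adj]
  constructor
  · rintro ⟨-, ⟨c, ⟨rfl, rfl⟩ | ⟨rfl, rfl⟩⟩ | ⟨c, ⟨rfl, rfl⟩ | ⟨rfl, rfl⟩⟩⟩
    · exact ⟨.inl (m.face c), Sym2.eq_swap⟩
    · exact ⟨.inr (m.face c), rfl⟩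
    · exact ⟨.inl (m.face c), rfl⟩
    · exact ⟨.inr (m.face c), Sym2.eq_swap⟩
  · rintro ⟨f | f, hf⟩ <;> induction f using Quotient.inductionOn with | _ c
    · rcases Sym2.eq_iff.1 hf with ⟨rfl, rfl⟩ | ⟨rfl, rfl⟩
      · exact ⟨by simp, Or.inr ⟨c, Or.inl ⟨rfl, rfl⟩⟩⟩
      · exact ⟨by simp, Or.inl ⟨c, Or.inl ⟨rfl, rfl⟩⟩⟩
    · rcases Sym2.eq_iff.1 hf with ⟨rfl, rfl⟩ | ⟨rfl, rfl⟩
      · exact ⟨by simp, Or.inl ⟨c, Or.inr ⟨rfl, rfl⟩⟩⟩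
      · exact ⟨by simp, Or.inr ⟨c, Or.inr ⟨rfl, rfl⟩⟩⟩

theorem card_gluingGraph_edgeSet : Nat.card m.gluingGraph.edgeSet = 2 * Nat.card m.Face := by
  rw [gluingGraph_edgeSet, Nat.card_coe_set_eq, ← Set.image_univ, Set.ncard_image_of_injective,
    Set.ncard_univ, Nat.card_sum, two_mul]
  rintro (f | f) (g | g) h
  · rw [show f = g by simp at h; exact h.1]
  · simp at h
  · simp at h
  · rw [show f = g by simp at h; exact h.1]

theorem gluingGraph_connected (hn : 0 < n) : m.gluingGraph.Connected ↔
    orb (ext m.rot) ⊔ orb (ext m.opp) ⊔ m.region = ⊤ := by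
  have hadj1 : ∀ c : Corner d, m.gluingGraph.Reachable (.inl (m.comp c.vertex))
      (.inr (.inl (m.face c))) := fun c =>
    SimpleGraph.Adj.reachable ⟨by simp, Or.inl ⟨c, Or.inl ⟨rfl, rfl⟩⟩⟩
  have hadj2 : ∀ c : Corner d, m.gluingGraph.Reachable (.inr (.inl (m.face c)))
      (.inr (.inr (Quotient.mk _ c))) := fun c =>
    SimpleGraph.Adj.reachable ⟨by simp, Or.inl ⟨c, Or.inr ⟨rfl, rfl⟩⟩⟩
  constructor
  · intro h
    generalize hG : orb (ext m.rot) ⊔ orb (ext m.opp) ⊔ m.region = G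
    have hC : ∀ c c' : Corner d, m.comp c.vertex = m.comp c'.vertex → G c c' := fun c c' h =>
      (hG ▸ le_sup_left : orb (ext m.rot) ⊔ orb (ext m.opp) ≤ G) ((orb_sup_iff m c c').2 h)
    have hR : m.region ≤ G := hG ▸ le_sup_right
    have hF : ∀ c c' : Corner d, m.face c = m.face c' → G c c' := fun c c' h =>
      hR (orb_faceStep_le_region m (Quotient.exact h))
    rw [eq_top_iff]
    intro c₀ c₁ _
    -- The nodes that have a corner equivalent to `c₀`; this property passes along the edges of the
    -- gluing graph.
    let T : m.Component ⊕ m.Face ⊕ m.Region → Prop := Sum.elim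
      (fun K => ∃ c : Corner d, m.comp c.vertex = K ∧ G c₀ c)
      (Sum.elim (fun f => ∃ c : Corner d, m.face c = f ∧ G c₀ c)
        fun r => ∃ c : Corner d, Quotient.mk _ c = r ∧ G c₀ c)
    have t1 : ∀ c, T (.inl (m.comp c.vertex)) ↔ G c₀ c := fun c =>
      ⟨fun ⟨c', h1, h2⟩ => G.trans h2 (hC _ _ h1), fun h => ⟨c, rfl, h⟩⟩
    have t2 : ∀ c, T (.inr (.inl (m.face c))) ↔ G c₀ c := fun c =>
      ⟨fun ⟨c', h1, h2⟩ => G.trans h2 (hF _ _ h1), fun h => ⟨c, rfl, h⟩⟩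
    have t3 : ∀ c, T (.inr (.inr (Quotient.mk _ c))) ↔ G c₀ c := fun c =>
      ⟨fun ⟨c', h1, h2⟩ => G.trans h2 (hR (Quotient.exact h1)), fun h => ⟨c, rfl, h⟩⟩
    have hT : ∀ a b, m.gluingGraph.Adj a b → T a → T b := by
      rintro a b ⟨-, ⟨c, ⟨rfl, rfl⟩ | ⟨rfl, rfl⟩⟩ | ⟨c, ⟨rfl, rfl⟩ | ⟨rfl, rfl⟩⟩⟩ ha
      · exact (t2 c).2 ((t1 c).1 ha)
      · exact (t3 c).2 ((t2 c).1 ha)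
      · exact (t1 c).2 ((t2 c).1 ha)
      · exact (t2 c).2 ((t3 c).1 ha)
    obtain ⟨w⟩ := h.preconnected (.inr (.inr (Quotient.mk _ c₀))) (.inr (.inr (Quotient.mk _ c₁)))
    have hw : ∀ a b, m.gluingGraph.Walk a b → T a → T b := by
      intro a b w
      induction w with
      | nil => exact id
      | cons hadj w ih => exact fun ha => ih (hT _ _ hadj ha)
    exact (t3 c₁).1 (hw _ _ w ((t3 c₀).2 (G.refl c₀)))
  · intro h
    let r : Setoid (Corner d) := (m.gluingGraph.reachableSetoid).comap
      fun c => .inr (.inr (Quotient.mk _ c))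
    have hr : orb (ext m.rot) ⊔ orb (ext m.opp) ⊔ m.region ≤ r := by
      refine sup_le (fun c c' hc => ?_) fun c c' hc => ?_
      · have := (orb_sup_iff m c c').1 hc
        have h1 := ((hadj2 c).symm.trans (hadj1 c).symm)
        rw [this] at h1
        exact h1.trans ((hadj1 c').trans (hadj2 c'))
      · change m.gluingGraph.Reachable (.inr (.inr (Quotient.mk _ c))) _
        rw [show Quotient.mk m.region c = Quotient.mk m.region c' from Quotient.sound hc]
    rw [h] at hr
    have key : ∀ a, ∃ c, m.gluingGraph.Reachable a (.inr (.inr (Quotient.mk _ c))) := by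
      rintro (K | f | r)
      · induction K using SimpleGraph.ConnectedComponent.ind with | _ i
        obtain ⟨c, rfl⟩ := exists_vertex (d := d) i
        exact ⟨c, (hadj1 c).trans (hadj2 c)⟩
      · induction f using Quotient.inductionOn with | _ c
        exact ⟨c, hadj2 c⟩
      · induction r using Quotient.inductionOn with | _ c
        exact ⟨c, SimpleGraph.Reachable.refl _⟩
    have : Nonempty (m.Component ⊕ m.Face ⊕ m.Region) := ⟨.inl (m.comp ⟨0, hn⟩)⟩
    refine ⟨fun a b => ?_⟩
    obtain ⟨c, hc⟩ := key a
    obtain ⟨c', hc'⟩ := key b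
    exact hc.trans ((show r c c' from hr trivial).trans hc'.symm)

end Gluing

section Euler
variable {n : ℕ} {d : Fin n → ℕ} (m : CombMap d)

theorem nc_rot : nc (orb (ext m.rot)) = n := by
  rw [nc_eq_ncard_range (f := Corner.vertex) (ext_sameCycle m.rot_cyclic),
    Set.range_eq_univ.2 exists_vertex, Set.ncard_univ, Nat.card_fin]

theorem nc_comp : nc (orb (ext m.rot) ⊔ orb (ext m.opp)) = Nat.card m.Component := by
  rw [nc_eq_ncard_range (orb_sup_iff m), Set.range_eq_univ.2, Set.ncard_univ]
  intro K
  induction K using SimpleGraph.ConnectedComponent.ind with | _ i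
  obtain ⟨c, rfl⟩ := exists_vertex (d := d) i
  exact ⟨c, rfl⟩

theorem card_corner : Nat.card (Corner d) = Nat.card (HalfEdge d) + {c | ext m.opp c = c}.ncard := by
  rw [Nat.card_sum]
  congr 1
  have : {c | ext m.opp c = c} = Set.range (Sum.inr : _ → Corner d) := Set.ext fun c =>
    ext_opp_fix m c
  rw [this, ← Set.image_univ, Set.ncard_image_of_injective _ Sum.inr_injective, Set.ncard_univ]

theorem two_mul_card_edge : 2 * Nat.card m.Edge = Nat.card (HalfEdge d) := by
  have h := two_mul_nc_invol m.opp_opp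
  have : {x | m.opp x = x} = ∅ := Set.eq_empty_of_forall_notMem fun x => m.opp_ne x
  rw [this, Set.ncard_empty, add_zero] at h
  exact h

theorem card_edge_add : Nat.card m.Edge + nc (orb (ext m.opp)) = Nat.card (Corner d) := by
  have h1 := two_mul_nc_invol (ext_opp_opp m)
  have h2 := card_corner m
  have h3 := two_mul_card_edge m
  omega

/-- The component to which an edge belongs. -/
def edgeComp : m.Edge → m.Component :=
  Quotient.lift (fun x => m.comp x.1) fun x y hxy => by
    obtain ⟨i, hi⟩ := hxy
    refine (orb_sup_iff m (.inl x) (.inl y)).1 ((le_sup_right : orb (ext m.opp) ≤ _) ⟨i, ?_⟩)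
    rw [ext_pow_inl, hi]

/-- The Euler characteristic of a component is at most `2`. -/
theorem component_euler_le (K : m.Component) :
    {i : Fin n | m.comp i = K}.ncard +
      {f : m.Face | ∃ c : Corner d, m.face c = f ∧ m.comp c.vertex = K}.ncard ≤
    2 + {e : m.Edge | ∃ x : HalfEdge d, Quotient.mk _ x = e ∧ m.comp x.1 = K}.ncard := by
  let p : Corner d → Prop := fun c => m.comp c.vertex = K
  let q : HalfEdge d → Prop := fun x => m.comp x.1 = K
  have hσ : ∀ c, p (ext m.rot c) ↔ p c := fun c => by
    simp only [p, ← (ext_sameCycle m.rot_cyclic c (ext m.rot c)).1 (orb_apply _ c)]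
  have hτ : ∀ c, p (ext m.opp c) ↔ p c := fun c => by
    simp only [p, ← (orb_sup_iff m c _).1 ((le_sup_right : orb (ext m.opp) ≤ _) (orb_apply _ c))]
  have hq : ∀ x, q (m.opp x) ↔ q x := fun x => hτ (.inl x)
  -- The general inequality is applied to one component, with its own faces as regions.
  have key := euler_le (σ := (ext m.rot).subtypePerm hσ) (τ := (ext m.opp).subtypePerm hτ)
    (R := res p (orb m.faceStep)) (fun c => Subtype.ext (ext_opp_opp m c)) (fun c => by
      change orb m.faceStep c.1 _
      exact ⟨1, by rw [zpow_one, faceStep_apply]; rfl⟩)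
  have htop : orb ((ext m.rot).subtypePerm hσ) ⊔ orb ((ext m.opp).subtypePerm hτ) = ⊤ := by
    rw [← res_orb hσ, ← res_orb hτ, ← res_sup (resp_orb hσ) (resp_orb hτ), res_eq_top]
    exact fun a b ha hb => (orb_sup_iff m a b).2 (ha.trans hb.symm)
  have hne : Nonempty {c // p c} := by
    induction K using SimpleGraph.ConnectedComponent.ind with | _ i
    obtain ⟨c, rfl⟩ := exists_vertex (d := d) i
    exact ⟨c, rfl⟩
  rw [htop, top_sup_eq, nc_eq_one rfl] at key
  have hV : nc (orb ((ext m.rot).subtypePerm hσ)) = {i : Fin n | m.comp i = K}.ncard := by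
    rw [nc_eq_ncard_range (f := fun c : {c // p c} => c.1.vertex)]
    · congr 1
      ext i
      constructor
      · rintro ⟨c, rfl⟩
        exact c.2
      · intro hi
        obtain ⟨c, rfl⟩ := exists_vertex (d := d) i
        exact ⟨⟨c, hi⟩, rfl⟩
    · intro a b
      rw [← ext_sameCycle m.rot_cyclic]
      exact Perm.sameCycle_subtypePerm
  have hF : nc (res p (orb m.faceStep))
      = {f : m.Face | ∃ c : Corner d, m.face c = f ∧ m.comp c.vertex = K}.ncard := by
    rw [nc_eq_ncard_range (f := fun c : {c // p c} => m.face c.1)]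
    · congr 1
      ext f
      exact ⟨fun ⟨c, hc⟩ => ⟨c.1, hc, c.2⟩, fun ⟨c, hc, hp⟩ => ⟨⟨c, hp⟩, hc⟩⟩
    · intro a b
      exact (Quotient.eq (r := orb m.faceStep)).symm
  have hE : nc (orb (m.opp.subtypePerm hq))
      = {e : m.Edge | ∃ x : HalfEdge d, Quotient.mk _ x = e ∧ m.comp x.1 = K}.ncard := by
    rw [nc_eq_ncard_range (f := fun c : {c // q c} => (Quotient.mk _ c.1 : m.Edge))]
    · congr 1
      ext f
      exact ⟨fun ⟨c, hc⟩ => ⟨c.1, hc, c.2⟩, fun ⟨c, hc, hp⟩ => ⟨⟨c, hp⟩, hc⟩⟩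
    · intro a b
      exact Perm.sameCycle_subtypePerm.trans (Quotient.eq (r := orb m.opp)).symm
  have h1 := two_mul_nc_invol (τ := (ext m.opp).subtypePerm hτ)
    fun c => Subtype.ext (ext_opp_opp m c)
  have h2 := two_mul_nc_invol (τ := m.opp.subtypePerm hq) fun c => Subtype.ext (m.opp_opp c)
  have h3 : {x | (m.opp.subtypePerm hq) x = x} = ∅ := Set.eq_empty_of_forall_notMem fun x hx =>
    m.opp_ne x.1 (congrArg Subtype.val hx)
  rw [h3, Set.ncard_empty, add_zero] at h2
  have h4 : Nat.card {c // p c} = Nat.card {x // q x}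
      + {c | ((ext m.opp).subtypePerm hτ) c = c}.ncard := by
    have e1 : {c | ((ext m.opp).subtypePerm hτ) c = c}ᶜ
        = Set.range fun x : {x // q x} => (⟨.inl x.1, x.2⟩ : {c // p c}) := by
      ext ⟨c, hc⟩
      rw [Set.mem_compl_iff, Set.mem_ofPred_eq, Subtype.ext_iff, Perm.subtypePerm_apply,
        ext_opp_fix]
      constructor
      · intro h
        rcases c with x | i
        · exact ⟨⟨x, hc⟩, rfl⟩
        · exact absurd ⟨i, rfl⟩ h
      · rintro ⟨x, hx⟩ ⟨i, rfl⟩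
        exact absurd (congrArg Subtype.val hx) (by simp)
    have e2 := Set.ncard_add_ncard_compl {c | ((ext m.opp).subtypePerm hτ) c = c}
    rw [e1, ← Set.image_univ, Set.ncard_image_of_injective, Set.ncard_univ] at e2
    · omega
    · intro x y hxy
      exact Subtype.ext (Sum.inl_injective (congrArg Subtype.val hxy))
  omega

/-- Summed over the components, Euler's formula reads `V - E + F = 2 C`; the tree condition amounts
to connectedness and `F + 1 = C + R`. Together they give `V - E + R = C + 1`. Conversely, both
relations hold as inequalities, by `component_euler_le` and the edge bound for connected graphs, so
equality in the combination forces equality in each. -/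
theorem isPlanar_iff (hn : 0 < n) : m.IsPlanar ↔
    Euler (ext m.rot) (ext m.opp) m.region ∧
      orb (ext m.rot) ⊔ orb (ext m.opp) ⊔ m.region = ⊤ := by
  classical
  have : Fintype m.Component := Fintype.ofFinite _
  have hV : ∑ K : m.Component, {i : Fin n | m.comp i = K}.ncard = n := by
    have := ncard_eq_sum_fiber (Set.univ : Set (Fin n)) m.comp Finset.univ (by simp)
    rw [Set.ncard_univ, Nat.card_fin] at this
    simpa using this.symm
  have hF : ∑ K : m.Component,
      {f : m.Face | ∃ c : Corner d, m.face c = f ∧ m.comp c.vertex = K}.ncard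
      = Nat.card m.Face := by
    rw [← Set.ncard_univ, ncard_eq_sum_fiber Set.univ (faceComp m) Finset.univ (by simp)]
    refine Finset.sum_congr rfl fun K _ => ?_
    congr 1
    ext f
    induction f using Quotient.inductionOn with | _ c
    constructor
    · rintro ⟨c', h1, h2⟩
      refine ⟨trivial, ?_⟩
      rw [← h2]
      exact (congrArg (faceComp m) h1).symm
    · rintro ⟨_, h⟩
      exact ⟨c, rfl, h⟩
  have hE : ∑ K : m.Component,
      {e : m.Edge | ∃ x : HalfEdge d, Quotient.mk _ x = e ∧ m.comp x.1 = K}.ncard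
      = Nat.card m.Edge := by
    rw [← Set.ncard_univ, ncard_eq_sum_fiber Set.univ (edgeComp m) Finset.univ (by simp)]
    refine Finset.sum_congr rfl fun K _ => ?_
    congr 1
    ext f
    induction f using Quotient.inductionOn with | _ c
    constructor
    · rintro ⟨c', h1, h2⟩
      refine ⟨trivial, ?_⟩
      rw [← h2]
      exact (congrArg (edgeComp m) h1).symm
    · rintro ⟨_, h⟩
      exact ⟨c, rfl, h⟩
  have hplanar : (∀ K, m.ComponentPlanar K) ↔
      n + Nat.card m.Face = 2 * Nat.card m.Component + Nat.card m.Edge := by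
    have h1 := Finset.sum_eq_sum_iff_of_le (s := Finset.univ) fun K _ => component_euler_le m K
    rw [Finset.sum_add_distrib, Finset.sum_add_distrib, hV, hF, hE, Finset.sum_const,
      Finset.card_univ, smul_eq_mul, mul_comm, ← Nat.card_eq_fintype_card] at h1
    rw [h1]
    refine forall_congr' fun K => ?_
    simp only [Finset.mem_univ, true_implies, CombMap.ComponentPlanar]
    omega
  have hcard : Nat.card (m.Component ⊕ m.Face ⊕ m.Region)
      = Nat.card m.Component + (Nat.card m.Face + nc m.region) := by
    rw [Nat.card_sum, Nat.card_sum]; rfl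
  have hEuler : orb (ext m.rot) ⊔ orb (ext m.opp) ⊔ m.region = ⊤ →
      (Euler (ext m.rot) (ext m.opp) m.region ↔
        n + nc m.region = Nat.card m.Component + 1 + Nat.card m.Edge) := by
    intro h
    have : Nonempty (Corner d) := ⟨(exists_vertex ⟨0, hn⟩).choose⟩
    have := card_edge_add m
    rw [Euler, h, nc_rot, nc_comp, nc_eq_one rfl]
    omega
  rw [CombMap.IsPlanar, hplanar, SimpleGraph.isTree_iff_connected_and_card,
    gluingGraph_connected m hn, card_gluingGraph_edgeSet, hcard]
  constructor
  · rintro ⟨h1, h2, h3⟩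
    refine ⟨(hEuler h2).2 ?_, h2⟩
    omega
  · rintro ⟨h1, h2⟩
    have h3 := (hEuler h2).1 h1
    have h4 := ((gluingGraph_connected m hn).2 h2).card_vert_le_card_edgeSet_add_one
    rw [card_gluingGraph_edgeSet, hcard] at h4
    have h5 := Finset.sum_le_sum (s := Finset.univ) fun K _ => component_euler_le m K
    rw [Finset.sum_add_distrib, Finset.sum_add_distrib, hV, hF, hE, Finset.sum_const,
      Finset.card_univ, smul_eq_mul, mul_comm, ← Nat.card_eq_fintype_card] at h5
    refine ⟨?_, h2, ?_⟩ <;> omega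

/-- A face with several edge sides provides another corner by itself. The corner of a vertex of
valency zero cannot be a whole region either, since there is another vertex to be connected with. -/
theorem noMonogon_iff (hn : 2 ≤ n)
    (h : orb (ext m.rot) ⊔ orb (ext m.opp) ⊔ m.region = ⊤) :
    m.NoMonogon ↔ ∀ c, ∃ c', c' ≠ c ∧ m.region c c' := by
  constructor
  · rintro hm (x | i)
    · by_cases hx : m.rot (m.opp x) = x
      · exact hm x hx
      · exact ⟨_, fun h => hx (Sum.inl.inj h), m.region_face x⟩
    · by_contra! hno
      have hnt : ∃ j, j ≠ i.1 := by
        have : Nontrivial (Fin n) := Fin.nontrivial_iff_two_le.2 hn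
        exact exists_ne i.1
      obtain ⟨j, hj⟩ := hnt
      obtain ⟨c, rfl⟩ := exists_vertex (d := d) j
      have hp : Resp (fun c => c = Sum.inr i) (orb (ext m.rot) ⊔ orb (ext m.opp) ⊔ m.region) := by
        refine (Resp.sup (resp_orb ?_) (resp_orb ?_)).sup (resp_iff.2 ?_)
        · rintro (x | j) <;> simp [ext_inl, ext_inr]
        · rintro (x | j) <;> simp [ext_inl, ext_inr]
        · intro a b hab
          constructor
          · rintro rfl
            by_contra hb
            exact hno b hb hab
          · rintro rfl
            by_contra ha
            exact hno a ha (m.region.symm hab)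
      rw [h] at hp
      have := (resp_iff.1 hp (.inr i) c trivial).1 rfl
      rw [this] at hj
      exact hj rfl
  · intro h x _
    exact h (.inl x)

theorem isPlanar_noMonogon_iff (hn : 2 ≤ n) : m.IsPlanar ∧ m.NoMonogon ↔
    IsMap (ext m.rot) (Set.range Sum.inr) (ext m.opp) m.region := by
  rw [isPlanar_iff m (by omega)]
  constructor
  · rintro ⟨⟨h1, h2⟩, h3⟩
    exact ⟨ext_opp_opp m, ext_opp_fix m, region_faceStep m, h1, h2, (noMonogon_iff m hn h2).1 h3⟩
  · intro h
    exact ⟨⟨h.euler, h.conn⟩, (noMonogon_iff m hn h.conn).2 h.nosing⟩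

end Euler

/-! ### Renumbering of the half-edges -/

section Conjugation
variable {D : Type} {σ τ : Perm D} {X : Set D} {R : Setoid D}

theorem comap_sup (f : Perm D) (r s : Setoid D) :
    (r ⊔ s).comap f = r.comap f ⊔ s.comap f := by
  refine le_antisymm ?_ (sup_le (fun _ _ h => (le_sup_left : r ≤ r ⊔ s) h)
    fun _ _ h => (le_sup_right : s ≤ r ⊔ s) h)
  have key : ∀ q : Setoid D, q.comap f ≤ r.comap f ⊔ s.comap f →
      q ≤ (r.comap f ⊔ s.comap f).comap f.symm := fun q hq a b hab =>
    hq (by rw [Setoid.comap_rel, apply_symm_apply, apply_symm_apply]; exact hab)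
  intro a b hab
  have := sup_le (key r le_sup_left) (key s le_sup_right) hab
  rwa [Setoid.comap_rel, symm_apply_apply, symm_apply_apply] at this

theorem orb_conj (f g : Perm D) : orb (f * g * f⁻¹) = (orb g).comap (f⁻¹ : Perm D) := by
  ext a b
  exact Perm.sameCycle_conj

theorem IsMap.conj [Finite D] (h : IsMap σ X τ R) (f : Perm D) (hf : ∀ c, f c ∈ X ↔ c ∈ X) :
    IsMap (f * σ * f⁻¹) X (f * τ * f⁻¹) (R.comap (f⁻¹ : Perm D)) := by
  have hi : ∀ c, f⁻¹ (f c) = c := f.symm_apply_apply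
  have hi' : ∀ c, f (f⁻¹ c) = c := f.apply_symm_apply
  refine ⟨fun c => ?_, fun c => ?_, fun c => ?_, ?_, ?_, fun c => ?_⟩
  · simp only [Perm.mul_apply, hi, h.invol, hi']
  · have h1 : f (τ (f⁻¹ c)) = f (f⁻¹ c) ↔ f (f⁻¹ c) ∈ X :=
      f.injective.eq_iff.trans ((h.fix _).trans (hf _).symm)
    rwa [hi'] at h1
  · simp only [Setoid.comap_rel, Perm.mul_apply, hi]
    exact h.face _
  · have := h.euler
    have hs := (f⁻¹ : Perm D).surjective
    rw [Euler, orb_conj, orb_conj, ← comap_sup, ← comap_sup, nc_comap hs, nc_comap hs, nc_comap hs,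
      nc_comap hs, nc_comap hs]
    exact this
  · rw [orb_conj, orb_conj, ← comap_sup, ← comap_sup, h.conn]
    rfl
  · obtain ⟨c', h1, h2⟩ := h.nosing (f⁻¹ c)
    refine ⟨f c', fun hc => h1 (by rw [← hc, hi]), ?_⟩
    rw [Setoid.comap_rel, hi]
    exact h2

end Conjugation

section Rotation
variable {n : ℕ} {d : Fin n → ℕ} {ρ ρ' : Perm (HalfEdge d)}

theorem ncard_vertex (i : Fin n) : ((Sigma.fst : HalfEdge d → Fin n) ⁻¹' {i}).ncard = d i := by
  have : (Sigma.fst : HalfEdge d → Fin n) ⁻¹' {i} = Set.range (Sigma.mk i) := by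
    ext ⟨j, k⟩
    constructor
    · rintro rfl
      exact ⟨k, rfl⟩
    · rintro ⟨k', hk⟩
      exact (congrArg Sigma.fst hk).symm
  rw [this, ← Set.image_univ, Set.ncard_image_of_injective _ sigma_mk_injective, Set.ncard_univ,
    Nat.card_fin]

theorem fst_pow (h : ∀ x y, ρ.SameCycle x y ↔ x.1 = y.1) (x : HalfEdge d) (i : ℕ) :
    ((ρ ^ i) x).1 = x.1 :=
  label_pow (v := Sigma.fst) h x i

theorem val_finRotate {N : ℕ} (k : Fin N) :
    (finRotate N k).val = if k.val + 1 = N then 0 else k.val + 1 := by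
  rcases N with _ | N
  · exact k.elim0
  · rw [coe_finRotate]
    simp only [Fin.ext_iff, Fin.val_last, Nat.add_right_cancel_iff]

/-- The standard rotation. -/
def stdRot (d : Fin n → ℕ) : Perm (HalfEdge d) := Equiv.sigmaCongrRight fun i => finRotate (d i)

/-- At each vertex the half-edges are numbered by powers of `ρ` from a base half-edge; the
wrap-around holds since the period is the valency. -/
theorem exists_conj (h : ∀ x y, ρ.SameCycle x y ↔ x.1 = y.1) :
    ∃ f : Perm (HalfEdge d), (∀ x, (f x).1 = x.1) ∧ ∀ x, f (stdRot d x) = ρ (f x) := by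
  let b : ∀ x : HalfEdge d, HalfEdge d := fun x => ⟨x.1, ⟨0, Fin.pos x.2⟩⟩
  let f : HalfEdge d → HalfEdge d := fun x => (ρ ^ x.2.val) (b x)
  have hv : ∀ x, (f x).1 = x.1 := fun x => fst_pow h _ _
  have hinj : Function.Injective f := by
    rintro ⟨i, k⟩ ⟨j, l⟩ hkl
    have hij : i = j := by
      have := congrArg Sigma.fst hkl
      rwa [hv, hv] at this
    subst hij
    have hc := ncard_vertex (d := d) i
    have := (pow_inj (v := Sigma.fst) h (z := b ⟨i, k⟩) hc k.2 l.2).1 hkl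
    rw [Fin.ext this]
  refine ⟨Equiv.ofBijective f (Finite.injective_iff_bijective.1 hinj), hv, ?_⟩
  rintro ⟨i, k⟩
  change (ρ ^ (finRotate (d i) k).val) ⟨i, ⟨0, _⟩⟩ = ρ ((ρ ^ k.val) ⟨i, ⟨0, _⟩⟩)
  rw [← Perm.mul_apply, ← pow_succ', val_finRotate]
  split_ifs with hk
  · rw [hk, pow_zero]
    exact (pow_period (v := Sigma.fst) h (z := (⟨i, ⟨0, Fin.pos k⟩⟩ : HalfEdge d)) (ncard_vertex i)).symm
  · rfl

theorem stdRot_cyclic (x y : HalfEdge d) : (stdRot d).SameCycle x y ↔ x.1 = y.1 := by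
  constructor
  · intro h
    have : orb (stdRot d) ≤ Setoid.ker Sigma.fst := orb_le.2 fun c => rfl
    exact this h
  · obtain ⟨i, k⟩ := x
    obtain ⟨j, l⟩ := y
    rintro (rfl : i = j)
    have key : ∀ (m : ℕ) (hm : m < d i),
        orb (stdRot d) ⟨i, ⟨0, Nat.zero_lt_of_lt hm⟩⟩ ⟨i, ⟨m, hm⟩⟩ := by
      intro m
      induction m with
      | zero => exact fun _ => Setoid.refl' _ _
      | succ m ih =>
        intro hm
        refine Setoid.trans' _ (ih (by omega)) ?_
        have := orb_apply (stdRot d) ⟨i, ⟨m, by omega⟩⟩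
        convert this using 1
        change _ = (⟨i, _⟩ : HalfEdge d)
        congr 1
        apply Fin.ext
        rw [val_finRotate, if_neg (by simp only; omega)]
    exact Setoid.trans' _ (Setoid.symm' _ (key k.1 k.2)) (key l.1 l.2)

/-- The symmetries of the standard rotation that fix the vertices. -/
def rotSymm (d : Fin n → ℕ) : Set (Perm (HalfEdge d)) :=
  {e | (∀ x, (e x).1 = x.1) ∧ ∀ x, e (stdRot d x) = stdRot d (e x)}

theorem commute_pow {e : Perm (HalfEdge d)} (h : ∀ x, e (ρ x) = ρ (e x)) (i : ℕ) (x : HalfEdge d) :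
    e ((ρ ^ i) x) = (ρ ^ i) (e x) := by
  induction i with
  | zero => rfl
  | succ i ih => rw [pow_succ', Perm.mul_apply, Perm.mul_apply, h, ih]

theorem card_rotSymm (d : Fin n → ℕ) : Nat.card (rotSymm d) = ∏ i, max (d i) 1 := by
  have hc := stdRot_cyclic (d := d)
  let F : (∀ i, Fin (max (d i) 1)) → HalfEdge d → HalfEdge d := fun s x => (stdRot d ^ (s x.1).val) x
  have hv : ∀ s x, (F s x).1 = x.1 := fun s x => fst_pow hc _ _
  have hinj : ∀ s, Function.Injective (F s) := fun s x y hxy => by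
    have h1 : x.1 = y.1 := by rw [← hv s x, hxy, hv]
    change (stdRot d ^ (s x.1).val) x = (stdRot d ^ (s y.1).val) y at hxy
    rw [show (s x.1).val = (s y.1).val by rw [h1]] at hxy
    exact (stdRot d ^ (s y.1).val).injective hxy
  let E : (∀ i, Fin (max (d i) 1)) → rotSymm d := fun s =>
    ⟨Equiv.ofBijective (F s) (Finite.injective_iff_bijective.1 (hinj s)), hv s, fun x => by
      change (stdRot d ^ (s x.1).val) (stdRot d x) = stdRot d ((stdRot d ^ (s x.1).val) x)
      rw [← Perm.mul_apply, ← Perm.mul_apply, pow_mul_comm']⟩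
  have hE : ∀ s x, (E s).1 x = (stdRot d ^ (s x.1).val) x := fun _ _ => rfl
  rw [← Nat.card_congr (Equiv.ofBijective E ⟨fun s t hst => ?_, fun e => ?_⟩), Nat.card_pi]
  · simp
  · funext i
    rcases Nat.eq_zero_or_pos (d i) with h0 | h0
    · exact Fin.ext (by have := (s i).2; have := (t i).2; omega)
    · have h1 := congrArg (fun e => e.1 ⟨i, ⟨0, h0⟩⟩) hst
      simp only [hE] at h1
      have hl : ∀ k : Fin (max (d i) 1), k.val < d i := fun k => by have := k.2; omega
      exact Fin.ext ((pow_inj (v := Sigma.fst) hc (z := (⟨i, ⟨0, h0⟩⟩ : HalfEdge d)) (ncard_vertex i) (hl _) (hl _)).1 h1)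
  · have hex : ∀ i, ∃ k : Fin (max (d i) 1), ∀ h0 : 0 < d i,
        (stdRot d ^ k.val) ⟨i, ⟨0, h0⟩⟩ = e.1 ⟨i, ⟨0, h0⟩⟩ := by
      intro i
      rcases Nat.eq_zero_or_pos (d i) with h0 | h0
      · exact ⟨⟨0, by omega⟩, fun h => by omega⟩
      · obtain ⟨k, hk, h⟩ := exists_pow_lt (v := Sigma.fst) hc (z := (⟨i, ⟨0, h0⟩⟩ : HalfEdge d)) (c := e.1 ⟨i, ⟨0, h0⟩⟩)
          (ncard_vertex i) (e.2.1 _)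
        exact ⟨⟨k, by omega⟩, fun _ => h⟩
    choose s hs using hex
    refine ⟨s, Subtype.ext (Equiv.ext fun x => ?_)⟩
    have h0 : 0 < d x.1 := Fin.pos x.2
    obtain ⟨j, _, hj⟩ := exists_pow_lt (v := Sigma.fst) hc (z := (⟨x.1, ⟨0, h0⟩⟩ : HalfEdge d)) (c := x)
      (ncard_vertex x.1) rfl
    generalize hb : (⟨x.1, ⟨0, h0⟩⟩ : HalfEdge d) = b at hj
    calc (E s).1 x = (stdRot d ^ (s x.1).val) x := rfl
      _ = (stdRot d ^ (s x.1).val) ((stdRot d ^ j) b) := by rw [hj]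
      _ = (stdRot d ^ j) ((stdRot d ^ (s x.1).val) b) := by
        rw [← Perm.mul_apply, ← Perm.mul_apply, ← pow_add, ← pow_add, add_comm]
      _ = (stdRot d ^ j) (e.1 b) := by rw [← hb, hs x.1 h0]
      _ = e.1 ((stdRot d ^ j) b) := (commute_pow e.2.2 j b).symm
      _ = e.1 x := by rw [hj]

end Rotation

section Transport
variable {n : ℕ} {d : Fin n → ℕ}

theorem ext_mul (f g : Perm (HalfEdge d)) : ext (f * g) = ext f * ext g :=
  Equiv.ext fun c => by rcases c with x | i <;> rfl

theorem ext_inv (f : Perm (HalfEdge d)) : ext f⁻¹ = (ext f)⁻¹ := rfl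

/-- Renumbering of the half-edges of a map. -/
def transport (m : CombMap d) (e : Perm (HalfEdge d)) (he : ∀ x, (e x).1 = x.1) : CombMap d where
  rot := e * m.rot * e⁻¹
  rot_cyclic x y := by
    have hi : ∀ x, (e⁻¹ x).1 = x.1 := fun x => by
      rw [← he, show e (e⁻¹ x) = x from e.apply_symm_apply x]
    rw [Perm.sameCycle_conj, m.rot_cyclic, hi, hi]
  opp := e * m.opp * e⁻¹
  opp_opp x := by simp [m.opp_opp]
  opp_ne x h := m.opp_ne (e⁻¹ x) (e.injective (h.trans (e.apply_symm_apply x).symm))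
  region := m.region.comap (ext e⁻¹)
  region_face x := by
    rw [Setoid.comap_rel, ext_inl, ext_inl]
    simpa using m.region_face (e⁻¹ x)

theorem combMap_ext {m m' : CombMap d} (h1 : m.rot = m'.rot) (h2 : m.opp = m'.opp)
    (h3 : m.region = m'.region) : m = m' := by
  cases m; cases m'; simp only at h1 h2 h3; subst h1 h2 h3; rfl

theorem mapIso_iff {m m' : CombMap d} : MapIso m m' ↔ ∃ e he, m' = transport m e he := by
  constructor
  · rintro ⟨e, h1, h2, h3, h4⟩
    refine ⟨e, h1, combMap_ext (Equiv.ext fun x => ?_) (Equiv.ext fun x => ?_)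
      (Setoid.ext fun a b => ?_)⟩
    · change _ = e (m.rot (e.symm x))
      rw [h2, apply_symm_apply]
    · change _ = e (m.opp (e.symm x))
      rw [h3, apply_symm_apply]
    · change _ ↔ m.region (cornerMap e.symm a) (cornerMap e.symm b)
      rw [h4, cornerMap_symm, cornerMap_symm]
  · rintro ⟨e, he, rfl⟩
    refine ⟨e, he, fun x => ?_, fun x => ?_, fun c c' => ?_⟩
    · change _ = e (m.rot (e.symm (e x)))
      rw [symm_apply_apply]
    · change _ = e (m.opp (e.symm (e x)))
      rw [symm_apply_apply]
    · change _ ↔ m.region (cornerMap e.symm (cornerMap e c)) (cornerMap e.symm (cornerMap e c'))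
      have := cornerMap_symm e.symm
      rw [symm_symm] at this
      rw [this, this]

theorem transport_good (hn : 2 ≤ n) {m : CombMap d} (h : m.IsPlanar ∧ m.NoMonogon)
    (e : Perm (HalfEdge d)) (he : ∀ x, (e x).1 = x.1) :
    (transport m e he).IsPlanar ∧ (transport m e he).NoMonogon := by
  rw [isPlanar_noMonogon_iff _ hn] at h ⊢
  have := h.conj (ext e) fun c => by rcases c with x | i <;> simp [ext_inl, ext_inr]
  rw [← ext_inv, ← ext_mul, ← ext_mul, ← ext_mul, ← ext_mul] at this
  exact this

theorem transport_eq_self (hn : 3 ≤ n) {m : CombMap d} (h : m.IsPlanar ∧ m.NoMonogon)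
    {e : Perm (HalfEdge d)} (he : ∀ x, (e x).1 = x.1) (heq : transport m e he = m) : e = 1 := by
  rw [isPlanar_noMonogon_iff _ (by omega)] at h
  have hr : ∀ x, e (m.rot x) = m.rot (e x) := fun x => by
    have : e * m.rot * e⁻¹ = m.rot := congrArg CombMap.rot heq
    conv_rhs => rw [← this]
    simp
  have ho : ∀ x, e (m.opp x) = m.opp (e x) := fun x => by
    have : e * m.opp * e⁻¹ = m.opp := congrArg CombMap.opp heq
    conv_rhs => rw [← this]
    simp
  have hR : ∀ a b, m.region a b → m.region (ext e a) (ext e b) := fun a b hab => by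
    have : m.region.comap (ext e⁻¹) = m.region := congrArg CombMap.region heq
    rw [← this, Setoid.comap_rel, ext_inv, Perm.inv_def, symm_apply_apply, symm_apply_apply]
    exact hab
  refine Equiv.ext fun x => Sum.inl_injective (rigid h ?_ (fun a b => ?_) (e := ext e) (fun c => ?_)
    (fun c => ?_) hR (.inl x))
  · rintro c ⟨i, rfl⟩
    rfl
  · obtain ⟨i, hi⟩ : ∃ i : Fin n, i ∉ ({a.vertex, b.vertex} : Finset (Fin n)) := by
      by_contra! hall
      have h1 := Finset.card_le_card (show Finset.univ ⊆ ({a.vertex, b.vertex} : Finset (Fin n))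
        from fun i _ => hall i)
      have h2 := Finset.card_le_two (a := a.vertex) (b := b.vertex)
      rw [Finset.card_univ, Fintype.card_fin] at h1
      omega
    obtain ⟨u, rfl⟩ := exists_vertex (d := d) i
    simp only [Finset.mem_insert, Finset.mem_singleton, not_or] at hi
    exact ⟨u, fun h => hi.1 ((ext_sameCycle m.rot_cyclic a u).1 h).symm,
      fun h => hi.2 ((ext_sameCycle m.rot_cyclic b u).1 h).symm⟩
  · rw [ext_sameCycle m.rot_cyclic]
    rcases c with x | i
    · exact (he x).symm
    · rfl
  · rcases c with x | i
    · rw [ext_inl, ext_inl, ext_inl, ext_inl, ho]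
    · rfl

theorem transport_mul (m : CombMap d) {e f : Perm (HalfEdge d)} (he : ∀ x, (e x).1 = x.1)
    (hf : ∀ x, (f x).1 = x.1) : transport (transport m e he) f hf =
      transport m (f * e) fun x => (hf (e x)).trans (he x) := by
  refine combMap_ext ?_ ?_ (Setoid.ext fun a b => ?_)
  · simp only [transport, mul_inv_rev, mul_assoc]
  · simp only [transport, mul_inv_rev, mul_assoc]
  · change m.region (ext e⁻¹ (ext f⁻¹ a)) (ext e⁻¹ (ext f⁻¹ b)) ↔
      m.region (ext (f * e)⁻¹ a) (ext (f * e)⁻¹ b)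
    rw [mul_inv_rev, ext_mul]
    rfl

/-- The maps with the standard rotation. -/
def stdMaps (d : Fin n → ℕ) : Set (CombMap d) :=
  {m | m.rot = stdRot d ∧ m.IsPlanar ∧ m.NoMonogon}

/-- Every class has a representative with the standard rotation. The symmetries of this rotation act
on such maps, with the isomorphism classes as orbits, and freely by `transport_eq_self`. -/
theorem card_planarMaps_mul (hn : 3 ≤ n) (d : Fin n → ℕ) :
    Nat.card (PlanarMaps d) * ∏ i, max (d i) 1 = (stdMaps d).ncard := by
  have hrep : ∀ q : PlanarMaps d, ∃ m : stdMaps d, Quotient.mk (planarMapSetoid d) ⟨m.1, m.2.2⟩ = q := by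
    intro q
    induction q using Quotient.inductionOn with | _ m
    obtain ⟨f, hf, hfr⟩ := exists_conj m.1.rot_cyclic
    have hf' : ∀ x, (f⁻¹ x).1 = x.1 := fun x => by
      rw [← hf, show f (f⁻¹ x) = x from f.apply_symm_apply x]
    refine ⟨⟨transport m.1 f⁻¹ hf', Equiv.ext fun x => ?_, transport_good (by omega) m.2 _ hf'⟩,
      Quotient.sound (MapIso.symm (mapIso_iff.2 ⟨f⁻¹, hf', rfl⟩))⟩
    change f.symm (m.1.rot (f x)) = _
    rw [← hfr, symm_apply_apply]
  choose rep hrep using hrep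
  rw [← card_rotSymm, ← Nat.card_prod, ← Nat.card_coe_set_eq]
  refine Nat.card_congr (Equiv.ofBijective (fun p : PlanarMaps d × rotSymm d =>
    (⟨transport (rep p.1).1 p.2.1 p.2.2.1, ?_, transport_good (by omega) (rep p.1).2.2 _ _⟩ :
      stdMaps d)) ⟨?_, ?_⟩)
  · refine Equiv.ext fun x => ?_
    change p.2.1 ((rep p.1).1.rot (p.2.1.symm x)) = _
    rw [(rep p.1).2.1, p.2.2.2, apply_symm_apply]
  · rintro ⟨q, e, he⟩ ⟨q', e', he'⟩ h
    have h1 : transport (rep q).1 e he.1 = transport (rep q').1 e' he'.1 := congrArg Subtype.val h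
    have hq : q = q' := by
      rw [← hrep q, ← hrep q']
      apply Quotient.sound
      have a1 : MapIso (rep q).1 (transport (rep q).1 e he.1) := mapIso_iff.2 ⟨_, _, rfl⟩
      have a2 : MapIso (rep q').1 (transport (rep q').1 e' he'.1) := mapIso_iff.2 ⟨_, _, rfl⟩
      rw [← h1] at a2
      exact a1.trans a2.symm
    subst hq
    have hi : ∀ x, (e'⁻¹ x).1 = x.1 := fun x => by
      rw [← he'.1, show e' (e'⁻¹ x) = x from e'.apply_symm_apply x]
    have h2 : transport (rep q).1 (e'⁻¹ * e) (fun x => (hi (e x)).trans (he.1 x)) = (rep q).1 := by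
      rw [← transport_mul _ he.1 hi, h1, transport_mul]
      refine combMap_ext ?_ ?_ (Setoid.ext fun a b => ?_)
      · simp [transport]
      · simp [transport]
      · change (rep q).1.region (ext (e'⁻¹ * e')⁻¹ a) (ext (e'⁻¹ * e')⁻¹ b) ↔ _
        rw [inv_mul_cancel, inv_one]
        rcases a with a | a <;> rcases b with b | b <;> rfl
    have h3 := transport_eq_self hn (rep q).2.2 _ h2
    have h4 : e = e' := (inv_mul_eq_one.1 h3).symm
    subst h4
    rfl
  · intro m
    have h1 := Quotient.exact (hrep (Quotient.mk (planarMapSetoid d) ⟨m.1, m.2.2⟩))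
    generalize (Quotient.mk (planarMapSetoid d) ⟨m.1, m.2.2⟩ : PlanarMaps d) = q at h1
    obtain ⟨e, he, h2⟩ := mapIso_iff.1 (show MapIso (rep q).1 m.1 from h1)
    have h3 : m.1.rot = e * (rep q).1.rot * e⁻¹ := congrArg CombMap.rot h2
    rw [m.2.1, (rep q).2.1] at h3
    refine ⟨⟨q, e, he, fun x => ?_⟩, Subtype.ext h2.symm⟩
    simpa using (congrArg (fun f : Perm (HalfEdge d) => f (e x)) h3).symm

/-- With the rotation fixed, a map is given by its edges and regions. The marks are the corners of
valency zero, so `τ` restricts to the half-edges without fixed points. -/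
theorem ncard_stdMaps (hn : 2 ≤ n) (d : Fin n → ℕ) :
    (stdMaps d).ncard = cnt (ext (stdRot d)) (Set.range Sum.inr) := by
  let F : CombMap d → Perm (Corner d) × Setoid (Corner d) := fun m => (ext m.opp, m.region)
  have hF : Set.InjOn F (stdMaps d) := by
    intro m hm m' hm' h
    refine combMap_ext (hm.1.trans hm'.1.symm) (Equiv.ext fun x => ?_) (congrArg Prod.snd h)
    have : ext m.opp (.inl x) = ext m'.opp (.inl x) := by rw [show ext m.opp = ext m'.opp from congrArg Prod.fst h]
    exact Sum.inl_injective this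
  rw [cnt, ← hF.ncard_image]
  congr 1
  ext ⟨τ, R⟩
  constructor
  · rintro ⟨m, ⟨h1, h2⟩, h⟩
    rw [isPlanar_noMonogon_iff m hn, h1] at h2
    rw [← h]
    exact h2
  · intro h
    replace h : IsMap (ext (stdRot d)) (Set.range Sum.inr) τ R := h
    have hr : ∀ i, τ (.inr i) = .inr i := fun i => (h.fix _).2 ⟨i, rfl⟩
    have hl : ∀ x : HalfEdge d, ∃ y, τ (.inl x) = .inl y := fun x => by
      rcases hx : τ (.inl x) with y | i
      · exact ⟨y, rfl⟩
      · exact absurd (τ.injective (hx.trans (hr i).symm)) (by simp)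
    choose o ho using hl
    have hoo : ∀ x, o (o x) = x := fun x => by
      have := h.invol (.inl x)
      rw [ho, ho] at this
      exact Sum.inl_injective this
    let m : CombMap d :=
      { rot := stdRot d
        rot_cyclic := stdRot_cyclic
        opp := ⟨o, o, hoo, hoo⟩
        opp_opp := hoo
        opp_ne := fun x hx => by
          obtain ⟨i, hi⟩ := (h.fix (.inl x)).1 ((ho x).trans (congrArg _ hx))
          cases hi
        region := R
        region_face := fun x => by
          have := h.face (.inl x)
          rw [ho, ext_inl] at this
          exact this }
    have hm : ext m.opp = τ := Equiv.ext fun c => by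
      rcases c with x | i
      · exact (ho x).symm
      · exact (hr i).symm
    refine ⟨m, ⟨rfl, ?_⟩, Prod.ext hm rfl⟩
    rw [isPlanar_noMonogon_iff m hn, hm]
    exact h

end Transport

/-! ### Maps with four vertices -/

theorem regSet_vertex {n : ℕ} (d : Fin n → ℕ) (i : Fin n) :
    RegSet (Set.range (Sum.inr : _ → Corner d)) {c : Corner d | c.vertex = i} (d i) := by
  constructor
  · rcases Nat.eq_zero_or_pos (d i) with h | h
    · have : {c : Corner d | c.vertex = i} = {.inr ⟨i, h⟩} := by
        ext c
        rcases c with x | j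
        · refine iff_of_false (fun hx => ?_) (by simp)
          have hx' : x.1 = i := hx
          have := Fin.pos x.2
          rw [hx'] at this
          omega
        · exact ⟨fun hj => congrArg Sum.inr (Subtype.ext hj), fun hj => by
            rw [Set.mem_singleton_iff.1 hj]; rfl⟩
      rw [this, Set.ncard_singleton, h]
      rfl
    · have : {c : Corner d | c.vertex = i} = Sum.inl '' ((Sigma.fst : HalfEdge d → Fin n) ⁻¹' {i}) := by
        ext c
        rcases c with x | j
        · exact ⟨fun hx => ⟨x, hx, rfl⟩, fun ⟨y, hy, hyx⟩ => Sum.inl_injective hyx ▸ hy⟩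
        · refine iff_of_false (fun hj => ?_) (by simp)
          have hj' : j.1 = i := hj
          have := j.2
          rw [hj'] at this
          omega
      rw [this, Set.ncard_image_of_injective _ Sum.inl_injective, ncard_vertex]
      omega
  · rintro (x | j) h
    · have hx : x.1 = i := h
      have := Fin.pos x.2
      rw [hx] at this
      exact iff_of_false (by simp) (by omega)
    · have hj : j.1 = i := h
      exact iff_of_true ⟨j, rfl⟩ (hj ▸ j.2)

theorem cnt_stdRot (d : Fin 4 → ℕ) {n : ℕ}
    (h : PlainVal {0, 1, 2} (fun i : Fin 3 => d i.succ) (d 0) n) :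
    cnt (ext (stdRot d)) (Set.range (Sum.inr : _ → Corner d)) = n := by
  refine h _ _ _ (fun c => finSuccEquiv 3 c.vertex) ⟨fun a b => ?_, fun i _ => ?_, fun c i _ => ?_⟩ ?_
  · rw [ext_sameCycle stdRot_cyclic, (finSuccEquiv 3).injective.eq_iff]
  · convert regSet_vertex d i.succ using 1
    ext c
    rw [Set.mem_preimage, Set.mem_singleton_iff, ← finSuccEquiv_succ,
      (finSuccEquiv 3).injective.eq_iff]
    rfl
  · fin_cases i <;> simp
  · convert regSet_vertex d 0 using 1
    ext c
    rw [Set.mem_preimage, Set.mem_singleton_iff, ← finSuccEquiv_zero,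
      (finSuccEquiv 3).injective.eq_iff]
    rfl

theorem card_planarMaps_four (d : Fin 4 → ℕ) : (Nat.card (PlanarMaps d) : ℚ) =
    if ∀ i, d i = 0 then 1 else
      if Even (d 0 + d 1 + d 2 + d 3) then
        ((d 0 : ℚ) ^ 2 + d 1 ^ 2 + d 2 ^ 2 + d 3 ^ 2) / 4
          + if Even (d 0 + d 1) ∧ Even (d 0 + d 2) then 2 else 1 / 2
      else 0 := by
  have h := card_planarMaps_mul (by omega) d
  rw [ncard_stdMaps (by omega)] at h
  split_ifs with h0 h1 h2
  · rw [cnt_stdRot d (n := 1)] at h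
    · have : ∏ i, max (d i) 1 = 1 := Finset.prod_eq_one fun i _ => by rw [h0 i]; rfl
      rw [this, mul_one] at h
      rw [h]; rfl
    · rw [h0 0]
      exact plain_all_zero (Finset.insert_nonempty _ _) fun i _ => h0 _
  all_goals
    obtain ⟨N, hN, hP⟩ := plain_triple (j := (0 : Fin 3)) (k := 1) (l := 2) (by decide) (by decide)
      (by decide) (fun i => d i.succ) (d 0) (fun hh => h0 fun i => by
        fin_cases i
        exacts [hh.1, hh.2.1, hh.2.2.1, hh.2.2.2])
    rw [cnt_stdRot d hP, Fin.prod_univ_four] at h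
    have hpos : ((max (d 0) 1 * max (d 1) 1 * max (d 2) 1 * max (d 3) 1 : ℕ) : ℚ) ≠ 0 := by
      rw [Nat.cast_ne_zero]
      have : ∀ k, max k 1 ≠ 0 := fun k => by omega
      simp only [ne_eq, mul_eq_zero, this, or_self, not_false_eq_true]
    rw [← h, Nat.cast_mul] at hN
    change _ = fourVal (d 0) (d 1) (d 2) (d 3) at hN
    apply mul_right_cancel₀ hpos
    rw [hN, fourVal]
  · rw [if_pos h1, if_pos h2, mul_comm]
  · rw [if_pos h1, if_neg h2, mul_comm]
  · rw [if_neg h1, zero_mul]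

theorem exists_natCast_iff {r : ℚ} {d : ℕ} (h : (d : ℚ) = 2 * r) : (∃ k : ℕ, r = k) ↔ Even d := by
  constructor
  · rintro ⟨k, rfl⟩
    exact ⟨k, by have : d = 2 * k := by exact_mod_cast h
                 omega⟩
  · rintro ⟨k, rfl⟩
    refine ⟨k, ?_⟩
    push_cast at h
    linarith

theorem exists_half_iff {r : ℚ} {d : ℕ} (h : (d : ℚ) = 2 * r) :
    (∃ k : ℕ, r = k + 1 / 2) ↔ ¬ Even d := by
  rw [Nat.not_even_iff_odd]
  constructor
  · rintro ⟨k, rfl⟩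
    refine ⟨k, ?_⟩
    have : (d : ℚ) = (2 * k + 1 : ℕ) := by rw [h]; push_cast; ring
    exact_mod_cast this
  · rintro ⟨k, rfl⟩
    refine ⟨k, ?_⟩
    push_cast at h
    linarith

/-- For a half-integer, `(k + 1 / 2) ^ 2 = k ^ 2 + k + 1 / 4`. -/
theorem floor_sq {r : ℚ} {d : ℕ} (h : (d : ℚ) = 2 * r) :
    (⌊r ^ 2⌋ : ℚ) = r ^ 2 - if Even d then 0 else 1 / 4 := by
  split_ifs with hd
  · obtain ⟨k, rfl⟩ := (exists_natCast_iff h).2 hd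
    have : (k : ℚ) ^ 2 = ((k ^ 2 : ℕ) : ℚ) := by push_cast; ring
    rw [this, Int.floor_natCast]
    simp
  · obtain ⟨k, rfl⟩ := (exists_half_iff h).2 hd
    have : ⌊((k : ℚ) + 1 / 2) ^ 2⌋ = (k : ℤ) ^ 2 + k := by
      rw [Int.floor_eq_iff]
      push_cast
      constructor <;> nlinarith
    rw [this]
    push_cast
    ring

end SphMap

theorem mainTheorem2 (r : Fin 4 → ℚ) (d : Fin 4 → ℕ) (hd : ∀ i, (d i : ℚ) = 2 * r i) :
    ((∀ i, ∃ k : ℕ, r i = k) →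
      (Nat.card (PlanarMaps d) : ℚ) = ∑ i, r i ^ 2 + 2 - Z04 {i | r i = 0}.ncard ∧
      (Nat.card (PlanarMaps d) : ℚ) = ∑ i, r i ^ 2 + 2 - ∏ i, (if r i = 0 then 1 else 0)) ∧
    ({i | ∃ k : ℕ, r i = k + 1 / 2}.ncard = 2 →
      (Nat.card (PlanarMaps d) : ℤ) = ∑ i, ⌊r i ^ 2⌋ + 1) ∧
    ((∀ i, ∃ k : ℕ, r i = k + 1 / 2) →
      (Nat.card (PlanarMaps d) : ℤ) = ∑ i, ⌊r i ^ 2⌋ + 3) := by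
  have hN := SphMap.card_planarMaps_four d
  have hsq : ((d 0 : ℚ) ^ 2 + d 1 ^ 2 + d 2 ^ 2 + d 3 ^ 2) / 4
      = r 0 ^ 2 + r 1 ^ 2 + r 2 ^ 2 + r 3 ^ 2 := by
    rw [hd, hd, hd, hd]; ring
  rw [hsq] at hN
  have hfl := fun i => SphMap.floor_sq (hd i)
  have hz : ∀ i, r i = 0 ↔ d i = 0 := fun i => by
    rw [← Nat.cast_eq_zero (R := ℚ), hd]; simp
  simp only [fun i => SphMap.exists_natCast_iff (hd i), fun i => SphMap.exists_half_iff (hd i)]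
  refine ⟨fun h => ?_, fun h => ?_, fun h => ?_⟩
  · have he : ∀ i j, Even (d i + d j) := fun i j => (h i).add (h j)
    rw [Fin.sum_univ_four]
    by_cases h0 : ∀ i, d i = 0
    · have hr : ∀ i, r i = 0 := fun i => (hz i).2 (h0 i)
      rw [if_pos h0] at hN
      have : {i | r i = 0} = Set.univ := Set.eq_univ_of_forall hr
      rw [hN, this, Set.ncard_univ, Nat.card_fin, Finset.prod_eq_one fun i _ => if_pos (hr i)]
      simp only [hr, Z04]
      norm_num
    · rw [if_neg h0, if_pos (((he 0 1).add (h 2)).add (h 3)), if_pos ⟨he 0 1, he 0 2⟩] at hN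
      push Not at h0
      obtain ⟨j, hj⟩ := h0
      have hrj : r j ≠ 0 := fun hh => hj ((hz j).1 hh)
      have hcard : {i | r i = 0}.ncard ≠ 4 := fun hh => by
        have : {i | r i = 0} = Set.univ :=
          (Set.eq_univ_iff_ncard _).2 (by rw [hh, Nat.card_fin])
        exact hrj (show j ∈ {i | r i = 0} from this ▸ Set.mem_univ j)
      rw [hN, Finset.prod_eq_zero (Finset.mem_univ j) (if_neg hrj), Z04, if_neg hcard]
      simp
  · have h' : ((Finset.univ : Finset (Fin 4)).filter fun i => ¬ Even (d i)).card = 2 := by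
      rw [← h, ← Set.ncard_coe_finset]
      congr 1
      ext i
      simp
    rw [Finset.card_filter, Fin.sum_univ_four] at h'
    have h0 : ¬ ∀ i, d i = 0 := fun hh => by simp [hh] at h'
    rw [if_neg h0] at hN
    have : (Nat.card (PlanarMaps d) : ℚ) = ((∑ i, ⌊r i ^ 2⌋ + 1 : ℤ) : ℚ) := by
      push_cast
      rw [Fin.sum_univ_four, hfl, hfl, hfl, hfl, hN]
      -- With two odd valencies the constant is `1 / 2`, and two floors remove `1 / 4` each; this
      -- makes up the `1`. With four odd valencies it is `2 + 4 / 4 = 3`.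
      by_cases e0 : Even (d 0) <;> by_cases e1 : Even (d 1) <;> by_cases e2 : Even (d 2) <;>
        by_cases e3 : Even (d 3) <;> simp [e0, e1, e2, e3] at h' <;>
        simp [Nat.even_add, e0, e1, e2, e3] <;> ring
    exact_mod_cast this
  · have h0 : ¬ ∀ i, d i = 0 := fun hh => h 0 (by rw [hh 0]; exact Even.zero)
    have he : ∀ i j, Even (d i + d j) := fun i j => by simp [Nat.even_add, h]
    have hs : Even (d 0 + d 1 + d 2 + d 3) := by rw [add_assoc]; exact (he 0 1).add (he 2 3)
    rw [if_neg h0, if_pos hs, if_pos ⟨he 0 1, he 0 2⟩] at hN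
    have : (Nat.card (PlanarMaps d) : ℚ) = ((∑ i, ⌊r i ^ 2⌋ + 3 : ℤ) : ℚ) := by
      push_cast
      rw [Fin.sum_univ_four, hfl, hfl, hfl, hfl, hN, if_neg (h 0), if_neg (h 1), if_neg (h 2),
        if_neg (h 3)]
      ring
    exact_mod_cast this
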